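/- Let $V_0$ be a finite-dimensional real vector space and $R\subset V_0$ a finite reduced (not necessarily crystallographic, not necessarily spanning) root system with coroots $\alpha^\vee\in V_0^\vee=\mathrm{Hom}_{\mathbb R}(V_0,\mathbb R)$, so that $s_\alpha(v)=v-\langle v,\alpha^\vee\rangle\alpha$, and let $W$ be the finite reflection group generated by the $s_\alpha$ $(\alpha\in R)$. Let $\Pi\subset R$ be a set of simple roots: $\Pi$ is linearly independent and every root is a real linear combination of elements of $\Pi$ whose coefficients are all nonnegative or all nonpositive. Let $w_0\in W$ be the longest element, put $V=\mathbb C\otimes_{\mathbb R}V_0$ and $n=\dim_{\mathbb C}V$, and let $k:\Pi\to\mathbb C$, $\alpha\mapsto k_\alpha$, be a function with $k_\alpha=k_{\alpha'}$ whenever $\alpha,\alpha'$ lie in the same $W$-orbit. The graded affine Hecke algebra $\mathbb H$ is the associative unital $\mathbb C$-algebra generated by $t_w$ $(w\in W)$ and $v\in V$, subject to the relations of $\mathbb C[W]$ among the $t_w$, the relations of the symmetric algebra $S(V)$ among the $v$, and $$t_{s_\alpha}v-s_\alpha(v)t_{s_\alpha}=k_\alpha\langle v,\alpha^\vee\rangle\qquad(\alpha\in\Pi,\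 v\in V).$$ Let $\bullet$ and $*$ be the $\mathbb C$-linear anti-involutions of $\mathbb H$ determined by $t_w^\bullet=t_w^*=t_w^{-1}$ for $w\in W$, and $v^\bullet=v$, $v^*=t_{w_0}\cdot(-w_0(v))\cdot t_{w_0}^{-1}$ for $v\in V$. Let $\iota$ be the automorphism of $\mathbb H$ determined by $\iota(v)=-v$ and $\iota(t_w)=\mathrm{sgn}(w)\,t_w$, where $\mathrm{sgn}(w)$ is the determinant of $w$ on $V_0$. For an $\mathbb H$-module $X$ let $X^\bullet$ (resp. $X^*$) be the space of $\mathbb C$-linear functionals on $X$ with $(h\cdot\varphi)(x)=\varphi(h^\bullet x)$ (resp. $\varphi(h^*x)$), let $\iota(X)$ be the space $X$ with $h$ acting as $\iota(h)$, and put $\mathbb D(X)=(\iota(X^\bullet))^*$. Let $X$ and $Y$ be finite-dimensional irreducible $\mathbb H$-modules. Then, with $\mathrm{Ext}$ taken in the category of all $\mathbb H$-modules, there is an isomorphism of complex vector spaces $$\mathrm{Ext}^n_{\mathbb H}(X,Y)\cong\begin{cases}\mathbb C&\text{if }X\cong\mathbb D(Y),\\ 0&\text{if }X\not\cong\mathbb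 D(Y).\end{cases}$$ -/

import Mathlib

open CategoryTheory
open scoped TensorProduct NNReal ModuleCat

universe u

namespace GradedHecke

noncomputable section

variable {ι V₀ N : Type u} [AddCommGroup V₀] [Module ℝ V₀] [AddCommGroup N] [Module ℝ N]

/-- A set of simple roots of a real, possibly non-crystallographic, root pairing: a linearly
independent set of roots such that every root is a combination of simple roots whose
coefficients are all nonnegative or all nonpositive. The coefficients are real numbers. -/
structure SimpleRoots (P : RootPairing ι ℝ V₀ N) where
  /-- The indices of the simple roots. -/
  support : Set ι
  linearIndepOn : LinearIndepOn ℝ P.root support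
  root_mem_or_neg_mem (i : ι) :
    P.root i ∈ Submodule.span ℝ≥0 (P.root '' support) ∨
      -P.root i ∈ Submodule.span ℝ≥0 (P.root '' support)

/-- A parameter function: a complex number for each simple root, depending only on the orbit of
the simple root under the finite reflection group. -/
structure Parameter {P : RootPairing ι ℝ V₀ N} (Δ : SimpleRoots P) where
  /-- The value at a simple root. -/
  val : Δ.support → ℂ
  val_eq (i j : Δ.support) (w : P.weylGroup) (h : w • P.root i = P.root j) : val i = val j

/-! ### The longest element -/

namespace SimpleRoots

variable {P : RootPairing ι ℝ V₀ N} (Δ : SimpleRoots P)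

/-- The root with index `i` is positive. -/
def IsPos (i : ι) : Prop := P.root i ∈ Submodule.span ℝ≥0 (P.root '' Δ.support)

/-- The length of `w`, as the number of positive roots that `w` makes negative. -/
def length (w : P.weylGroup) : ℕ := {i | Δ.IsPos i ∧ ¬ Δ.IsPos (w • i)}.ncard

lemma exists_longest [Finite ι] : ∃ w : P.weylGroup, ∀ w', Δ.length w' ≤ Δ.length w := by
  have hb : ∀ w : P.weylGroup, Δ.length w ≤ Nat.card ι := fun w => by
    rw [← Set.ncard_univ]
    exact Set.ncard_le_ncard (Set.subset_univ _) (Set.toFinite _)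
  have hfin : (Set.range Δ.length).Finite :=
    (Set.finite_Iic (Nat.card ι)).subset (by rintro _ ⟨w, rfl⟩; exact hb w)
  obtain ⟨_, ⟨w, rfl⟩, hw⟩ := hfin.exists_maximal (Set.range_nonempty _)
  refine ⟨w, fun w' => ?_⟩
  rcases le_total (Δ.length w') (Δ.length w) with h | h
  · exact h
  · exact hw ⟨w', rfl⟩ h

/-- The longest element `w₀` of the reflection group. -/
def longest [Finite ι] : P.weylGroup := Δ.exists_longest.choose

lemma root_smul (w : P.weylGroup) (i : ι) : P.root (w • i) = w • P.root i :=
  (P.weylGroup_apply_root w i).symm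

lemma exists_coord : ∃ c : V₀ →ₗ[ℝ] (Δ.support →₀ ℝ),
    ∀ i : Δ.support, c (P.root i) = Finsupp.single i 1 := by
  have h : LinearIndependent ℝ (fun i : Δ.support => P.root i) := Δ.linearIndepOn
  obtain ⟨c, hc⟩ := LinearMap.exists_leftInverse_of_injective _
    (LinearMap.ker_eq_bot.2 h)
  refine ⟨c, fun i => ?_⟩
  have := LinearMap.congr_fun hc (Finsupp.single i 1)
  simpa using this

/-- The coordinates of a vector with respect to the simple roots (on the span of the roots). -/
def coord : V₀ →ₗ[ℝ] (Δ.support →₀ ℝ) := Δ.exists_coord.choose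

lemma coord_root (i : Δ.support) : Δ.coord (P.root i) = Finsupp.single i 1 :=
  Δ.exists_coord.choose_spec i

lemma coord_nonneg {x : V₀} (hx : x ∈ Submodule.span ℝ≥0 (P.root '' Δ.support))
    (j : Δ.support) : 0 ≤ Δ.coord x j := by
  classical
  induction hx using Submodule.span_induction with
  | mem x h =>
    obtain ⟨i, hi, rfl⟩ := h
    rw [Δ.coord_root ⟨i, hi⟩, Finsupp.single_apply]
    split_ifs <;> norm_num
  | zero => simp
  | add x y _ _ hx hy => simpa using add_nonneg hx hy
  | smul a x _ hx =>
    have : a • x = (a : ℝ) • x := rfl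
    rw [this, map_smul]
    exact mul_nonneg a.2 hx

lemma eq_sum {x : V₀} (hx : x ∈ Submodule.span ℝ≥0 (P.root '' Δ.support)) :
    x = (Δ.coord x).sum fun i a => a • P.root i := by
  change x = Finsupp.linearCombination ℝ (fun i : Δ.support => P.root i) (Δ.coord x)
  induction hx using Submodule.span_induction with
  | mem x h =>
    obtain ⟨i, hi, rfl⟩ := h
    rw [Δ.coord_root ⟨i, hi⟩]; simp
  | zero => simp
  | add x y _ _ hx hy => rw [map_add, map_add, ← hx, ← hy]
  | smul a x _ hx =>
    have : a • x = (a : ℝ) • x := rfl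
    rw [this, map_smul, map_smul, ← hx]

lemma eq_zero_of_neg_mem {x : V₀} (hx : x ∈ Submodule.span ℝ≥0 (P.root '' Δ.support))
    (hx' : -x ∈ Submodule.span ℝ≥0 (P.root '' Δ.support)) : x = 0 := by
  have h : Δ.coord x = 0 := by
    ext j
    have h1 := Δ.coord_nonneg hx j
    have h2 := Δ.coord_nonneg hx' j
    simp only [map_neg, Finsupp.coe_neg, Pi.neg_apply] at h2
    simp only [Finsupp.coe_zero, Pi.zero_apply]
    linarith
  rw [Δ.eq_sum hx, h]; simp

lemma not_isPos_iff (i : ι) :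
    ¬ Δ.IsPos i ↔ -P.root i ∈ Submodule.span ℝ≥0 (P.root '' Δ.support) := by
  constructor
  · intro h
    exact (Δ.root_mem_or_neg_mem i).resolve_left h
  · intro h h'
    exact P.ne_zero i (Δ.eq_zero_of_neg_mem h' h)

lemma isPos_simple (j : Δ.support) : Δ.IsPos j := Submodule.subset_span ⟨j, j.2, rfl⟩

lemma exists_coord_pos [P.IsReduced] {i : ι} (hi : Δ.IsPos i) {j : Δ.support} (hij : i ≠ j) :
    ∃ k, k ≠ j ∧ 0 < Δ.coord (P.root i) k := by
  classical
  by_contra! hcon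
  have h0 : ∀ k, k ≠ j → Δ.coord (P.root i) k = 0 := fun k hk =>
    le_antisymm (hcon k hk) (Δ.coord_nonneg hi k)
  have hs : Δ.coord (P.root i) = Finsupp.single j (Δ.coord (P.root i) j) := by
    ext k
    by_cases hk : k = j
    · simp [hk]
    · rw [h0 k hk, Finsupp.single_apply, if_neg (Ne.symm hk)]
  have h1 := Δ.eq_sum hi
  rw [hs, Finsupp.sum_single_index (by simp)] at h1
  have hdep : ¬ LinearIndependent ℝ ![P.root i, P.root j] := by
    intro h
    have := (LinearIndependent.pair_iff.1 h) 1 (-(Δ.coord (P.root i) j))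
      (by rw [one_smul, neg_smul, ← h1, add_neg_cancel])
    exact one_ne_zero this.1
  rcases RootPairing.IsReduced.eq_or_eq_neg i (j : ι) hdep with h | h
  · exact hij (P.root.injective h)
  · have : -P.root (j : ι) ∈ Submodule.span ℝ≥0 (P.root '' Δ.support) := h ▸ hi
    exact (Δ.not_isPos_iff _).2 this (Δ.isPos_simple j)

/-- The simple (or any) reflection as an element of the reflection group. -/
def refl (P : RootPairing ι ℝ V₀ N) (i : ι) : P.weylGroup := RootPairing.weylGroup.ofIdx P i

lemma refl_smul (i : ι) (x : V₀) : refl P i • x = x - P.coroot' i x • P.root i := rfl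

lemma refl_smul_self (i : ι) : refl P i • P.root i = - P.root i := by
  rw [refl_smul, RootPairing.root_coroot'_eq_pairing, RootPairing.pairing_same, two_smul]; abel

lemma refl_mul_self (i : ι) : refl P i * refl P i = 1 := by
  have h : (refl P i)⁻¹ = refl P i := Subtype.ext (RootPairing.Equiv.reflection_inv P i)
  nth_rewrite 1 [← h]
  exact inv_mul_cancel _

lemma isPos_refl_smul [P.IsReduced] {i : ι} (hi : Δ.IsPos i) {j : Δ.support} (hij : i ≠ j) :
    Δ.IsPos (refl P j • i) := by
  obtain ⟨k, hkj, hk⟩ := Δ.exists_coord_pos hi hij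
  by_contra hneg
  have := Δ.coord_nonneg ((Δ.not_isPos_iff _).1 hneg) k
  rw [root_smul, refl_smul, map_neg, map_sub, map_smul, Δ.coord_root] at this
  simp [Ne.symm hkj] at this
  linarith

lemma not_isPos_longest_smul [Finite ι] [P.IsReduced] (j : Δ.support) :
    ¬ Δ.IsPos (Δ.longest • (j : ι)) := by
  intro hpos
  set w := Δ.longest with hw
  have hmax : Δ.length (w * refl P j) ≤ Δ.length w := Δ.exists_longest.choose_spec _
  have hinj : Function.Injective (fun i : ι => refl P j • i) := MulAction.injective _
  have hself : ∀ i : ι, refl P (j : ι) • (refl P (j : ι) • i) = i := fun i => by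
    rw [← mul_smul, refl_mul_self, one_smul]
  have hsub : insert (j : ι) ((fun i : ι => refl P j • i) '' {i | Δ.IsPos i ∧ ¬ Δ.IsPos (w • i)}) ⊆
      {i | Δ.IsPos i ∧ ¬ Δ.IsPos ((w * refl P j) • i)} := by
    intro i hi
    rcases hi with rfl | ⟨i, ⟨hi1, hi2⟩, rfl⟩
    · refine ⟨Δ.isPos_simple j, ?_⟩
      rw [not_isPos_iff, root_smul, mul_smul, refl_smul_self, smul_neg, neg_neg, ← root_smul]
      exact hpos
    · have hne : i ≠ j := by rintro rfl; exact hi2 hpos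
      refine ⟨Δ.isPos_refl_smul hi1 hne, ?_⟩
      rw [mul_smul, hself]
      exact hi2
  have hnot : (j : ι) ∉ (fun i : ι => refl P j • i) '' {i | Δ.IsPos i ∧ ¬ Δ.IsPos (w • i)} := by
    rintro ⟨i, ⟨hi1, -⟩, hij⟩
    have h1 : P.root i = - P.root j := by
      rw [← refl_smul_self, ← root_smul]
      congr 1
      rw [← hself i]
      exact congrArg (fun t => refl P (j : ι) • t) hij
    refine (Δ.not_isPos_iff i).2 ?_ hi1
    rw [h1, neg_neg]
    exact Δ.isPos_simple j
  have := Set.ncard_le_ncard hsub (Set.toFinite _)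
  rw [Set.ncard_insert_of_notMem hnot (Set.toFinite _), Set.ncard_image_of_injective _ hinj] at this
  unfold length at hmax
  omega

lemma longest_smul_neg_mem [Finite ι] [P.IsReduced] {x : V₀}
    (hx : x ∈ Submodule.span ℝ≥0 (P.root '' Δ.support)) :
    -(Δ.longest • x) ∈ Submodule.span ℝ≥0 (P.root '' Δ.support) := by
  induction hx using Submodule.span_induction with
  | mem x h =>
    obtain ⟨i, hi, rfl⟩ := h
    rw [← root_smul, ← not_isPos_iff]
    exact Δ.not_isPos_longest_smul ⟨i, hi⟩
  | zero => simp
  | add x y _ _ hx hy =>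
    rw [smul_add, neg_add]; exact add_mem hx hy
  | smul a x _ hx =>
    have h1 : a • x = (a : ℝ) • x := rfl
    have h2 : -(Δ.longest • (a • x)) = a • (-(Δ.longest • x)) := by
      rw [h1, smul_neg]
      congr 1
      exact (RootPairing.Equiv.weightHom P Δ.longest.1).map_smul (a : ℝ) x
    rw [h2]
    exact Submodule.smul_mem _ a hx

lemma longest_inv_smul_neg_mem [Finite ι] [P.IsReduced] (i : ι) (hi : Δ.IsPos i) :
    -(Δ.longest⁻¹ • P.root i) ∈ Submodule.span ℝ≥0 (P.root '' Δ.support) := by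
  rw [← root_smul, ← not_isPos_iff]
  intro h
  have := Δ.longest_smul_neg_mem h
  rw [root_smul, smul_inv_smul] at this
  exact (Δ.not_isPos_iff i).2 this hi

/-- The longest element maps simple roots to negatives of simple roots. -/
lemma exists_simple_longest [Finite ι] [P.IsReduced] (j : Δ.support) :
    ∃ k : Δ.support, P.root k = -(Δ.longest • P.root j) := by
  set w := Δ.longest with hw
  have hx := Δ.longest_smul_neg_mem (Δ.isPos_simple j)
  rw [← hw] at hx
  set x := -(w • P.root (j : ι)) with hxdef
  have hx0 : Δ.coord x ≠ 0 := by
    intro h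
    have h1 := Δ.eq_sum hx
    rw [h, Finsupp.sum_zero_index] at h1
    rw [hxdef, neg_eq_zero, ← root_smul] at h1
    exact P.ne_zero _ h1
  obtain ⟨k, hk⟩ := Finsupp.ne_iff.1 hx0
  have hkpos : 0 < Δ.coord x k := lt_of_le_of_ne (Δ.coord_nonneg hx k) (Ne.symm hk)
  -- the root `-w⁻¹ e_k` is positive
  let m : ι := refl P (w⁻¹ • (k : ι)) • (w⁻¹ • (k : ι))
  have hm : P.root m = -(w⁻¹ • P.root k) := by
    simp only [m]
    rw [root_smul, refl_smul_self, root_smul]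
  have hmpos : Δ.IsPos m := by
    unfold IsPos
    rw [hm]
    exact Δ.longest_inv_smul_neg_mem k (Δ.isPos_simple k)
  have hmj : m = j := by
    by_contra hne
    obtain ⟨l, hlj, hl⟩ := Δ.exists_coord_pos hmpos hne
    have hsum : P.root j = (Δ.coord x).sum fun i a => a • (-(w⁻¹ • P.root i)) := by
      have h1 : P.root (j : ι) = -(w⁻¹ • x) := by
        rw [hxdef, smul_neg, neg_neg, inv_smul_smul]
      rw [h1]
      conv_lhs => rw [Δ.eq_sum hx]
      let f : V₀ →ₗ[ℝ] V₀ := -(RootPairing.Equiv.weightHom P (w⁻¹).1).toLinearMap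
      change f _ = (Δ.coord x).sum fun i a => a • f (P.root i)
      simp only [Finsupp.sum, map_sum, map_smul]
    have h2 := congrArg (fun v => Δ.coord v l) hsum
    simp only [Finsupp.sum, map_sum, map_smul, Finsupp.coe_finsetSum, Finset.sum_apply,
      Δ.coord_root, Finsupp.smul_apply, smul_eq_mul, Finsupp.single_eq_of_ne hlj] at h2
    have h3 : 0 < ∑ i ∈ (Δ.coord x).support,
        Δ.coord x i * Δ.coord (-(w⁻¹ • P.root (i : ι))) l := by
      refine Finset.sum_pos' (fun i _ => mul_nonneg (Δ.coord_nonneg hx i)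
        (Δ.coord_nonneg (Δ.longest_inv_smul_neg_mem i (Δ.isPos_simple i)) l))
        ⟨k, Finsupp.mem_support_iff.2 hk, mul_pos hkpos ?_⟩
      rw [← hm]
      exact hl
    exact absurd h2 (ne_of_lt h3)
  refine ⟨k, ?_⟩
  rw [hxdef, ← hmj, hm, smul_neg, neg_neg, smul_inv_smul]

end SimpleRoots

/-! ### The complexified reflection representation -/

variable (P : RootPairing ι ℝ V₀ N)

/-- The action of an element of the reflection group on `V = ℂ ⊗ V₀`. -/
def act (w : P.weylGroup) : ℂ ⊗[ℝ] V₀ →ₗ[ℂ] ℂ ⊗[ℝ] V₀ :=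
  (RootPairing.Equiv.weightHom P w.1).toLinearMap.baseChange ℂ

/-- The complex linear extension of the coroot `⟨·, α^∨⟩ : V₀ → ℝ` to `V = ℂ ⊗ V₀`. -/
def corootC (i : ι) : ℂ ⊗[ℝ] V₀ →ₗ[ℂ] ℂ :=
  LinearMap.liftBaseChange ℂ (Algebra.linearMap ℝ ℂ ∘ₗ P.coroot' i)

/-- The sign character of the reflection group, the determinant of the reflection
representation. -/
def sgn (w : P.weylGroup) : ℂ :=
  ((LinearMap.det (RootPairing.Equiv.weightHom P w.1).toLinearMap : ℝ) : ℂ)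

lemma act_tmul (w : P.weylGroup) (z : ℂ) (x : V₀) : act P w (z ⊗ₜ x) = z ⊗ₜ (w • x) := rfl

lemma corootC_tmul (i : ι) (z : ℂ) (x : V₀) :
    corootC P i (z ⊗ₜ x) = z * (P.coroot' i x : ℝ) := rfl

lemma act_mul (w w' : P.weylGroup) (x : ℂ ⊗[ℝ] V₀) :
    act P (w * w') x = act P w (act P w' x) := by
  induction x with
  | zero => simp
  | add x y hx hy => rw [map_add, hx, hy, map_add, map_add]
  | tmul z x => simp only [act_tmul, mul_smul]

lemma act_one (x : ℂ ⊗[ℝ] V₀) : act P 1 x = x := by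
  induction x with
  | zero => simp
  | add x y hx hy => rw [map_add, hx, hy]
  | tmul z x => simp only [act_tmul, one_smul]

lemma corootC_refl (i : ι) (x : ℂ ⊗[ℝ] V₀) :
    corootC P i (act P (SimpleRoots.refl P i) x) = - corootC P i x := by
  induction x with
  | zero => simp
  | add x y hx hy => rw [map_add, map_add, hx, hy, map_add, neg_add]
  | tmul z x =>
    rw [act_tmul, corootC_tmul, corootC_tmul, SimpleRoots.refl_smul, map_sub, map_smul,
      RootPairing.root_coroot'_eq_pairing, RootPairing.pairing_same, smul_eq_mul]
    push_cast
    ring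

lemma sgn_one : sgn P 1 = 1 := by
  unfold sgn
  rw [Subgroup.coe_one, map_one]
  simp

lemma sgn_mul (w w' : P.weylGroup) : sgn P (w * w') = sgn P w * sgn P w' := by
  unfold sgn
  rw [Subgroup.coe_mul, map_mul, ← Complex.ofReal_mul, ← LinearMap.det_comp]
  rfl

lemma sgn_refl [FiniteDimensional ℝ V₀] (i : ι) : sgn P (SimpleRoots.refl P i) = -1 := by
  have h : (RootPairing.Equiv.weightHom P (SimpleRoots.refl P i).1).toLinearMap =
      LinearMap.transvection (P.coroot' i) (-P.root i) := by
    ext x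
    change SimpleRoots.refl P i • x = _
    rw [SimpleRoots.refl_smul, LinearMap.transvection.apply, smul_neg, sub_eq_add_neg]
  unfold sgn
  rw [h, LinearMap.transvection.det, map_neg, RootPairing.root_coroot'_eq_pairing,
    RootPairing.pairing_same]
  norm_num

/-! ### The graded affine Hecke algebra -/

variable {P} {Δ : SimpleRoots P}

/-- The defining relations: `w ↦ t_w` is multiplicative and unital, `v ↦ f_v` is linear with
commuting values, and `t_s f_v - f_{s(v)} t_s = k_α ⟨v, α^∨⟩` for the reflection `s` in a simple
root `α`. The generator `t_w` is `Sum.inl w` and the generator `f_v` is `Sum.inr v`. -/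
inductive Rel (k : Parameter Δ) : FreeAlgebra ℂ (P.weylGroup ⊕ (ℂ ⊗[ℝ] V₀)) →
    FreeAlgebra ℂ (P.weylGroup ⊕ (ℂ ⊗[ℝ] V₀)) → Prop
  | t_one : Rel k (FreeAlgebra.ι ℂ (Sum.inl 1)) 1
  | t_mul (w w' : P.weylGroup) : Rel k (FreeAlgebra.ι ℂ (Sum.inl (w * w')))
      (FreeAlgebra.ι ℂ (Sum.inl w) * FreeAlgebra.ι ℂ (Sum.inl w'))
  | f_add (v v' : ℂ ⊗[ℝ] V₀) : Rel k (FreeAlgebra.ι ℂ (Sum.inr (v + v')))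
      (FreeAlgebra.ι ℂ (Sum.inr v) + FreeAlgebra.ι ℂ (Sum.inr v'))
  | f_smul (c : ℂ) (v : ℂ ⊗[ℝ] V₀) : Rel k (FreeAlgebra.ι ℂ (Sum.inr (c • v)))
      (c • FreeAlgebra.ι ℂ (Sum.inr v))
  | f_comm (v v' : ℂ ⊗[ℝ] V₀) :
      Rel k (FreeAlgebra.ι ℂ (Sum.inr v) * FreeAlgebra.ι ℂ (Sum.inr v'))
        (FreeAlgebra.ι ℂ (Sum.inr v') * FreeAlgebra.ι ℂ (Sum.inr v))
  | cross (i : Δ.support) (v : ℂ ⊗[ℝ] V₀) :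
      Rel k (FreeAlgebra.ι ℂ (Sum.inl (SimpleRoots.refl P i)) * FreeAlgebra.ι ℂ (Sum.inr v)
          - FreeAlgebra.ι ℂ (Sum.inr (act P (SimpleRoots.refl P i) v)) *
            FreeAlgebra.ι ℂ (Sum.inl (SimpleRoots.refl P i)))
        (algebraMap ℂ _ (k.val i * corootC P i v))

/-- The graded affine Hecke algebra with parameter function `k`. By the
Poincaré–Birkhoff–Witt theorem for this presentation, the maps `ℂ[W] → ℍ` and `S(V) → ℍ` are
injective. -/
def Hecke (k : Parameter Δ) : Type u := RingQuot (Rel k)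

instance (k : Parameter Δ) : Ring (Hecke k) := inferInstanceAs (Ring (RingQuot (Rel k)))

instance (k : Parameter Δ) : Algebra ℂ (Hecke k) :=
  inferInstanceAs (Algebra ℂ (RingQuot (Rel k)))

namespace Hecke

variable (k : Parameter Δ)

/-- The map `w ↦ t_w`. -/
def t : P.weylGroup →* Hecke k where
  toFun w := RingQuot.mkAlgHom ℂ (Rel k) (FreeAlgebra.ι ℂ (Sum.inl w))
  map_one' := by
    rw [RingQuot.mkAlgHom_rel ℂ Rel.t_one, map_one]; rfl
  map_mul' w w' := by
    rw [RingQuot.mkAlgHom_rel ℂ (Rel.t_mul w w'), map_mul]; rfl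

/-- The map `v ↦ f_v`. -/
def f : ℂ ⊗[ℝ] V₀ →ₗ[ℂ] Hecke k where
  toFun v := RingQuot.mkAlgHom ℂ (Rel k) (FreeAlgebra.ι ℂ (Sum.inr v))
  map_add' v v' := by
    rw [RingQuot.mkAlgHom_rel ℂ (Rel.f_add v v'), map_add]; rfl
  map_smul' c v := by
    rw [RingQuot.mkAlgHom_rel ℂ (Rel.f_smul c v), map_smul]; rfl

lemma f_comm (v v' : ℂ ⊗[ℝ] V₀) : f k v * f k v' = f k v' * f k v := by
  have := RingQuot.mkAlgHom_rel ℂ (Rel.f_comm (k := k) v v')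
  rw [map_mul, map_mul] at this
  exact this

lemma cross (i : Δ.support) (v : ℂ ⊗[ℝ] V₀) :
    t k (SimpleRoots.refl P i) * f k v
      - f k (act P (SimpleRoots.refl P i) v) * t k (SimpleRoots.refl P i) =
    algebraMap ℂ (Hecke k) (k.val i * corootC P i v) := by
  have := RingQuot.mkAlgHom_rel ℂ (Rel.cross (k := k) i v)
  rw [map_sub, map_mul, map_mul, AlgHom.commutes] at this
  exact this

/-- The universal property of the presentation. -/
def lift {A : Type*} [Ring A] [Algebra ℂ A] (T : P.weylGroup →* A) (F : ℂ ⊗[ℝ] V₀ →ₗ[ℂ] A)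
    (hF : ∀ v v', F v * F v' = F v' * F v)
    (hc : ∀ (i : Δ.support) v, T (SimpleRoots.refl P i) * F v
      - F (act P (SimpleRoots.refl P i) v) * T (SimpleRoots.refl P i) =
        algebraMap ℂ A (k.val i * corootC P i v)) :
    Hecke k →ₐ[ℂ] A :=
  RingQuot.liftAlgHom ℂ ⟨FreeAlgebra.lift ℂ (Sum.elim T F), by
    intro x y h
    induction h with
    | t_one => simp
    | t_mul w w' => simp
    | f_add v v' => simp
    | f_smul c v => simp
    | f_comm v v' => simpa using hF v v'
    | cross i v =>
      rw [AlgHom.commutes, ← hc i v]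
      simp⟩

lemma lift_t {A : Type*} [Ring A] [Algebra ℂ A] (T : P.weylGroup →* A)
    (F : ℂ ⊗[ℝ] V₀ →ₗ[ℂ] A) (hF) (hc) (w : P.weylGroup) :
    lift k T F hF hc (t k w) = T w := by
  refine (RingQuot.liftAlgHom_mkAlgHom_apply _ _ _ _).trans ?_
  simp

lemma lift_f {A : Type*} [Ring A] [Algebra ℂ A] (T : P.weylGroup →* A)
    (F : ℂ ⊗[ℝ] V₀ →ₗ[ℂ] A) (hF) (hc) (v : ℂ ⊗[ℝ] V₀) :
    lift k T F hF hc (f k v) = F v := by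
  refine (RingQuot.liftAlgHom_mkAlgHom_apply _ _ _ _).trans ?_
  simp

/-- The cross relation with the `t_s` on the other side. -/
lemma cross' (i : Δ.support) (v : ℂ ⊗[ℝ] V₀) :
    f k v * t k (SimpleRoots.refl P i)
      - t k (SimpleRoots.refl P i) * f k (act P (SimpleRoots.refl P i) v) =
    algebraMap ℂ (Hecke k) (k.val i * corootC P i v) := by
  have h := cross k i (act P (SimpleRoots.refl P i) v)
  rw [← act_mul, SimpleRoots.refl_mul_self, act_one, corootC_refl, mul_neg, map_neg] at h
  rw [← neg_sub, h, neg_neg]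

/-! ### The Iwahori–Matsumoto involution and the two anti-involutions -/

/-- The Iwahori–Matsumoto involution: `ι(v) = -v` and `ι(t_w) = sgn(w) t_w`. -/
def iwahoriMatsumoto [FiniteDimensional ℝ V₀] : Hecke k →ₐ[ℂ] Hecke k :=
  lift k
    { toFun := fun w => sgn P w • t k w
      map_one' := by rw [sgn_one, map_one, one_smul]
      map_mul' := fun w w' => by rw [sgn_mul, map_mul, smul_mul_smul_comm] }
    (-f k)
    (fun v v' => by simp [f_comm k v v'])
    (fun i v => by
      rw [← cross k i v]
      simp [sgn_refl])

lemma inv_refl (i : ι) : (SimpleRoots.refl P i)⁻¹ = SimpleRoots.refl P i :=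
  inv_eq_of_mul_eq_one_right (SimpleRoots.refl_mul_self i)

/-- The linear anti-involution `•`, as a homomorphism to the opposite algebra:
`v^• = v` and `t_w^• = t_w⁻¹`. -/
def bullet : Hecke k →ₐ[ℂ] (Hecke k)ᵐᵒᵖ :=
  lift k
    { toFun := fun w => MulOpposite.op (t k w⁻¹)
      map_one' := by rw [inv_one, map_one, MulOpposite.op_one]
      map_mul' := fun w w' => by rw [mul_inv_rev, map_mul, MulOpposite.op_mul] }
    ((MulOpposite.opLinearEquiv ℂ).toLinearMap ∘ₗ f k)
    (fun v v' => by
      simp only [LinearMap.comp_apply, LinearEquiv.coe_coe, MulOpposite.coe_opLinearEquiv,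
        ← MulOpposite.op_mul, f_comm k v v'])
    (fun i v => by
      rw [MulOpposite.algebraMap_apply, ← cross' k i v]
      simp [inv_refl])

lemma iwahoriMatsumoto_t [FiniteDimensional ℝ V₀] (w : P.weylGroup) :
    iwahoriMatsumoto k (t k w) = sgn P w • t k w := lift_t k _ _ _ _ w

lemma iwahoriMatsumoto_f [FiniteDimensional ℝ V₀] (v : ℂ ⊗[ℝ] V₀) :
    iwahoriMatsumoto k (f k v) = -f k v := lift_f k _ _ _ _ v

lemma bullet_t (w : P.weylGroup) : bullet k (t k w) = MulOpposite.op (t k w⁻¹) :=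
  lift_t k _ _ _ _ w

lemma bullet_f (v : ℂ ⊗[ℝ] V₀) : bullet k (f k v) = MulOpposite.op (f k v) :=
  lift_f k _ _ _ _ v

end Hecke

lemma coroot'_smul_of_smul_eq (w : P.weylGroup) {i j : ι} (h : w • P.root i = P.root j)
    (x : V₀) : P.coroot' j (w • x) = P.coroot' i x := by
  have hj : j = w.1.indexEquiv i := by
    apply P.root.injective
    rw [RootPairing.Equiv.root_indexEquiv_eq_smul, ← h]; rfl
  have hco : w.1.coweightMap (P.coroot j) = P.coroot i := by
    rw [RootPairing.Hom.coroot_coweightMap_apply, hj, Equiv.symm_apply_apply]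
  have h1 := LinearMap.congr_fun
    (RootPairing.Hom.weight_coweight_transpose_apply P P (P.coroot j) w.1.toHom) x
  rw [hco] at h1
  exact h1

lemma corootC_act_of_smul_eq (w : P.weylGroup) {i j : ι} (h : w • P.root i = P.root j)
    (x : ℂ ⊗[ℝ] V₀) : corootC P j (act P w x) = corootC P i x := by
  induction x with
  | zero => simp
  | add x y hx hy => rw [map_add, map_add, hx, hy, map_add]
  | tmul z x => rw [act_tmul, corootC_tmul, corootC_tmul, coroot'_smul_of_smul_eq w h]

lemma refl_mul_of_smul_eq (w : P.weylGroup) {i j : ι} (h : w • P.root i = P.root j) :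
    SimpleRoots.refl P j * w = w * SimpleRoots.refl P i := by
  apply Subtype.ext
  apply RootPairing.Equiv.weightHom_injective P
  ext x
  change (SimpleRoots.refl P j * w) • x = (w * SimpleRoots.refl P i) • x
  rw [mul_smul, mul_smul, SimpleRoots.refl_smul, SimpleRoots.refl_smul, smul_sub,
    coroot'_smul_of_smul_eq w h, ← h]
  congr 1
  exact ((RootPairing.Equiv.weightHom P w.1).map_smul _ _).symm

/-- Every simple root `α` is `-w₀(β)` for a simple root `β`, and conjugation by `w₀`
exchanges their reflections and coroots. -/
lemma exists_longest_simple [Finite ι] [P.IsReduced] (k : Parameter Δ) (j : Δ.support) :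
    ∃ i : Δ.support, k.val i = k.val j ∧
      SimpleRoots.refl P j * Δ.longest = Δ.longest * SimpleRoots.refl P i ∧
      ∀ v, corootC P i (-act P Δ.longest⁻¹ v) = corootC P j v := by
  choose g hg using Δ.exists_simple_longest
  have hinj : Function.Injective g := by
    intro a b hab
    have h1 := hg a
    rw [hab, hg b, neg_inj, ← SimpleRoots.root_smul, ← SimpleRoots.root_smul] at h1
    exact Subtype.ext (MulAction.injective _ (P.root.injective h1)).symm
  obtain ⟨i, rfl⟩ := Finite.surjective_of_injective hinj j
  have hw : (Δ.longest * SimpleRoots.refl P i) • P.root i = P.root (g i) := by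
    rw [mul_smul, SimpleRoots.refl_smul_self, smul_neg, hg i]
  refine ⟨i, k.val_eq _ _ _ hw, ?_, fun v => ?_⟩
  · have h := refl_mul_of_smul_eq _ hw
    rw [mul_assoc, SimpleRoots.refl_mul_self, mul_one] at h
    calc SimpleRoots.refl P (g i) * Δ.longest
        = SimpleRoots.refl P (g i) * (Δ.longest * SimpleRoots.refl P i) * SimpleRoots.refl P i := by
          rw [mul_assoc, mul_assoc, SimpleRoots.refl_mul_self, mul_one]
      _ = _ := by rw [h]
  · have h := corootC_act_of_smul_eq _ hw
      (act P (SimpleRoots.refl P i) (act P Δ.longest⁻¹ v))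
    rw [corootC_refl, ← act_mul, ← act_mul, mul_assoc Δ.longest, SimpleRoots.refl_mul_self,
      mul_one, mul_inv_cancel, act_one] at h
    rw [map_neg, h]

namespace Hecke

variable (k : Parameter Δ) [Finite ι] [P.IsReduced]

/-- The image of `v` under the linear anti-involution `*`, namely `t_{w₀} θ(v) t_{w₀}⁻¹`, where
`θ(v) = -w₀(v)`. It is written with `w₀⁻¹`, which equals `w₀`. -/
def starF : ℂ ⊗[ℝ] V₀ →ₗ[ℂ] Hecke k :=
  LinearMap.mulRight ℂ (t k Δ.longest⁻¹) ∘ₗ LinearMap.mulLeft ℂ (t k Δ.longest) ∘ₗ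
    f k ∘ₗ (-act P Δ.longest⁻¹)

lemma starF_apply (v : ℂ ⊗[ℝ] V₀) :
    starF k v = t k Δ.longest * f k (-act P Δ.longest⁻¹ v) * t k Δ.longest⁻¹ := rfl

lemma starF_comm (v v' : ℂ ⊗[ℝ] V₀) : starF k v * starF k v' = starF k v' * starF k v := by
  have h : t k Δ.longest⁻¹ * t k Δ.longest = 1 := by rw [← map_mul, inv_mul_cancel, map_one]
  have key : ∀ a b : Hecke k, (t k Δ.longest * a * t k Δ.longest⁻¹) *
      (t k Δ.longest * b * t k Δ.longest⁻¹) = t k Δ.longest * (a * b) * t k Δ.longest⁻¹ := by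
    intro a b
    calc _ = t k Δ.longest * a * (t k Δ.longest⁻¹ * t k Δ.longest) * b * t k Δ.longest⁻¹ := by
          simp only [mul_assoc]
      _ = _ := by rw [h]; simp only [mul_assoc, mul_one]
  rw [starF_apply, starF_apply, key, key, f_comm]

lemma starF_cross (j : Δ.support) (v : ℂ ⊗[ℝ] V₀) :
    starF k v * t k (SimpleRoots.refl P j)
      - t k (SimpleRoots.refl P j) * starF k (act P (SimpleRoots.refl P j) v) =
    algebraMap ℂ (Hecke k) (k.val j * corootC P j v) := by
  obtain ⟨i, hki, hr, hc⟩ := exists_longest_simple k j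
  have hr' : Δ.longest⁻¹ * SimpleRoots.refl P j = SimpleRoots.refl P i * Δ.longest⁻¹ := by
    rw [inv_mul_eq_iff_eq_mul, ← mul_assoc, ← hr, mul_assoc, mul_inv_cancel, mul_one]
  have hx := cross' k i (-act P Δ.longest⁻¹ v)
  rw [hki, hc, map_neg (act P _), ← act_mul, ← hr', act_mul] at hx
  have h1 : t k Δ.longest * t k Δ.longest⁻¹ = 1 := by rw [← map_mul, mul_inv_cancel, map_one]
  have e1 : starF k v * t k (SimpleRoots.refl P j) = t k Δ.longest *
      (f k (-act P Δ.longest⁻¹ v) * t k (SimpleRoots.refl P i)) * t k Δ.longest⁻¹ := by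
    rw [starF_apply, mul_assoc, ← map_mul, hr', map_mul]; simp only [mul_assoc]
  have e2 : t k (SimpleRoots.refl P j) * starF k (act P (SimpleRoots.refl P j) v) =
      t k Δ.longest * (t k (SimpleRoots.refl P i) *
        f k (-act P Δ.longest⁻¹ (act P (SimpleRoots.refl P j) v))) * t k Δ.longest⁻¹ := by
    rw [starF_apply, ← mul_assoc, ← mul_assoc, ← map_mul, hr, map_mul]; simp only [mul_assoc]
  rw [e1, e2, ← sub_mul, ← mul_sub, hx, ← Algebra.commutes, mul_assoc, h1, mul_one]

/-- The linear anti-involution `*`, as a homomorphism to the opposite algebra: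
`v^* = t_{w₀} θ(v) t_{w₀}⁻¹` and `t_w^* = t_w⁻¹`. -/
def star : Hecke k →ₐ[ℂ] (Hecke k)ᵐᵒᵖ :=
  lift k
    { toFun := fun w => MulOpposite.op (t k w⁻¹)
      map_one' := by rw [inv_one, map_one, MulOpposite.op_one]
      map_mul' := fun w w' => by rw [mul_inv_rev, map_mul, MulOpposite.op_mul] }
    ((MulOpposite.opLinearEquiv ℂ).toLinearMap ∘ₗ starF k)
    (fun v v' => by
      simp only [LinearMap.comp_apply, LinearEquiv.coe_coe, MulOpposite.coe_opLinearEquiv,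
        ← MulOpposite.op_mul, starF_comm k v v'])
    (fun i v => by
      rw [MulOpposite.algebraMap_apply, ← starF_cross k i v]
      simp [inv_refl])

lemma star_t (w : P.weylGroup) : star k (t k w) = MulOpposite.op (t k w⁻¹) :=
  lift_t k _ _ _ _ w

lemma star_f (v : ℂ ⊗[ℝ] V₀) : star k (f k v) =
    MulOpposite.op (t k Δ.longest * f k (-act P Δ.longest⁻¹ v) * t k Δ.longest⁻¹) :=
  lift_f k _ _ _ _ v

end Hecke

/-! ### Dual modules -/

section Dual

variable {A : Type u} [Ring A] [Algebra ℂ A]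

/-- The space of complex linear functionals on an `A`-module `X`, made into an `A`-module by
`(a • φ) x = φ (σ(a) • x)` for an anti-homomorphism `σ` of `A`. -/
def DualSpace (_σ : A →ₐ[ℂ] Aᵐᵒᵖ) (X : ModuleCat.{u} A) : Type u := Module.Dual ℂ X

variable (σ : A →ₐ[ℂ] Aᵐᵒᵖ) (X : ModuleCat.{u} A)

instance : AddCommGroup (DualSpace σ X) := inferInstanceAs (AddCommGroup (Module.Dual ℂ X))

instance : Module A (DualSpace σ X) where
  smul a φ := (show Module.Dual ℂ X from φ) ∘ₗ Module.toModuleEnd ℂ X (σ a).unop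
  one_smul φ := by
    refine LinearMap.ext fun x => ?_
    change (show Module.Dual ℂ X from φ) ((σ 1).unop • x) = (show Module.Dual ℂ X from φ) x
    rw [map_one, MulOpposite.unop_one, one_smul]
  mul_smul a b φ := by
    refine LinearMap.ext fun x => ?_
    change (show Module.Dual ℂ X from φ) ((σ (a * b)).unop • x) =
      (show Module.Dual ℂ X from φ) ((σ b).unop • (σ a).unop • x)
    rw [map_mul, MulOpposite.unop_mul, mul_smul]
  smul_zero a := rfl
  smul_add a φ ψ := rfl
  add_smul a b φ := by
    refine LinearMap.ext fun x => ?_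
    change (show Module.Dual ℂ X from φ) ((σ (a + b)).unop • x) =
      (show Module.Dual ℂ X from φ) ((σ a).unop • x) +
        (show Module.Dual ℂ X from φ) ((σ b).unop • x)
    rw [map_add, MulOpposite.unop_add, add_smul, map_add]
  zero_smul φ := by
    refine LinearMap.ext fun x => ?_
    change (show Module.Dual ℂ X from φ) ((σ 0).unop • x) = 0
    rw [map_zero, MulOpposite.unop_zero, zero_smul, map_zero]

lemma dualSpace_smul_apply (a : A) (φ : DualSpace σ X) (x : X) :
    (show Module.Dual ℂ X from a • φ) x = (show Module.Dual ℂ X from φ) ((σ a).unop • x) := rfl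

/-- The dual of an `A`-module with respect to an anti-homomorphism `σ` of `A`. -/
def dual : ModuleCat.{u} A := ModuleCat.of A (DualSpace σ X)

/-- The twist of an `A`-module `X` by an endomorphism `τ` of `A`: the same space with `a` acting
as `τ(a)` does on `X`. -/
def twist (τ : A →ₐ[ℂ] A) (X : ModuleCat.{u} A) : ModuleCat.{u} A :=
  (ModuleCat.restrictScalars τ.toRingHom).obj X

end Dual

/-- The module `𝔻(X) = (ι(X^•))^*`. -/
def dualizing [Finite ι] [FiniteDimensional ℝ V₀] [P.IsReduced] (k : Parameter Δ)
    (X : ModuleCat.{u} (Hecke k)) : ModuleCat.{u} (Hecke k) :=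
  dual (Hecke.star k) (twist (Hecke.iwahoriMatsumoto k) (dual (Hecke.bullet k) X))

end

end GradedHecke

/-! For v in V let ṽ (`Hecke.tilde`) be v minus half the sum of k_α⟨v, α^∨⟩t_{s_α} over the positive
roots, and put K_m = ℍ ⊗_{ℂ[W]} (X ⊗ ⋀^m V). The K_m form a projective resolution of X of length n.
By the Poincaré–Birkhoff–Witt theorem K_m is S(V) ⊗ X ⊗ ⋀^m V as a vector space, and there the
differential is the Koszul differential of the commuting operators v ⊗ 1 − 1 ⊗ v. Exactness follows
from the Euler homotopy ∑ ∂_j ⊗ (b_j ∧ ·), by induction on polynomial degree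
(`KoszulData.exact_succ`, `KoszulData.exact_zero`). Projectivity is Maschke averaging. Hence
Ext^n(X, Y) is the cokernel of Hom_ℍ(K_{n-1}, Y) → Hom_ℍ(K_n, Y).

The line ⋀^n V carries the sign character, so averaging over W presents Hom_ℍ(K_n, Y) as a quotient
of Hom_ℂ(X, Y) (`topHom_surjective`). The elements ṽ are permuted by W exactly as the vectors v are
(`Hecke.t_mul_tilde`), and on W-equivariant maps the Koszul differential does not change when v is
replaced by ṽ (`delta_f_eq_delta_tilde`). So Ext^n(X, Y) is Hom_ℂ(X, Y) modulo the commutators [ṽ,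
φ] and the differences between φ and its conjugates by W twisted by the sign. Under the pairing
tr(ψφ) with Hom_ℂ(Y, X), the annihilator of these elements is `twistedHom`: the maps ψ that commute
with every ṽ and commute with every t_w up to sgn(w). Therefore Ext^n(X, Y) and `twistedHom` have
the same dimension (`mem_twistedHom_iff_tracePairing`, `finrank_ext_eq_finrank_twistedHom`).

The composite of *, ι and • is an algebra endomorphism `doubleTwist` that sends t_w to sgn(w)t_w and
fixes every ṽ, because conjugation by t_{w₀} takes w₀(v) to v − ∑ k_α⟨v, α^∨⟩t_{s_α}
(`Hecke.t_longest_mul_f`). Evaluation identifies 𝔻(Y) with Y on which ℍ acts through `doubleTwist`,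
so `twistedHom` is Hom_ℍ(𝔻(Y), X). For irreducible X and Y Schur's lemma makes it a line or zero. -/

namespace GradedHecke

variable {ι V₀ N : Type u} [AddCommGroup V₀] [Module ℝ V₀] [AddCommGroup N] [Module ℝ N]
  {P : RootPairing ι ℝ V₀ N}

/-! ### Simple reflections -/

namespace SimpleRoots

lemma refl_smul_refl_smul (i j : ι) : refl P i • refl P i • j = j := by
  rw [← mul_smul, refl_mul_self, one_smul]

lemma refl_conj (w : P.weylGroup) (i : ι) : refl P (w • i) = w * refl P i * w⁻¹ := by
  rw [eq_mul_inv_iff_mul_eq]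
  exact refl_mul_of_smul_eq w (root_smul w i).symm

lemma smul_root_eq_neg (i : ι) : P.root (refl P i • i) = -P.root i := by
  rw [root_smul, refl_smul_self]

lemma smul_refl_smul_root (w : P.weylGroup) (i : ι) :
    P.root (w • refl P i • i) = -P.root (w • i) := by
  rw [root_smul, smul_root_eq_neg, smul_neg, root_smul]

lemma refl_smul_refl_self (w : P.weylGroup) (i : ι) :
    refl P (w • refl P i • i) = refl P (w • i) := by
  rw [refl_conj, refl_conj (refl P i), refl_conj w i]
  simp [mul_assoc, refl_mul_self, Hecke.inv_refl]

variable (Δ : SimpleRoots P)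

lemma isPos_smul_refl_smul_iff (w : P.weylGroup) (i : ι) :
    Δ.IsPos (w • refl P i • i) ↔ ¬ Δ.IsPos (w • i) := by
  rw [not_isPos_iff, ← smul_refl_smul_root]; rfl

lemma isPos_refl_smul_self_iff (i : ι) : Δ.IsPos (refl P i • i) ↔ ¬ Δ.IsPos i := by
  simpa using Δ.isPos_smul_refl_smul_iff 1 i

/-- The subgroup generated by the simple reflections. -/
noncomputable def simpleGroup : Subgroup P.weylGroup :=
  Subgroup.closure (Set.range fun j : Δ.support => refl P j)

lemma refl_simple_mem (j : Δ.support) : refl P j ∈ Δ.simpleGroup :=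
  Subgroup.subset_closure ⟨j, rfl⟩

lemma rootForm_root [Fintype ι] (x : V₀) (j : ι) :
    2 * P.RootForm x (P.root j) = P.RootForm (P.root j) (P.root j) * P.coroot' j x := by
  have h := congrArg (P.toLinearMap x) (P.rootForm_self_smul_coroot j)
  rw [map_smul, map_nsmul, P.toLinearMap_apply_apply_Polarization] at h
  have hs : P.RootForm (P.root j) x = P.RootForm x (P.root j) := (P.rootForm_symmetric).eq _ _
  rw [hs] at h
  simpa using h.symm

lemma rootForm_root_self_pos [Fintype ι] (j : ι) : 0 < P.RootForm (P.root j) (P.root j) := by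
  rw [P.rootForm_apply_apply]
  refine Finset.sum_pos' (fun i _ => mul_self_nonneg _) ⟨j, Finset.mem_univ _, ?_⟩
  simp

/-- The sum of the coordinates with respect to the simple roots. -/
noncomputable def height : V₀ →ₗ[ℝ] ℝ := Finsupp.lsum ℝ (fun _ => LinearMap.id) ∘ₗ Δ.coord

lemma height_root (j : Δ.support) : Δ.height (P.root j) = 1 := by
  simp [height, coord_root]

/-- The root form is positive on each root, and its value against a simple root has the sign of the
pairing with that simple coroot. If no pairing were positive, expanding one copy of the root in
simple roots with nonnegative coefficients would make its square nonpositive. -/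
lemma exists_simple_pairing_pos [Finite ι] {i : ι} (hi : Δ.IsPos i) :
    ∃ j : Δ.support, 0 < P.coroot' j (P.root i) := by
  classical
  have := Fintype.ofFinite ι
  by_contra! hcon
  have h1 := Δ.eq_sum hi
  have h2 : P.RootForm (P.root i) (P.root i) ≤ 0 := by
    conv_lhs => rw [h1]; arg 1; rw [← h1]
    rw [Finsupp.sum, map_sum]
    refine Finset.sum_nonpos fun j _ => ?_
    rw [map_smul, smul_eq_mul]
    refine mul_nonpos_of_nonneg_of_nonpos (Δ.coord_nonneg hi j) ?_
    have h3 := rootForm_root (P := P) (P.root i) j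
    have h4 := rootForm_root_self_pos (P := P) (j : ι)
    have h5 := mul_nonpos_of_nonneg_of_nonpos h4.le (hcon j)
    linarith
  exact absurd (rootForm_root_self_pos (P := P) i) (not_lt.2 h2)

/-- A counterexample of least height is not simple. A simple reflection with positive pairing keeps
it positive and lowers its height, while conjugating its reflection by a simple one. Heights are
real, so the minimum is taken over the finite set of roots. -/
lemma refl_mem_of_isPos [Finite ι] [P.IsReduced] {i : ι} (hi : Δ.IsPos i) :
    refl P i ∈ Δ.simpleGroup := by
  by_contra hcon
  obtain ⟨m, ⟨hm1, hm2⟩, hmin⟩ := Set.exists_min_image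
    {i | Δ.IsPos i ∧ refl P i ∉ Δ.simpleGroup} (fun i => Δ.height (P.root i)) (Set.toFinite _)
    ⟨i, hi, hcon⟩
  obtain ⟨j, hj⟩ := Δ.exists_simple_pairing_pos hm1
  have hne : m ≠ j := by rintro rfl; exact hm2 (Δ.refl_simple_mem j)
  have h1 := hmin (refl P j • m) ⟨Δ.isPos_refl_smul hm1 hne, fun h => hm2 ?_⟩
  · simp only [root_smul, refl_smul, map_sub, map_smul, height_root, smul_eq_mul] at h1
    linarith
  · rw [refl_conj, inv_eq_of_mul_eq_one_right (refl_mul_self _)] at h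
    have := mul_mem (mul_mem (Δ.refl_simple_mem j) h) (Δ.refl_simple_mem j)
    rwa [mul_assoc, mul_assoc, mul_assoc, refl_mul_self, mul_one, ← mul_assoc,
      refl_mul_self, one_mul] at this

lemma simpleGroup_eq_top [Finite ι] [P.IsReduced] : Δ.simpleGroup = ⊤ := by
  rw [eq_top_iff]
  have hr : ∀ i, refl P i ∈ Δ.simpleGroup := fun i => by
    by_cases hi : Δ.IsPos i
    · exact Δ.refl_mem_of_isPos hi
    · have h := Δ.refl_mem_of_isPos ((Δ.isPos_refl_smul_self_iff i).2 hi)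
      have h2 := refl_smul_refl_self (P := P) 1 i
      rw [one_smul, one_smul] at h2
      rwa [h2] at h
  rintro ⟨w, hw⟩ -
  exact RootPairing.weylGroup.induction P
    (pred := fun w hw => (⟨w, hw⟩ : P.weylGroup) ∈ Δ.simpleGroup)
    (fun i => hr i) (one_mem _) (fun x y hx hy h1 h2 => mul_mem h1 h2) hw

/-- Induction over the reflection group by left multiplication with simple reflections. -/
lemma weylGroup_induction [Finite ι] [P.IsReduced] {p : P.weylGroup → Prop} (one : p 1)
    (mul : ∀ (j : Δ.support) w, p w → p (refl P j * w)) (w : P.weylGroup) : p w := by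
  have hw : w ∈ Subgroup.closure (Set.range fun j : Δ.support => refl P j) := by
    change w ∈ Δ.simpleGroup
    rw [simpleGroup_eq_top]; trivial
  induction hw using Subgroup.closure_induction_left with
  | one => exact one
  | mul_left x hx y _ hy => obtain ⟨j, rfl⟩ := hx; exact mul j y hy
  | inv_mul_cancel x hx y _ hy =>
    obtain ⟨j, rfl⟩ := hx
    change p ((refl P (j : ι))⁻¹ * y)
    rw [inv_eq_of_mul_eq_one_right (refl_mul_self _)]
    exact mul j y hy

open Classical in
-- A simple reflection permutes the positive roots other than its own, so the two sums differ only
-- at ±α_j. Every verification of a cross relation below reduces to this cancellation.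
lemma sum_isPos_sub_sum_isPos_refl [Fintype ι] [P.IsReduced] {M : Type*} [AddCommGroup M]
    (j : Δ.support) (G : ι → M) :
    (∑ i, if Δ.IsPos i then G i else 0) - (∑ i, if Δ.IsPos (refl P j • i) then G i else 0) =
      G j - G (refl P j • (j : ι)) := by
  have hne : (j : ι) ≠ refl P j • (j : ι) := fun h => by
    have h1 := Δ.isPos_simple j
    have h2 := (Δ.isPos_refl_smul_self_iff (j : ι)).1
    rw [← h] at h2
    exact h2 h1 h1
  have hself : ¬ Δ.IsPos (refl P j • (j : ι)) := fun h =>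
    (Δ.isPos_refl_smul_self_iff (j : ι)).1 h (Δ.isPos_simple j)
  rw [← Finset.sum_sub_distrib, ← Finset.sum_subset (Finset.subset_univ {(j : ι),
    refl P j • (j : ι)}), Finset.sum_pair hne]
  · rw [refl_smul_refl_smul]
    simp [hself, Δ.isPos_simple j, sub_eq_add_neg]
  · intro i _ hi
    simp only [Finset.mem_insert, Finset.mem_singleton, not_or] at hi
    have : Δ.IsPos i ↔ Δ.IsPos (refl P j • i) := by
      refine ⟨fun h => Δ.isPos_refl_smul h hi.1, fun h => ?_⟩
      have := Δ.isPos_refl_smul h (j := j) (fun h' => hi.2 ?_)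
      · rwa [refl_smul_refl_smul] at this
      · exact (refl_smul_refl_smul (P := P) (j : ι) i).symm.trans (congrArg _ h')
    simp [this]

lemma isPos_longest_smul_iff [Finite ι] [P.IsReduced] (i : ι) :
    Δ.IsPos (Δ.longest • i) ↔ ¬ Δ.IsPos i := by
  constructor
  · intro h hi
    have := Δ.longest_smul_neg_mem hi
    rw [← root_smul, ← not_isPos_iff] at this
    exact this h
  · intro h
    have := Δ.longest_smul_neg_mem ((Δ.not_isPos_iff i).1 h)
    have h2 : Δ.longest • (-P.root i) = -(Δ.longest • P.root i) := smul_neg _ _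
    rw [h2, neg_neg, ← root_smul] at this
    exact this

end SimpleRoots

/-! ### Faithfulness on the roots and finiteness of the reflection group -/

lemma smul_sub_mem_rootSpan (w : P.weylGroup) (x : V₀) :
    w • x - x ∈ P.rootSpan ℝ := by
  obtain ⟨w, hw⟩ := w
  refine RootPairing.weylGroup.induction P
    (pred := fun w hw => ∀ x : V₀, (⟨w, hw⟩ : P.weylGroup) • x - x ∈ P.rootSpan ℝ) ?_ ?_ ?_ hw x
  · intro i x
    change SimpleRoots.refl P i • x - x ∈ _
    rw [SimpleRoots.refl_smul, sub_sub_cancel_left]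
    exact neg_mem (Submodule.smul_mem _ _ (Submodule.subset_span ⟨i, rfl⟩))
  · intro x
    change (1 : P.weylGroup) • x - x ∈ _
    rw [one_smul, sub_self]; exact zero_mem _
  · intro w w' hw hw' h h' x
    change ((⟨w, hw⟩ : P.weylGroup) * ⟨w', hw'⟩) • x - x ∈ _
    rw [mul_smul, ← sub_add_sub_cancel]
    exact add_mem (h _) (h' _)

/-- The roots need not span, so fixing them is not obviously enough. However, wx − x lies in the
root span and, since w preserves each coroot, is killed by all coroots. Anisotropy of the root form
then forces it to vanish. -/
lemma eq_one_of_forall_smul_eq [Finite ι] {w : P.weylGroup} (h : ∀ i : ι, w • i = i) : w = 1 := by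
  have := Fintype.ofFinite ι
  apply Subtype.ext
  apply RootPairing.Equiv.weightHom_injective P
  ext x
  change w • x = (1 : P.weylGroup) • x
  rw [one_smul, ← sub_eq_zero]
  by_contra hne
  have hx := smul_sub_mem_rootSpan w x
  have := P.isAnisotropic_of_isValuedIn ℝ
  obtain ⟨i, hi⟩ := P.exists_coroot_ne ℝ (x := ⟨w • x - x, hx⟩)
    (fun h0 => hne (congrArg Subtype.val h0))
  refine hi ?_
  have h1 : algebraMap ℝ ℝ (P.coroot'In ℝ i ⟨w • x - x, hx⟩) = P.coroot' i (w • x - x) :=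
    P.algebraMap_coroot'In_apply ℝ i ⟨w • x - x, hx⟩
  rw [Algebra.algebraMap_self_apply] at h1
  rw [h1, map_sub, coroot'_smul_of_smul_eq w (i := i) (by rw [← SimpleRoots.root_smul, h]),
    sub_self]

instance [Finite ι] : Finite P.weylGroup :=
  Finite.of_injective (fun (w : P.weylGroup) (i : ι) => w • i) fun w w' h => by
    rw [← inv_mul_eq_one]
    refine eq_one_of_forall_smul_eq fun i => ?_
    rw [mul_smul, inv_smul_eq_iff]
    exact (congrFun h i).symm

/-! ### Parameters on all roots -/

namespace Parameter

variable {Δ : SimpleRoots P} (k : Parameter Δ)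

open Classical in
/-- The extension of a parameter function to all roots, invariant under the reflection group. -/
noncomputable def ext (i : ι) : ℂ :=
  -- The value 0 on orbits without a simple root makes the invariance `ext_smul` hold without first
  -- showing that every root is conjugate to a simple one.
  if h : ∃ (j : Δ.support) (w : P.weylGroup), w • P.root j = P.root i then k.val h.choose else 0

lemma ext_eq {i : ι} (j : Δ.support) (w : P.weylGroup) (h : w • P.root j = P.root i) :
    k.ext i = k.val j := by
  have hex : ∃ (j : Δ.support) (w : P.weylGroup), w • P.root j = P.root i := ⟨j, w, h⟩
  obtain ⟨w', hw'⟩ := hex.choose_spec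
  rw [ext, dif_pos hex]
  refine k.val_eq _ _ (w⁻¹ * w') ?_
  rw [mul_smul, hw', ← h, inv_smul_smul]

lemma ext_simple (j : Δ.support) : k.ext j = k.val j := k.ext_eq j 1 (one_smul _ _)

lemma ext_smul (w : P.weylGroup) (i : ι) : k.ext (w • i) = k.ext i := by
  by_cases hex : ∃ (j : Δ.support) (w : P.weylGroup), w • P.root j = P.root i
  · obtain ⟨j, w', h⟩ := hex
    rw [k.ext_eq j w' h, k.ext_eq j (w * w')]
    rw [mul_smul, h, SimpleRoots.root_smul]
  · have hex' : ¬ ∃ (j : Δ.support) (w' : P.weylGroup), w' • P.root j = P.root (w • i) := by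
      rintro ⟨j, w', h⟩
      refine hex ⟨j, w⁻¹ * w', ?_⟩
      rw [mul_smul, h, SimpleRoots.root_smul, inv_smul_smul]
    rw [ext, dif_neg hex', ext, dif_neg hex]

end Parameter

/-! ### Roots and coroots on the complexified space -/

lemma corootC_smul (w : P.weylGroup) (i : ι) (x : ℂ ⊗[ℝ] V₀) :
    corootC P (w • i) (act P w x) = corootC P i x :=
  corootC_act_of_smul_eq w (SimpleRoots.root_smul w i).symm x

lemma corootC_refl_smul_self (i : ι) (x : ℂ ⊗[ℝ] V₀) :
    corootC P (SimpleRoots.refl P i • i) x = -corootC P i x := by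
  have h := corootC_smul (SimpleRoots.refl P i) i (act P (SimpleRoots.refl P i) x)
  rw [← act_mul, SimpleRoots.refl_mul_self, act_one, corootC_refl] at h
  exact h

/-- The image of a root in `V = ℂ ⊗ V₀`. -/
noncomputable def rootC (P : RootPairing ι ℝ V₀ N) (i : ι) : ℂ ⊗[ℝ] V₀ := 1 ⊗ₜ P.root i

lemma act_refl (i : ι) (x : ℂ ⊗[ℝ] V₀) :
    act P (SimpleRoots.refl P i) x = x - corootC P i x • rootC P i := by
  induction x with
  | zero => simp
  | add x y hx hy => rw [map_add, hx, hy, map_add, add_smul]; abel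
  | tmul z x =>
    rw [act_tmul, corootC_tmul, SimpleRoots.refl_smul, TensorProduct.tmul_sub, rootC,
      TensorProduct.smul_tmul', TensorProduct.tmul_smul, smul_eq_mul, mul_one]
    congr 1
    rw [TensorProduct.smul_tmul', Complex.real_smul, mul_comm]

end GradedHecke

namespace GradedHecke

variable {ι V₀ N : Type u} [AddCommGroup V₀] [Module ℝ V₀] [AddCommGroup N] [Module ℝ N]
  {P : RootPairing ι ℝ V₀ N} {Δ : SimpleRoots P}

/-! ### The Poincaré–Birkhoff–Witt theorem -/

noncomputable section

/-- A vector as a linear form in the variables that correspond to the elements of a basis. -/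
def linForm {κ V : Type*} [Fintype κ] [AddCommGroup V] [Module ℂ V] (b : Module.Basis κ ℂ V) :
    V →ₗ[ℂ] MvPolynomial κ ℂ :=
  b.constr ℂ MvPolynomial.X

lemma linForm_basis {κ V : Type*} [Fintype κ] [AddCommGroup V] [Module ℂ V]
    (b : Module.Basis κ ℂ V) (j : κ) : linForm b (b j) = MvPolynomial.X j :=
  b.constr_basis ℂ _ j

namespace PBW

variable {κ : Type} [Fintype κ] (b : Module.Basis κ ℂ (ℂ ⊗[ℝ] V₀)) (k : Parameter Δ)

/-- The reflection group acts on `W → S(V)` by left translation. -/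
def T : P.weylGroup →* Module.End (MvPolynomial κ ℂ) (P.weylGroup → MvPolynomial κ ℂ) where
  toFun w := LinearMap.funLeft _ _ (fun u => w⁻¹ * u)
  map_one' := by ext; simp
  map_mul' w w' := by
    refine LinearMap.ext fun g => funext fun u => ?_
    simp [LinearMap.funLeft_apply, mul_assoc]

omit [Fintype κ] in
lemma T_apply (w : P.weylGroup) (g : P.weylGroup → MvPolynomial κ ℂ) (u : P.weylGroup) :
    T w g u = g (w⁻¹ * u) := rfl

variable [Fintype ι]

open Classical in
/-- The operator by which `v ∈ V` acts on `W → S(V)`. -/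
def F : ℂ ⊗[ℝ] V₀ →ₗ[ℂ] Module.End (MvPolynomial κ ℂ) (P.weylGroup → MvPolynomial κ ℂ) where
  toFun v :=
    -- A function g stands for ∑ t_u g(u) in ⊕ t_u S(V). The formula is left multiplication by v,
    -- from v t_w = t_w w⁻¹(v) + ∑ k_β⟨v, β^∨⟩t_{s_β w} over β > 0 with w⁻¹β < 0. Reading off the
    -- coefficient at u = s_β w turns the last condition into u⁻¹β > 0.
    { toFun := fun g u => linForm b (act P u⁻¹ v) * g u +
        ∑ i, if Δ.IsPos i then
          (if Δ.IsPos (u⁻¹ • i) then (k.ext i * corootC P i v) • g (SimpleRoots.refl P i * u)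
            else 0) else 0
      map_add' := fun g g' => by
        funext u
        simp only [Pi.add_apply, mul_add, smul_add]
        rw [add_add_add_comm, ← Finset.sum_add_distrib]
        congr 1
        refine Finset.sum_congr rfl fun i _ => ?_
        split_ifs <;> simp
      map_smul' := fun p g => by
        funext u
        simp only [Pi.smul_apply, smul_eq_mul, RingHom.id_apply, mul_add, Finset.mul_sum]
        congr 1
        · ring
        · refine Finset.sum_congr rfl fun i _ => ?_
          split_ifs <;> simp }
  map_add' v v' := by
    refine LinearMap.ext fun g => funext fun u => ?_
    simp only [LinearMap.coe_mk, AddHom.coe_mk, LinearMap.add_apply, Pi.add_apply, map_add,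
      add_mul, mul_add, add_smul]
    rw [add_add_add_comm, ← Finset.sum_add_distrib]
    congr 1
    refine Finset.sum_congr rfl fun i _ => ?_
    split_ifs <;> simp
  map_smul' c v := by
    refine LinearMap.ext fun g => funext fun u => ?_
    simp only [LinearMap.coe_mk, AddHom.coe_mk, LinearMap.smul_apply, Pi.smul_apply, map_smul,
      smul_eq_mul, RingHom.id_apply, smul_add, Finset.smul_sum, smul_mul_assoc]
    congr 1
    refine Finset.sum_congr rfl fun i _ => ?_
    split_ifs
    · rw [smul_smul]; congr 1; ring
    all_goals simp

open Classical in
lemma F_apply (v : ℂ ⊗[ℝ] V₀) (g : P.weylGroup → MvPolynomial κ ℂ) (u : P.weylGroup) :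
    F b k v g u = linForm b (act P u⁻¹ v) * g u +
        ∑ i, if Δ.IsPos i then
          (if Δ.IsPos (u⁻¹ • i) then (k.ext i * corootC P i v) • g (SimpleRoots.refl P i * u)
            else 0) else 0 := rfl

open Classical in
-- After reindexing by the simple reflection, both sides carry the same summands, over the positive
-- roots and over the roots made positive by it. Only ±α_j survive, and exactly one of them
-- satisfies the condition at u.
lemma T_F_sub_F_T [P.IsReduced] (j : Δ.support) (v : ℂ ⊗[ℝ] V₀) :
    T (SimpleRoots.refl P j) * F b k v
      - F b k (act P (SimpleRoots.refl P j) v) * T (SimpleRoots.refl P j) =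
    algebraMap ℂ _ (k.val j * corootC P j v) := by
  refine LinearMap.ext fun g => funext fun u => ?_
  set s := SimpleRoots.refl P (j : ι) with hs
  have hss : s * s = 1 := SimpleRoots.refl_mul_self _
  have hsi : s⁻¹ = s := Hecke.inv_refl _
  set G : ι → MvPolynomial κ ℂ := fun i => if Δ.IsPos (u⁻¹ • s • i) then
    (k.ext i * corootC P i v) • g (SimpleRoots.refl P i * s * u) else 0 with hG
  have h1 := Δ.sum_isPos_sub_sum_isPos_refl j G
  rw [← hs] at h1
  have e1 : T s (F b k v g) u = linForm b (act P (u⁻¹ * s) v) * g (s * u) +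
      ∑ i, if Δ.IsPos i then G i else 0 := by
    rw [T_apply, F_apply, hsi, mul_inv_rev, hsi]
    congr 1
  have e2 : F b k (act P s v) (T s g) u = linForm b (act P (u⁻¹ * s) v) * g (s * u) +
      ∑ i, if Δ.IsPos (s • i) then G i else 0 := by
    rw [F_apply, T_apply, hsi, act_mul]
    congr 1
    rw [← Equiv.sum_comp (MulAction.toPerm s)]
    refine Finset.sum_congr rfl fun i _ => ?_
    simp only [hG, MulAction.toPerm_apply, k.ext_smul, corootC_smul, T_apply, hsi]
    rw [SimpleRoots.refl_conj, hsi]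
    have : s * (s * SimpleRoots.refl P i * s * u) = SimpleRoots.refl P i * s * u := by
      rw [← mul_assoc, ← mul_assoc, ← mul_assoc, hss, one_mul]
    rw [this]
  rw [LinearMap.sub_apply, Pi.sub_apply, Module.End.mul_apply, Module.End.mul_apply, e1, e2, add_sub_add_left_eq_sub, h1]
  have h2 : Δ.IsPos (u⁻¹ • s • (j : ι)) ↔ ¬ Δ.IsPos (u⁻¹ • (j : ι)) :=
    Δ.isPos_smul_refl_smul_iff _ _
  have h3 : SimpleRoots.refl P (s • (j : ι)) = s := by
    simpa using SimpleRoots.refl_smul_refl_self (P := P) 1 (j : ι)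
  have h4 : s • s • (j : ι) = j := SimpleRoots.refl_smul_refl_smul _ _
  simp only [hG]
  rw [h4, h3, k.ext_smul, h2, hs, corootC_refl_smul_self, ← hs, k.ext_simple, hss, one_mul,
    Module.algebraMap_end_apply, Pi.smul_apply]
  by_cases h : Δ.IsPos (u⁻¹ • (j : ι)) <;> simp [h]

open Classical in
-- A correction term could be nonzero only at u = s_i, but there u⁻¹ makes the positive root i
-- negative.
lemma F_single_one (v : ℂ ⊗[ℝ] V₀) (p : MvPolynomial κ ℂ) :
    F b k v (Pi.single 1 p) = linForm b v • Pi.single 1 p := by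
  funext u
  rw [F_apply, Finset.sum_eq_zero, add_zero]
  · by_cases hu : u = 1
    · subst hu; simp [act_one]
    · simp [hu]
  · intro i _
    split_ifs with h1 h2
    · rw [Pi.single_eq_of_ne, smul_zero]
      intro h
      rw [mul_eq_one_iff_inv_eq, Hecke.inv_refl] at h
      subst h
      rw [Hecke.inv_refl] at h2
      exact (Δ.isPos_refl_smul_self_iff i).1 h2 h1
    all_goals rfl

/-- The scalar corrections from moving the reflection past the two factors cancel, since F_v and
F_{s(v)} differ by ⟨v, α^∨⟩F_α. This needs no commutativity of the F_v, which is what it is used to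
prove. -/
lemma F_commutator_T [P.IsReduced] (j : Δ.support) (v v' : ℂ ⊗[ℝ] V₀) :
    (F b k v * F b k v' - F b k v' * F b k v) * T (SimpleRoots.refl P j) =
      T (SimpleRoots.refl P j) *
        (F b k (act P (SimpleRoots.refl P j) v) * F b k (act P (SimpleRoots.refl P j) v') -
          F b k (act P (SimpleRoots.refl P j) v') * F b k (act P (SimpleRoots.refl P j) v)) := by
  set s := SimpleRoots.refl P (j : ι) with hs
  have h : ∀ x, F b k x * T s = T s * F b k (act P s x) + (k.val j * corootC P j x) • 1 := by
    intro x
    have h1 := T_F_sub_F_T b k j (act P s x)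
    rw [← hs, ← act_mul, hs, SimpleRoots.refl_mul_self, act_one, corootC_refl, ← hs, mul_neg,
      map_neg, Algebra.algebraMap_eq_smul_one] at h1
    rw [sub_eq_iff_eq_add] at h1
    rw [h1]; abel
  have h2 : ∀ x, act P s x = x - corootC P j x • rootC P j := act_refl _
  rw [sub_mul, mul_assoc, mul_assoc, h, h, mul_add, mul_add, ← mul_assoc, ← mul_assoc, h, h,
    add_mul, add_mul, mul_sub]
  simp only [mul_assoc, smul_mul_assoc, one_mul, mul_smul_comm, mul_one]
  have h3 : ∀ x, F b k x = F b k (act P s x) + corootC P j x • F b k (rootC P j) := by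
    intro x; rw [h2, map_sub, map_smul]; abel
  have e1 := h3 v
  have e2 := h3 v'
  generalize F b k (act P s v) = A at *
  generalize F b k (act P s v') = B at *
  rw [e1, e2]
  module

/-- At the identity the operators are multiplications by polynomials, so commutators vanish on
functions supported there. `F_commutator_T` carries this to every point of W along products of
simple reflections. -/
lemma F_comm [P.IsReduced] (v v' : ℂ ⊗[ℝ] V₀) :
    F b k v * F b k v' = F b k v' * F b k v := by
  classical
  have := Fintype.ofFinite P.weylGroup
  have key : ∀ w : P.weylGroup, ∀ (p : MvPolynomial κ ℂ) v v',
      (F b k v * F b k v' - F b k v' * F b k v) (Pi.single w p) = 0 := by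
    intro w
    induction w using Δ.weylGroup_induction with
    | one =>
      intro p v v'
      simp only [LinearMap.sub_apply, Module.End.mul_apply, F_single_one, map_smul, smul_smul]
      rw [mul_comm, sub_self]
    | mul j w ih =>
      intro p v v'
      have h : (Pi.single (SimpleRoots.refl P j * w) p : P.weylGroup → MvPolynomial κ ℂ) =
          T (SimpleRoots.refl P j) (Pi.single w p) := by
        funext u
        simp only [T_apply, Pi.single_apply, inv_mul_eq_iff_eq_mul]
      rw [h, ← Module.End.mul_apply, F_commutator_T, Module.End.mul_apply, ih, map_zero]
  rw [← sub_eq_zero]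
  refine LinearMap.pi_ext fun w p => ?_
  rw [key, LinearMap.zero_apply]

/-- The action of the graded Hecke algebra on `W → S(V)`. -/
def action [P.IsReduced] :
    Hecke k →ₐ[ℂ] Module.End (MvPolynomial κ ℂ) (P.weylGroup → MvPolynomial κ ℂ) :=
  Hecke.lift k T (F b k) (F_comm b k) (T_F_sub_F_T b k)

variable [P.IsReduced]

open Classical in
/-- The coordinates of an element of the graded Hecke algebra with respect to the basis `t_w`,
`w ∈ W`, of a free left module over `S(V)`. -/
def coord : Hecke k →ₗ[ℂ] P.weylGroup → MvPolynomial κ ℂ where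
  -- The anti-involution exchanges the order of the factors, so that polynomials stand on the left.
  -- As a result the value at u is the coefficient of t_{u⁻¹}.
  toFun h := action b k (Hecke.bullet k h).unop (Pi.single 1 1)
  map_add' h h' := by simp
  map_smul' c h := by simp

lemma coord_mul_t (h : Hecke k) (w u : P.weylGroup) :
    coord b k (h * Hecke.t k w) u = coord b k h (w * u) := by
  simp [coord, Hecke.bullet_t, action, Hecke.lift_t, T_apply]

lemma coord_f_mul (h : Hecke k) (v : ℂ ⊗[ℝ] V₀) :
    coord b k (Hecke.f k v * h) = linForm b v • coord b k h := by
  simp [coord, Hecke.bullet_f, action, Hecke.lift_f, F_single_one]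

open Classical in
lemma coord_one : coord b k 1 = Pi.single 1 1 := by
  simp [coord]

end PBW

/-! ### The map from S(V) and the spanning half of the PBW theorem -/

namespace Hecke

variable (k : Parameter Δ)

lemma f_mem_adjoin (v : ℂ ⊗[ℝ] V₀) : f k v ∈ Algebra.adjoin ℂ (Set.range (f k)) :=
  Algebra.subset_adjoin ⟨v, rfl⟩

/-- The algebra homomorphism `S(V) → ℍ`. -/
def ofPoly {κ : Type} (b : Module.Basis κ ℂ (ℂ ⊗[ℝ] V₀)) : MvPolynomial κ ℂ →ₐ[ℂ] Hecke k :=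
  -- Evaluation of polynomials needs a commutative target, so it takes place in the subalgebra
  -- generated by the commuting elements f_v.
  letI : CommRing (Algebra.adjoin ℂ (Set.range (f k))) :=
    Algebra.adjoinCommRingOfComm ℂ (by
      rintro _ ⟨v, rfl⟩ _ ⟨v', rfl⟩
      exact f_comm k v v')
  (Algebra.adjoin ℂ (Set.range (f k))).val.comp
    (MvPolynomial.aeval fun j => ⟨f k (b j), f_mem_adjoin k (b j)⟩)

lemma ofPoly_X {κ : Type} (b : Module.Basis κ ℂ (ℂ ⊗[ℝ] V₀)) (j : κ) :
    ofPoly k b (MvPolynomial.X j) = f k (b j) := by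
  simp [ofPoly]

lemma ofPoly_linForm {κ : Type} [Fintype κ] (b : Module.Basis κ ℂ (ℂ ⊗[ℝ] V₀)) (v : ℂ ⊗[ℝ] V₀) :
    ofPoly k b (linForm b v) = f k v := by
  have : (ofPoly k b).toLinearMap ∘ₗ linForm b = f k := by
    refine b.ext fun j => ?_
    simp [linForm_basis, ofPoly_X]
  exact LinearMap.congr_fun this v

/-- The quotient map from the free algebra. -/
def mk : FreeAlgebra ℂ (P.weylGroup ⊕ (ℂ ⊗[ℝ] V₀)) →ₐ[ℂ] Hecke k := RingQuot.mkAlgHom ℂ (Rel k)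

/-- A subset of the graded Hecke algebra that is a left ideal under the generators is everything
once it contains `1`. -/
lemma induction_left {p : Hecke k → Prop} (one : p 1) (add : ∀ x y, p x → p y → p (x + y))
    (smul : ∀ (c : ℂ) x, p x → p (c • x)) (t_mul : ∀ w x, p x → p (t k w * x))
    (f_mul : ∀ v x, p x → p (f k v * x)) (x : Hecke k) : p x := by
  obtain ⟨y, rfl⟩ := (RingQuot.mkAlgHom_surjective ℂ (Rel k) : Function.Surjective (mk k)) x
  suffices h : ∀ x, p x → p (mk k y * x) by
    have := h 1 one
    rw [mul_one] at this
    exact this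
  induction y using FreeAlgebra.induction with
  | grade0 r =>
    intro x hx
    rw [AlgHom.commutes, ← Algebra.smul_def]; exact smul r x hx
  | grade1 x =>
    rcases x with w | v
    · exact t_mul w
    · exact f_mul v
  | mul a b ha hb => intro x hx; rw [map_mul, mul_assoc]; exact ha _ (hb _ hx)
  | add a b ha hb => intro x hx; rw [map_add, add_mul]; exact add _ _ (ha _ hx) (hb _ hx)

variable {κ : Type} [Fintype κ] (b : Module.Basis κ ℂ (ℂ ⊗[ℝ] V₀))

/-- The span contains 1 and is clearly stable under left multiplication by f_v. Stability under a
simple t_s comes from straightening with the cross relation, one variable at a time; simple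
reflections generate W. -/
lemma mem_span_ofPoly_mul_t [Finite ι] [P.IsReduced] (x : Hecke k) :
    x ∈ Submodule.span ℂ (Set.range fun q : MvPolynomial κ ℂ × P.weylGroup =>
      ofPoly k b q.1 * t k q.2) := by
  set S := Submodule.span ℂ (Set.range fun q : MvPolynomial κ ℂ × P.weylGroup =>
      ofPoly k b q.1 * t k q.2) with hS
  have mem : ∀ p w, ofPoly k b p * t k w ∈ S := fun p w => Submodule.subset_span ⟨(p, w), rfl⟩
  have hf : ∀ v x, x ∈ S → f k v * x ∈ S := by
    intro v x hx
    induction hx using Submodule.span_induction with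
    | mem x h =>
      obtain ⟨⟨p, w⟩, rfl⟩ := h
      change f k v * (ofPoly k b p * t k w) ∈ S
      rw [← ofPoly_linForm k b, ← mul_assoc, ← map_mul]
      exact mem _ _
    | zero => rw [mul_zero]; exact zero_mem _
    | add x y _ _ hx hy => rw [mul_add]; exact add_mem hx hy
    | smul c x _ hx => rw [mul_smul_comm]; exact Submodule.smul_mem _ c hx
  have hts : ∀ (j : Δ.support) x, x ∈ S → t k (SimpleRoots.refl P j) * x ∈ S := by
    intro j x hx
    induction hx using Submodule.span_induction with
    | mem x h =>
      obtain ⟨⟨p, w⟩, rfl⟩ := h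
      change t k _ * (ofPoly k b p * t k w) ∈ S
      induction p using MvPolynomial.induction_on with
      | C a =>
        rw [← MvPolynomial.algebraMap_eq, AlgHom.commutes, ← mul_assoc, ← Algebra.commutes,
          mul_assoc, ← map_mul, ← Algebra.smul_def]
        have := mem 1 (SimpleRoots.refl P j * w)
        rw [map_one, one_mul] at this
        exact Submodule.smul_mem _ a this
      | add p q hp hq => rw [map_add, add_mul, mul_add]; exact add_mem hp hq
      | mul_X p l hp =>
        have h := cross k j (b l)
        rw [sub_eq_iff_eq_add] at h
        rw [mul_comm, map_mul, ofPoly_X, mul_assoc, ← mul_assoc, h, add_mul, mul_assoc,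
          ← Algebra.smul_def]
        exact add_mem (Submodule.smul_mem _ _ (mem _ _)) (hf _ _ hp)
    | zero => rw [mul_zero]; exact zero_mem _
    | add x y _ _ hx hy => rw [mul_add]; exact add_mem hx hy
    | smul c x _ hx => rw [mul_smul_comm]; exact Submodule.smul_mem _ c hx
  have ht : ∀ w x, x ∈ S → t k w * x ∈ S := by
    intro w
    induction w using Δ.weylGroup_induction with
    | one => intro x hx; rwa [map_one, one_mul]
    | mul j w ih => intro x hx; rw [map_mul, mul_assoc]; exact hts j _ (ih x hx)
  refine induction_left k (p := fun x => x ∈ S) ?_ (fun _ _ => add_mem)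
    (fun c x hx => Submodule.smul_mem _ c hx) ht hf x
  simpa using mem 1 1

end Hecke

open Classical in
-- The independence half of PBW: a polynomial is recovered from its image in ℍ.
lemma PBW.coord_ofPoly {κ : Type} [Fintype κ] (b : Module.Basis κ ℂ (ℂ ⊗[ℝ] V₀))
    (k : Parameter Δ) [Fintype ι] [P.IsReduced] (p : MvPolynomial κ ℂ) :
    coord b k (Hecke.ofPoly k b p) = Pi.single 1 p := by
  induction p using MvPolynomial.induction_on with
  | C a =>
    rw [← MvPolynomial.algebraMap_eq, AlgHom.commutes, Algebra.algebraMap_eq_smul_one, map_smul,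
      coord_one]
    funext u
    by_cases hu : u = 1
    · subst hu; simp [MvPolynomial.smul_eq_C_mul]
    · simp [hu]
  | add p q hp hq => rw [map_add, map_add, hp, hq, Pi.single_add]
  | mul_X p l hp =>
    rw [mul_comm, map_mul, Hecke.ofPoly_X, coord_f_mul, hp, linForm_basis]
    funext u
    by_cases hu : u = 1
    · subst hu; simp
    · simp [hu]

end

end GradedHecke

namespace GradedHecke

/-! ### Koszul complexes over a polynomial ring -/

/-- Operators of contraction and exterior multiplication on the graded pieces of an exterior
algebra with coefficients in a module on which commuting operators act. -/
structure KoszulData (κ : Type) [DecidableEq κ] [Fintype κ] (L : ℕ → Type u)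
    [∀ n, AddCommGroup (L n)] [∀ n, Module ℂ (L n)] where
  /-- contraction -/
  c (n : ℕ) : κ → L (n + 1) →ₗ[ℂ] L n
  /-- exterior multiplication -/
  w (n : ℕ) : κ → L n →ₗ[ℂ] L (n + 1)
  /-- the operators on the coefficients -/
  e (n : ℕ) : κ → L n →ₗ[ℂ] L n
  c_w_zero (j l : κ) (x : L 0) : c 0 j (w 0 l x) = if j = l then x else 0
  c_w (n : ℕ) (j l : κ) (x : L (n + 1)) :
    c (n + 1) j (w (n + 1) l x) + w n l (c n j x) = if j = l then x else 0
  sum_w_c (n : ℕ) (x : L (n + 1)) : ∑ j, w n j (c n j x) = ((n + 1 : ℕ) : ℂ) • x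
  c_c (n : ℕ) (j l : κ) (x : L (n + 2)) : c n j (c (n + 1) l x) = -c n l (c (n + 1) j x)
  e_c (n : ℕ) (j l : κ) (x : L (n + 1)) : e n j (c n l x) = c n l (e (n + 1) j x)
  e_e (n : ℕ) (j l : κ) (x : L n) : e n j (e n l x) = e n l (e n j x)

namespace KoszulData

noncomputable section

open MvPolynomial

variable {κ : Type} [DecidableEq κ] [Fintype κ] {L : ℕ → Type u}
    [∀ n, AddCommGroup (L n)] [∀ n, Module ℂ (L n)] (K : KoszulData κ L)

/-- The Koszul differential. -/
def D (n : ℕ) : MvPolynomial κ ℂ ⊗[ℂ] L (n + 1) →ₗ[ℂ] MvPolynomial κ ℂ ⊗[ℂ] L n :=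
  ∑ j, (TensorProduct.map (LinearMap.mulLeft ℂ (X j)) (K.c n j)
    - TensorProduct.map LinearMap.id (K.c n j ∘ₗ K.e (n + 1) j))

lemma D_tmul (n : ℕ) (p : MvPolynomial κ ℂ) (x : L (n + 1)) :
    K.D n (p ⊗ₜ x) = ∑ j, ((X j * p) ⊗ₜ K.c n j x - p ⊗ₜ K.c n j (K.e (n + 1) j x)) := by
  simp [D]

/-- The homotopy. -/
def s (n : ℕ) : MvPolynomial κ ℂ ⊗[ℂ] L n →ₗ[ℂ] MvPolynomial κ ℂ ⊗[ℂ] L (n + 1) :=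
  ∑ j, TensorProduct.map (pderiv j).toLinearMap (K.w n j)

lemma s_tmul (n : ℕ) (p : MvPolynomial κ ℂ) (x : L n) :
    K.s n (p ⊗ₜ x) = ∑ j, pderiv j p ⊗ₜ K.w n j x := by
  simp [s]

omit [DecidableEq κ] in
lemma sum_sum_eq_zero_of_antisymm {M : Type*} [AddCommGroup M] [Module ℂ M] (a : κ → κ → M)
    (h : ∀ j l, a j l = -a l j) : ∑ j, ∑ l, a j l = 0 := by
  have h1 : ∑ j, ∑ l, a j l = -∑ j, ∑ l, a j l := by
    conv_lhs => rw [Finset.sum_comm]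
    simp only [← Finset.sum_neg_distrib]
    exact Finset.sum_congr rfl fun j _ => Finset.sum_congr rfl fun l _ => h _ _
  have h2 : (2 : ℂ) • ∑ j, ∑ l, a j l = 0 := by
    rw [two_smul]; nth_rewrite 1 [h1]; exact neg_add_cancel _
  exact (smul_eq_zero.1 h2).resolve_left two_ne_zero

/-- The operators X_j − e_j commute while the contractions anticommute, so the double sum is
antisymmetric. -/
lemma D_D (n : ℕ) (z : MvPolynomial κ ℂ ⊗[ℂ] L (n + 2)) : K.D n (K.D (n + 1) z) = 0 := by
  induction z with
  | zero => simp
  | add x y hx hy => rw [map_add, map_add, hx, hy, add_zero]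
  | tmul p x =>
    rw [D_tmul, map_sum]
    simp only [map_sub, D_tmul, ← Finset.sum_sub_distrib]
    apply sum_sum_eq_zero_of_antisymm
    intro j l
    simp only [← K.e_c]
    rw [K.c_c n l j, K.c_c n j l, mul_left_comm (X l) (X j), K.e_e n l j]
    simp only [map_neg, TensorProduct.tmul_neg]
    abel

/-- The elements of polynomial degree less than `d`. -/
def degLT (L : ℕ → Type u) [∀ n, AddCommGroup (L n)] [∀ n, Module ℂ (L n)] (κ : Type) (n d : ℕ) :
    Submodule ℂ (MvPolynomial κ ℂ ⊗[ℂ] L n) :=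
  Submodule.span ℂ {z | ∃ (m : ℕ) (p : MvPolynomial κ ℂ) (x : L n), m < d ∧ p.IsHomogeneous m ∧
    p ⊗ₜ x = z}

omit [DecidableEq κ] [Fintype κ] in
lemma tmul_mem_degLT {n d m : ℕ} {p : MvPolynomial κ ℂ} (hp : p.IsHomogeneous m) (h : m < d)
    (x : L n) : p ⊗ₜ x ∈ degLT L κ n d :=
  Submodule.subset_span ⟨m, p, x, h, hp, rfl⟩

omit [DecidableEq κ] [Fintype κ] in
lemma pderiv_tmul_mem_degLT {n d m : ℕ} {p : MvPolynomial κ ℂ} (hp : p.IsHomogeneous m)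
    (h : m < d + 1) (j : κ) (x : L n) : pderiv j p ⊗ₜ x ∈ degLT L κ n d := by
  rcases m with _ | m
  · rw [← totalDegree_zero_iff_isHomogeneous, totalDegree_eq_zero_iff_eq_C] at hp
    rw [hp, pderiv_C, TensorProduct.zero_tmul]
    exact zero_mem _
  · exact tmul_mem_degLT (m := m) hp.pderiv (by omega) x

omit [DecidableEq κ] [Fintype κ] in
lemma degLT_mono (n : ℕ) {d d' : ℕ} (h : d ≤ d') : degLT L κ n d ≤ degLT L κ n d' := by
  refine Submodule.span_mono ?_
  rintro _ ⟨m, p, x, hm, hp, rfl⟩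
  exact ⟨m, p, x, hm.trans_le h, hp, rfl⟩

omit [DecidableEq κ] [Fintype κ] in
lemma exists_mem_degLT (n : ℕ) (z : MvPolynomial κ ℂ ⊗[ℂ] L n) : ∃ d, z ∈ degLT L κ n d := by
  induction z with
  | zero => exact ⟨0, zero_mem _⟩
  | add x y hx hy =>
    obtain ⟨d, hd⟩ := hx
    obtain ⟨d', hd'⟩ := hy
    exact ⟨max d d', add_mem (degLT_mono n (le_max_left _ _) hd)
      (degLT_mono n (le_max_right _ _) hd')⟩
  | tmul p x =>
    refine ⟨p.totalDegree + 1, ?_⟩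
    conv => arg 2; rw [← sum_homogeneousComponent p]
    rw [TensorProduct.sum_tmul]
    exact sum_mem fun i hi => tmul_mem_degLT (homogeneousComponent_isHomogeneous i p)
      (Finset.mem_range.1 hi) x

omit [Fintype κ] in
lemma pderiv_X_mul (j l : κ) (p : MvPolynomial κ ℂ) :
    pderiv l (X j * p) = X j * pderiv l p + if j = l then p else 0 := by
  rw [Derivation.leibniz, pderiv_X, smul_eq_mul, smul_eq_mul]
  by_cases h : l = j
  · subst h; simp
  · simp [Ne.symm h]

/-- Without the operators e_j, the sum Ds + sD is multiplication by total degree, by Euler's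
identity for polynomials and for exterior powers. The terms with e_j keep a derivative of p without
the compensating variable, so they fall into lower polynomial degree. -/
lemma homotopy_succ {n d m : ℕ} {p : MvPolynomial κ ℂ} (hp : p.IsHomogeneous m) (h : m < d + 1)
    (x : L (n + 1)) :
    K.D (n + 1) (K.s (n + 1) (p ⊗ₜ x)) + K.s n (K.D n (p ⊗ₜ x)) - ((d + (n + 1) : ℕ) : ℂ) • p ⊗ₜ x
      ∈ degLT L κ (n + 1) d := by
  have h1 : K.D (n + 1) (K.s (n + 1) (p ⊗ₜ x)) + K.s n (K.D n (p ⊗ₜ x)) =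
      ((m + (n + 1) : ℕ) : ℂ) • p ⊗ₜ x -
      ∑ l, ∑ j, pderiv l p ⊗ₜ (K.c (n + 1) j (K.e (n + 2) j (K.w (n + 1) l x)) +
        K.w n l (K.c n j (K.e (n + 1) j x))) := by
    have e1 : K.D (n + 1) (K.s (n + 1) (p ⊗ₜ x)) =
        ∑ l, ∑ j, ((X j * pderiv l p) ⊗ₜ K.c (n + 1) j (K.w (n + 1) l x) -
          pderiv l p ⊗ₜ K.c (n + 1) j (K.e (n + 2) j (K.w (n + 1) l x))) := by
      rw [s_tmul, map_sum]
      simp only [D_tmul]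
    have e2 : K.s n (K.D n (p ⊗ₜ x)) =
        ∑ l, ∑ j, ((X j * pderiv l p + if j = l then p else 0) ⊗ₜ K.w n l (K.c n j x) -
          pderiv l p ⊗ₜ K.w n l (K.c n j (K.e (n + 1) j x))) := by
      rw [D_tmul, map_sum, Finset.sum_comm]
      simp only [map_sub, s_tmul, pderiv_X_mul, Finset.sum_sub_distrib]
    have e3 : ∑ l, ∑ j, ((X j * pderiv l p) ⊗ₜ[ℂ] (if j = l then x else 0)) =
        ((m : ℕ) : ℂ) • p ⊗ₜ x := by
      rw [TensorProduct.smul_tmul', Nat.cast_smul_eq_nsmul, ← hp.sum_X_mul_pderiv,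
        TensorProduct.sum_tmul]
      refine Finset.sum_congr rfl fun l _ => ?_
      rw [Finset.sum_eq_single l]
      · simp
      · intro j _ hj; simp [hj]
      · simp
    have e4 : ∑ l, ∑ j, ((if j = l then p else 0) ⊗ₜ[ℂ] K.w n l (K.c n j x)) =
        ((n + 1 : ℕ) : ℂ) • p ⊗ₜ x := by
      rw [← TensorProduct.tmul_smul, ← K.sum_w_c, TensorProduct.tmul_sum]
      refine Finset.sum_congr rfl fun l _ => ?_
      rw [Finset.sum_eq_single l]
      · simp
      · intro j _ hj; simp [hj]
      · simp
    rw [e1, e2, Nat.cast_add, add_smul, ← e3, ← e4]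
    simp only [← Finset.sum_add_distrib, ← Finset.sum_sub_distrib]
    refine Finset.sum_congr rfl fun l _ => Finset.sum_congr rfl fun j _ => ?_
    rw [← K.c_w n j l, TensorProduct.add_tmul, TensorProduct.tmul_add, TensorProduct.tmul_add]
    abel
  have h2 : ∑ l, ∑ j, pderiv l p ⊗ₜ (K.c (n + 1) j (K.e (n + 2) j (K.w (n + 1) l x)) +
        K.w n l (K.c n j (K.e (n + 1) j x))) ∈ degLT L κ (n + 1) d :=
    sum_mem fun l _ => sum_mem fun j _ => pderiv_tmul_mem_degLT hp h l _
  rw [h1, sub_right_comm]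
  refine sub_mem ?_ h2
  -- Only in the top degree m = d must the scalars agree. Below it both multiples already lie in the
  -- lower stage of the filtration.
  rcases Nat.lt_succ_iff_lt_or_eq.1 h with h | rfl
  · exact sub_mem (Submodule.smul_mem _ _ (tmul_mem_degLT hp h x))
      (Submodule.smul_mem _ _ (tmul_mem_degLT hp h x))
  · rw [sub_self]; exact zero_mem _

lemma homotopy_zero {d m : ℕ} {p : MvPolynomial κ ℂ} (hp : p.IsHomogeneous m) (h : m < d + 1)
    (x : L 0) :
    K.D 0 (K.s 0 (p ⊗ₜ x)) - (d : ℂ) • p ⊗ₜ x ∈ degLT L κ 0 d := by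
  have h1 : K.D 0 (K.s 0 (p ⊗ₜ x)) =
      (m : ℂ) • p ⊗ₜ x - ∑ l, ∑ j, pderiv l p ⊗ₜ K.c 0 j (K.e 1 j (K.w 0 l x)) := by
    rw [TensorProduct.smul_tmul', Nat.cast_smul_eq_nsmul, ← hp.sum_X_mul_pderiv,
      TensorProduct.sum_tmul, s_tmul, map_sum, ← Finset.sum_sub_distrib]
    refine Finset.sum_congr rfl fun l _ => ?_
    rw [D_tmul, Finset.sum_sub_distrib]
    congr 1
    rw [Finset.sum_eq_single l]
    · rw [K.c_w_zero, if_pos rfl]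
    · intro j _ hj; rw [K.c_w_zero, if_neg hj, TensorProduct.tmul_zero]
    · simp
  rw [h1, sub_right_comm]
  refine sub_mem ?_ (sum_mem fun l _ => sum_mem fun j _ => pderiv_tmul_mem_degLT hp h l _)
  rcases Nat.lt_succ_iff_lt_or_eq.1 h with h | rfl
  · exact sub_mem (Submodule.smul_mem _ _ (tmul_mem_degLT hp h x))
      (Submodule.smul_mem _ _ (tmul_mem_degLT hp h x))
  · rw [sub_self]; exact zero_mem _

lemma homotopy_succ_of_mem {n d : ℕ} {z : MvPolynomial κ ℂ ⊗[ℂ] L (n + 1)}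
    (hz : z ∈ degLT L κ (n + 1) (d + 1)) :
    K.D (n + 1) (K.s (n + 1) z) + K.s n (K.D n z) - ((d + (n + 1) : ℕ) : ℂ) • z
      ∈ degLT L κ (n + 1) d := by
  let Φ := K.D (n + 1) ∘ₗ K.s (n + 1) + K.s n ∘ₗ K.D n - ((d + (n + 1) : ℕ) : ℂ) • LinearMap.id
  suffices h : degLT L κ (n + 1) (d + 1) ≤ (degLT L κ (n + 1) d).comap Φ from h hz
  refine Submodule.span_le.2 ?_
  rintro _ ⟨m, p, x, hm, hp, rfl⟩
  exact K.homotopy_succ hp hm x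

lemma homotopy_zero_of_mem {d : ℕ} {z : MvPolynomial κ ℂ ⊗[ℂ] L 0}
    (hz : z ∈ degLT L κ 0 (d + 1)) :
    K.D 0 (K.s 0 z) - (d : ℂ) • z ∈ degLT L κ 0 d := by
  let Φ := K.D 0 ∘ₗ K.s 0 - (d : ℂ) • LinearMap.id
  suffices h : degLT L κ 0 (d + 1) ≤ (degLT L κ 0 d).comap Φ from h hz
  refine Submodule.span_le.2 ?_
  rintro _ ⟨m, p, x, hm, hp, rfl⟩
  exact K.homotopy_zero hp hm x

omit [DecidableEq κ] [Fintype κ] in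
lemma eq_zero_of_mem_degLT_zero {n : ℕ} {z : MvPolynomial κ ℂ ⊗[ℂ] L n}
    (hz : z ∈ degLT L κ n 0) : z = 0 := by
  have : degLT L κ n 0 = ⊥ := by
    refine Submodule.span_eq_bot.2 ?_
    rintro _ ⟨m, p, x, hm, -⟩
    omega
  rwa [this, Submodule.mem_bot] at hz

/-- For a cycle z, the boundary D(s z) agrees with a nonzero multiple of z up to a cycle of smaller
polynomial degree, which is a boundary by induction. -/
theorem exact_succ (n : ℕ) (z : MvPolynomial κ ℂ ⊗[ℂ] L (n + 1)) (hz : K.D n z = 0) :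
    ∃ y, K.D (n + 1) y = z := by
  obtain ⟨d, hd⟩ := exists_mem_degLT (n + 1) z
  induction d generalizing z with
  | zero => exact ⟨0, by rw [map_zero, eq_zero_of_mem_degLT_zero hd]⟩
  | succ d ih =>
    have h := K.homotopy_succ_of_mem hd
    rw [hz, map_zero, add_zero] at h
    obtain ⟨y, hy⟩ := ih _ (by rw [map_sub, D_D, map_smul, hz, smul_zero, sub_zero]) h
    have hne : ((d + (n + 1) : ℕ) : ℂ) ≠ 0 := Nat.cast_ne_zero.2 (by omega)
    refine ⟨((d + (n + 1) : ℕ) : ℂ)⁻¹ • (K.s (n + 1) z - y), ?_⟩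
    rw [map_smul, map_sub, hy, sub_sub_cancel, inv_smul_smul₀ hne]

theorem exact_zero {M : Type*} [AddCommGroup M] [Module ℂ M]
    (aug : MvPolynomial κ ℂ ⊗[ℂ] L 0 →ₗ[ℂ] M) (hinj : ∀ x : L 0, aug (1 ⊗ₜ x) = 0 → x = 0)
    (hD : ∀ y, aug (K.D 0 y) = 0) (z : MvPolynomial κ ℂ ⊗[ℂ] L 0) (hz : aug z = 0) :
    ∃ y, K.D 0 y = z := by
  obtain ⟨d, hd⟩ := exists_mem_degLT 0 z
  induction d generalizing z with
  | zero => exact ⟨0, by rw [map_zero, eq_zero_of_mem_degLT_zero hd]⟩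
  | succ d ih =>
    -- In exterior degree 0 the homotopy acts by d, which is useless on constant polynomials. There
    -- injectivity of the augmentation takes over.
    rcases Nat.eq_zero_or_pos d with rfl | hpos
    · have h1 : ∃ x, z = 1 ⊗ₜ x := by
        have h2 : degLT L κ 0 1 ≤ LinearMap.range (TensorProduct.mk ℂ (MvPolynomial κ ℂ) (L 0) 1) := by
          refine Submodule.span_le.2 ?_
          rintro _ ⟨m, p, x, hm, hp, rfl⟩
          obtain rfl : m = 0 := by omega
          rw [← totalDegree_zero_iff_isHomogeneous, totalDegree_eq_zero_iff_eq_C] at hp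
          refine ⟨p.coeff 0 • x, ?_⟩
          rw [TensorProduct.mk_apply, ← TensorProduct.smul_tmul, ← C_eq_smul_one]
          rw [← hp]
        obtain ⟨x, hx⟩ := h2 hd
        exact ⟨x, hx.symm⟩
      obtain ⟨x, rfl⟩ := h1
      refine ⟨0, ?_⟩
      rw [hinj x hz, map_zero, TensorProduct.tmul_zero]
    · have h := K.homotopy_zero_of_mem hd
      obtain ⟨y, hy⟩ := ih _ (by rw [map_sub, hD, map_smul, hz, smul_zero, sub_zero]) h
      have hne : (d : ℂ) ≠ 0 := Nat.cast_ne_zero.2 (by omega)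
      refine ⟨(d : ℂ)⁻¹ • (K.s 0 z - y), ?_⟩
      rw [map_smul, map_sub, hy, sub_sub_cancel, inv_smul_smul₀ hne]

end

end KoszulData

end GradedHecke

namespace GradedHecke

/-! ### Contractions in the exterior algebra -/

noncomputable section

namespace Ext

open ExteriorAlgebra

variable {V : Type*} [AddCommGroup V] [Module ℂ V]

/-- Contraction of an element of the exterior algebra with a linear functional. -/
abbrev contract (ξ : Module.Dual ℂ V) : ExteriorAlgebra ℂ V →ₗ[ℂ] ExteriorAlgebra ℂ V :=
  CliffordAlgebra.contractLeft (Q := (0 : QuadraticForm ℂ V)) ξ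

lemma contract_ι_mul (ξ : Module.Dual ℂ V) (v : V) (x : ExteriorAlgebra ℂ V) :
    contract ξ (ι ℂ v * x) = ξ v • x - ι ℂ v * contract ξ x :=
  CliffordAlgebra.contractLeft_ι_mul ξ v x

lemma contract_algebraMap (ξ : Module.Dual ℂ V) (c : ℂ) :
    contract ξ (algebraMap ℂ (ExteriorAlgebra ℂ V) c) = 0 :=
  CliffordAlgebra.contractLeft_algebraMap _ ξ c

lemma left_induction {p : ExteriorAlgebra ℂ V → Prop} (algebraMap : ∀ c, p (algebraMap ℂ _ c))
    (add : ∀ x y, p x → p y → p (x + y)) (ι_mul : ∀ x v, p x → p (ι ℂ v * x))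
    (x : ExteriorAlgebra ℂ V) : p x :=
  CliffordAlgebra.left_induction 0 algebraMap add ι_mul x

lemma contract_map (ξ : Module.Dual ℂ V) (g : V →ₗ[ℂ] V) (x : ExteriorAlgebra ℂ V) :
    contract ξ (map g x) = map g (contract (ξ ∘ₗ g) x) := by
  induction x using left_induction with
  | algebraMap c => rw [AlgHom.commutes, contract_algebraMap, contract_algebraMap, map_zero]
  | add x y hx hy => simp only [map_add, hx, hy]
  | ι_mul x v hx =>
    rw [map_mul, map_apply_ι, contract_ι_mul, contract_ι_mul, hx, map_sub, map_mul, map_apply_ι,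
      map_smul, LinearMap.comp_apply]

/-- For x = v ∧ y the terms beyond first order in α vanish because α ∧ α = 0. -/
lemma map_transvection (ξ : Module.Dual ℂ V) (α : V) (g : V →ₗ[ℂ] V)
    (hg : ∀ v, g v = v - ξ v • α) (x : ExteriorAlgebra ℂ V) :
    map g x = x - ι ℂ α * contract ξ x := by
  induction x using left_induction with
  | algebraMap c => rw [AlgHom.commutes, contract_algebraMap, mul_zero, sub_zero]
  | add x y hx hy => simp only [map_add, hx, hy, mul_add]; abel
  | ι_mul x v hx =>
    have h1 : ι ℂ v * ι ℂ α = - (ι ℂ α * ι ℂ v) := by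
      rw [eq_neg_iff_add_eq_zero]; exact ι_add_mul_swap v α
    rw [map_mul, map_apply_ι, hx, contract_ι_mul, hg, map_sub, map_smul, sub_mul, mul_sub, mul_sub,
      mul_sub, ← mul_assoc, h1, smul_mul_assoc, smul_mul_assoc, ← mul_assoc (ι ℂ α) (ι ℂ α),
      ι_sq_zero, zero_mul, smul_zero, sub_zero, mul_smul_comm, ← mul_assoc]
    simp only [neg_mul]
    abel

/-- Since contraction with ξ squares to zero, the correction term disappears. Applied to a
reflection and its coroot, this is what kills the shift in the Koszul differential. -/
lemma map_contract_of_transvection (ξ : Module.Dual ℂ V) (α : V) (g : V →ₗ[ℂ] V)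
    (hg : ∀ v, g v = v - ξ v • α) (x : ExteriorAlgebra ℂ V) :
    map g (contract ξ x) = contract ξ x := by
  rw [map_transvection ξ α g hg, CliffordAlgebra.contractLeft_contractLeft, mul_zero, sub_zero]

lemma exteriorPower_induction {n : ℕ} {p : ExteriorAlgebra ℂ V → Prop}
    (add : ∀ x y, p x → p y → p (x + y)) (ι_mul : ∀ v, ∀ x ∈ ⋀[ℂ]^n V, p (ι ℂ v * x))
    {x : ExteriorAlgebra ℂ V} (hx : x ∈ ⋀[ℂ]^(n + 1) V) : p x := by
  rw [exteriorPower, pow_succ'] at hx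
  refine Submodule.mul_induction_on hx ?_ add
  rintro _ ⟨v, rfl⟩ y hy
  exact ι_mul v y hy

lemma ι_mul_mem {n : ℕ} (v : V) {x : ExteriorAlgebra ℂ V} (hx : x ∈ ⋀[ℂ]^n V) :
    ι ℂ v * x ∈ ⋀[ℂ]^(n + 1) V := by
  rw [exteriorPower, pow_succ']
  exact Submodule.mul_mem_mul ⟨v, rfl⟩ hx

lemma contract_of_mem_zero (ξ : Module.Dual ℂ V) {x : ExteriorAlgebra ℂ V}
    (hx : x ∈ ⋀[ℂ]^0 V) : contract ξ x = 0 := by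
  rw [exteriorPower, pow_zero, Submodule.mem_one] at hx
  obtain ⟨c, rfl⟩ := hx
  exact contract_algebraMap ξ c

lemma contract_mem (ξ : Module.Dual ℂ V) {n : ℕ} {x : ExteriorAlgebra ℂ V} (hx : x ∈ ⋀[ℂ]^n V) :
    contract ξ x ∈ ⋀[ℂ]^(n - 1) V := by
  induction n generalizing x with
  | zero => rw [contract_of_mem_zero ξ hx]; exact zero_mem _
  | succ n ih =>
    refine exteriorPower_induction (p := fun x => contract ξ x ∈ ⋀[ℂ]^n V) (fun x y hx hy => ?_)
      (fun v x hx => ?_) hx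
    · rw [map_add]; exact add_mem hx hy
    · rw [contract_ι_mul]
      refine sub_mem (Submodule.smul_mem _ _ hx) ?_
      rcases n with _ | n
      · rw [contract_of_mem_zero ξ hx, mul_zero]; exact zero_mem _
      · exact ι_mul_mem v (ih hx)

variable {κ : Type*} [Fintype κ] (b : Module.Basis κ ℂ V)

lemma sum_coord_smul_ι (v : V) : ∑ j, b.coord j v • ι ℂ (b j) = ι ℂ v := by
  simp only [← map_smul, ← map_sum]
  congr 1
  exact b.sum_repr v

/-- Euler's identity for exterior powers: peeling off one vector contributes one, and the two sign
changes in moving past it cancel. -/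
lemma sum_ι_mul_contract {n : ℕ} {x : ExteriorAlgebra ℂ V} (hx : x ∈ ⋀[ℂ]^n V) :
    ∑ j, ι ℂ (b j) * contract (b.coord j) x = (n : ℂ) • x := by
  induction n generalizing x with
  | zero => simp [contract_of_mem_zero _ hx]
  | succ n ih =>
    refine exteriorPower_induction (p := fun x => ∑ j, ι ℂ (b j) * contract (b.coord j) x =
      ((n + 1 : ℕ) : ℂ) • x) (fun x y hx hy => ?_) (fun v x hx => ?_) hx
    · simp only [map_add, mul_add, Finset.sum_add_distrib, hx, hy, smul_add]
    · have h1 : ∀ j, ι ℂ (b j) * contract (b.coord j) (ι ℂ v * x) =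
          (b.coord j v • ι ℂ (b j)) * x + ι ℂ v * (ι ℂ (b j) * contract (b.coord j) x) := by
        intro j
        have h2 : ι ℂ (b j) * ι ℂ v = - (ι ℂ v * ι ℂ (b j)) := by
          rw [eq_neg_iff_add_eq_zero]; exact ι_add_mul_swap _ _
        rw [contract_ι_mul, mul_sub, ← mul_assoc, h2, mul_smul_comm, smul_mul_assoc, neg_mul,
          sub_neg_eq_add, mul_assoc]
      simp only [h1]
      rw [Finset.sum_add_distrib, ← Finset.sum_mul, sum_coord_smul_ι, ← Finset.mul_sum, ih hx,
        mul_smul_comm, Nat.cast_succ, add_smul, one_smul, add_comm]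

/-- Contraction on the exterior powers. In degree zero it is zero. -/
def contr (ξ : Module.Dual ℂ V) (n : ℕ) : ⋀[ℂ]^n V →ₗ[ℂ] ⋀[ℂ]^(n - 1) V :=
  (contract ξ).restrict fun _ hx => contract_mem ξ hx

/-- Exterior multiplication with a vector on the exterior powers. -/
def wedge (v : V) (n : ℕ) : ⋀[ℂ]^n V →ₗ[ℂ] ⋀[ℂ]^(n + 1) V :=
  (LinearMap.mulLeft ℂ (ι ℂ v)).restrict fun _ hx => ι_mul_mem v hx

/-- Contraction on the exterior powers of positive degree. -/
def contrSucc (ξ : Module.Dual ℂ V) (n : ℕ) : ⋀[ℂ]^(n + 1) V →ₗ[ℂ] ⋀[ℂ]^n V := contr ξ (n + 1)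

lemma coe_contr (ξ : Module.Dual ℂ V) (n : ℕ) (x : ⋀[ℂ]^n V) :
    (contr ξ n x : ExteriorAlgebra ℂ V) = contract ξ x := rfl

lemma coe_map (g : V →ₗ[ℂ] V) (n : ℕ) (x : ⋀[ℂ]^n V) :
    (exteriorPower.map n g x : ExteriorAlgebra ℂ V) = map g x := by
  have : (⋀[ℂ]^n V).subtype ∘ₗ exteriorPower.map n g = (map g).toLinearMap ∘ₗ (⋀[ℂ]^n V).subtype := by
    apply exteriorPower.linearMap_ext
    ext v
    simp [map_apply_ιMulti]
  exact LinearMap.congr_fun this x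

lemma contr_zero (ξ : Module.Dual ℂ V) : contr ξ 0 = 0 :=
  LinearMap.ext fun x => Subtype.ext (contract_of_mem_zero ξ x.2)

lemma contr_exteriorPower_map (ξ : Module.Dual ℂ V) (g : V →ₗ[ℂ] V) (n : ℕ) (x : ⋀[ℂ]^n V) :
    contr ξ n (exteriorPower.map n g x) = exteriorPower.map (n - 1) g (contr (ξ ∘ₗ g) n x) :=
  Subtype.ext (by rw [coe_contr, coe_map, coe_map, contract_map, coe_contr])

lemma exteriorPower_map_contr_of_transvection (ξ : Module.Dual ℂ V) (α : V) (g : V →ₗ[ℂ] V)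
    (hg : ∀ v, g v = v - ξ v • α) (n : ℕ) (x : ⋀[ℂ]^n V) :
    exteriorPower.map (n - 1) g (contr ξ n x) = contr ξ n x :=
  Subtype.ext (by rw [coe_map, coe_contr, map_contract_of_transvection ξ α g hg])

lemma contr_contr (ξ ξ' : Module.Dual ℂ V) (n : ℕ) (x : ⋀[ℂ]^n V) :
    contr ξ (n - 1) (contr ξ' n x) = -contr ξ' (n - 1) (contr ξ n x) :=
  Subtype.ext (CliffordAlgebra.contractLeft_comm _ _ _)

lemma contr_wedge (ξ : Module.Dual ℂ V) (v : V) (n : ℕ) (x : ⋀[ℂ]^(n + 1) V) :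
    contrSucc ξ (n + 1) (wedge v (n + 1) x) + wedge v n (contrSucc ξ n x) = ξ v • x :=
  Subtype.ext (by
    change contract ξ (ι ℂ v * (x : ExteriorAlgebra ℂ V)) + ι ℂ v * contract ξ x =
      ξ v • (x : ExteriorAlgebra ℂ V)
    rw [contract_ι_mul, sub_add_cancel])

lemma contr_wedge_zero (ξ : Module.Dual ℂ V) (v : V) (x : ⋀[ℂ]^0 V) :
    contrSucc ξ 0 (wedge v 0 x) = ξ v • x :=
  Subtype.ext (by
    change contract ξ (ι ℂ v * (x : ExteriorAlgebra ℂ V)) = ξ v • (x : ExteriorAlgebra ℂ V)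
    rw [contract_ι_mul, contract_of_mem_zero ξ x.2, mul_zero, sub_zero])

lemma sum_wedge_contr (n : ℕ) (x : ⋀[ℂ]^(n + 1) V) :
    ∑ j, wedge (b j) n (contrSucc (b.coord j) n x) = ((n + 1 : ℕ) : ℂ) • x :=
  Subtype.ext (by
    rw [AddSubmonoidClass.coe_finsetSum]
    exact sum_ι_mul_contract b x.2)

end Ext

/-! ### Koszul data on exterior powers with coefficients -/

section

variable {V : Type u} [AddCommGroup V] [Module ℂ V] {κ : Type} [Fintype κ] [DecidableEq κ]
  (b : Module.Basis κ ℂ V) {X : Type u} [AddCommGroup X] [Module ℂ X]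

/-- The Koszul data of the exterior powers of a vector space, with coefficients in a space on
which commuting operators act. -/
def koszulData (e : κ → X →ₗ[ℂ] X) (he : ∀ j l x, e j (e l x) = e l (e j x)) :
    KoszulData κ fun n => X ⊗[ℂ] ⋀[ℂ]^n V where
  c n j := (Ext.contrSucc (b.coord j) n).lTensor X
  w n j := (Ext.wedge (b j) n).lTensor X
  e n j := (e j).rTensor _
  c_w_zero j l x := by
    induction x with
    | zero => simp
    | add x y hx hy =>
      rw [map_add, map_add, hx, hy]
      split_ifs <;> simp
    | tmul x y =>
      rw [LinearMap.lTensor_tmul, LinearMap.lTensor_tmul, Ext.contr_wedge_zero]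
      by_cases h : j = l
      · simp [h]
      · simp [h, Finsupp.single_eq_of_ne h]
  c_w n j l x := by
    induction x with
    | zero => simp
    | add x y hx hy =>
      simp only [map_add]
      rw [add_add_add_comm, hx, hy]
      split_ifs <;> simp
    | tmul x y =>
      simp only [LinearMap.lTensor_tmul]
      rw [← TensorProduct.tmul_add, Ext.contr_wedge]
      by_cases h : j = l
      · simp [h]
      · simp [h, Finsupp.single_eq_of_ne h]
  sum_w_c n x := by
    induction x with
    | zero => simp
    | add x y hx hy =>
      simp only [map_add]
      rw [Finset.sum_add_distrib, hx, hy, smul_add]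
    | tmul x y =>
      simp only [LinearMap.lTensor_tmul]
      rw [← TensorProduct.tmul_sum, Ext.sum_wedge_contr, TensorProduct.tmul_smul]
  c_c n j l x := by
    induction x with
    | zero => simp
    | add x y hx hy => simp only [map_add, hx, hy, neg_add]
    | tmul x y =>
      simp only [LinearMap.lTensor_tmul]
      rw [← TensorProduct.tmul_neg]
      congr 1
      exact Ext.contr_contr _ _ (n + 2) y
  e_c n j l x := by
    induction x with
    | zero => simp
    | add x y hx hy => simp only [map_add, hx, hy]
    | tmul x y => simp only [LinearMap.lTensor_tmul, LinearMap.rTensor_tmul]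
  e_e n j l x := by
    induction x with
    | zero => simp
    | add x y hx hy => simp only [map_add, hx, hy]
    | tmul x y => simp only [LinearMap.rTensor_tmul, he]

end

end

end GradedHecke

namespace GradedHecke

variable {ι V₀ N : Type u} [AddCommGroup V₀] [Module ℝ V₀] [AddCommGroup N] [Module ℝ N]
  {P : RootPairing ι ℝ V₀ N} {Δ : SimpleRoots P}

/-! ### Modules induced from representations of the reflection group -/

noncomputable section

variable (k : Parameter Δ) {E : Type u} [AddCommGroup E] [Module ℂ E]
  (ρ : Representation ℂ P.weylGroup E)

/-- The relations that define `ℍ ⊗_{ℂ[W]} E` as a quotient of `ℍ ⊗_ℂ E`. -/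
def indRel : Submodule (Hecke k) (Hecke k ⊗[ℂ] E) :=
  Submodule.span (Hecke k)
    (Set.range fun q : P.weylGroup × E => Hecke.t k q.1 ⊗ₜ[ℂ] q.2 - 1 ⊗ₜ[ℂ] ρ q.1 q.2)

/-- The induced module `ℍ ⊗_{ℂ[W]} E`. -/
def Ind : Type u := (Hecke k ⊗[ℂ] E) ⧸ indRel k ρ

instance : AddCommGroup (Ind k ρ) := inferInstanceAs (AddCommGroup (_ ⧸ indRel k ρ))
instance : Module (Hecke k) (Ind k ρ) := inferInstanceAs (Module (Hecke k) (_ ⧸ indRel k ρ))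
instance : Module ℂ (Ind k ρ) := inferInstanceAs (Module ℂ (_ ⧸ indRel k ρ))
instance : IsScalarTower ℂ (Hecke k) (Ind k ρ) :=
  inferInstanceAs (IsScalarTower ℂ (Hecke k) (_ ⧸ indRel k ρ))

namespace Ind

/-- The quotient map. -/
def mkQ : Hecke k ⊗[ℂ] E →ₗ[Hecke k] Ind k ρ := (indRel k ρ).mkQ

lemma mkQ_eq_zero_iff (z : Hecke k ⊗[ℂ] E) : mkQ k ρ z = 0 ↔ z ∈ indRel k ρ :=
  Submodule.Quotient.mk_eq_zero _

lemma mkQ_surjective : Function.Surjective (mkQ k ρ) := Submodule.mkQ_surjective _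

/-- The canonical map `E → ℍ ⊗_{ℂ[W]} E`. -/
def mk : E →ₗ[ℂ] Ind k ρ := (mkQ k ρ).restrictScalars ℂ ∘ₗ TensorProduct.mk ℂ (Hecke k) E 1

lemma mk_apply (e : E) : mk k ρ e = mkQ k ρ (1 ⊗ₜ e) := rfl

lemma smul_mk (h : Hecke k) (e : E) : h • mk k ρ e = mkQ k ρ (h ⊗ₜ e) := by
  rw [mk_apply, ← map_smul, TensorProduct.smul_tmul', smul_eq_mul, mul_one]

lemma mk_rho (w : P.weylGroup) (e : E) : mk k ρ (ρ w e) = Hecke.t k w • mk k ρ e := by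
  rw [smul_mk, mk_apply, eq_comm, ← sub_eq_zero, ← map_sub, mkQ_eq_zero_iff]
  exact Submodule.subset_span ⟨(w, e), rfl⟩

variable {k ρ}

lemma induction {p : Ind k ρ → Prop} (add : ∀ x y, p x → p y → p (x + y))
    (smul_mk : ∀ (h : Hecke k) e, p (h • mk k ρ e)) (x : Ind k ρ) : p x := by
  obtain ⟨z, rfl⟩ := mkQ_surjective k ρ x
  induction z with
  | zero => have := smul_mk 0 0; rwa [zero_smul] at this
  | add x y hx hy => rw [map_add]; exact add _ _ hx hy
  | tmul h e => rw [← Ind.smul_mk]; exact smul_mk h e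

variable {Z : Type*} [AddCommGroup Z] [Module (Hecke k) Z]

lemma hom_ext {g g' : Ind k ρ →ₗ[Hecke k] Z} (h : ∀ e, g (mk k ρ e) = g' (mk k ρ e)) : g = g' := by
  refine LinearMap.ext fun x => ?_
  induction x using induction with
  | add x y hx hy => rw [map_add, map_add, hx, hy]
  | smul_mk a e => rw [map_smul, map_smul, h]

variable [Module ℂ Z] [IsScalarTower ℂ (Hecke k) Z]

/-- The universal property of the induced module. -/
def lift (g : E →ₗ[ℂ] Z) (hg : ∀ w e, g (ρ w e) = Hecke.t k w • g e) : Ind k ρ →ₗ[Hecke k] Z :=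
  Submodule.liftQ _ (TensorProduct.AlgebraTensorModule.lift
    (LinearMap.toSpanSingleton (Hecke k) (E →ₗ[ℂ] Z) g)) (by
      refine Submodule.span_le.2 ?_
      rintro _ ⟨⟨w, e⟩, rfl⟩
      simp [hg])

lemma lift_mk (g : E →ₗ[ℂ] Z) (hg : ∀ w e, g (ρ w e) = Hecke.t k w • g e) (e : E) :
    lift g hg (mk k ρ e) = g e := by
  change TensorProduct.AlgebraTensorModule.lift
    (LinearMap.toSpanSingleton (Hecke k) (E →ₗ[ℂ] Z) g) (1 ⊗ₜ e) = g e
  simp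

end Ind

/-! ### Averaging over the reflection group and projectivity -/

section Average

variable {Z : Type*} [AddCommGroup Z] [Module (Hecke k) Z] [Module ℂ Z]
  [IsScalarTower ℂ (Hecke k) Z] [Fintype P.weylGroup]

/-- The sum over the reflection group of the conjugates of a linear map. -/
def average (g : E →ₗ[ℂ] Z) : E →ₗ[ℂ] Z := ∑ w : P.weylGroup, Hecke.t k w • (g ∘ₗ ρ w⁻¹)

lemma average_apply (g : E →ₗ[ℂ] Z) (e : E) :
    average k ρ g e = ∑ w : P.weylGroup, Hecke.t k w • g (ρ w⁻¹ e) := by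
  simp [average]

lemma average_rho (g : E →ₗ[ℂ] Z) (u : P.weylGroup) (e : E) :
    average k ρ g (ρ u e) = Hecke.t k u • average k ρ g e := by
  rw [average_apply, average_apply, Finset.smul_sum, ← Equiv.sum_comp (Equiv.mulLeft u)]
  refine Finset.sum_congr rfl fun w _ => ?_
  rw [Equiv.coe_mulLeft, map_mul, mul_smul, mul_inv_rev, map_mul, Module.End.mul_apply,
    ← Module.End.mul_apply (ρ u⁻¹), ← map_mul, inv_mul_cancel, map_one, Module.End.one_apply]

lemma average_of_equivariant (g : E →ₗ[ℂ] Z) (hg : ∀ w e, g (ρ w e) = Hecke.t k w • g e) :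
    average k ρ g = (Fintype.card P.weylGroup : ℂ) • g := by
  refine LinearMap.ext fun e => ?_
  rw [average_apply, LinearMap.smul_apply, Nat.cast_smul_eq_nsmul, ← Finset.card_univ]
  refine Finset.sum_eq_card_nsmul fun w _ => ?_
  rw [← hg, ← Module.End.mul_apply, ← map_mul, mul_inv_cancel, map_one, Module.End.one_apply]

end Average

/-- Maschke's argument: a ℂ-linear section of the surjection, restricted to E and averaged over W,
is equivariant and so extends to an ℍ-linear section. E may be infinite-dimensional. -/
instance [Finite ι] : Module.Projective (Hecke k) (Ind k ρ) := by
  refine Module.Projective.of_lifting_property'' fun f hf => ?_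
  have := Fintype.ofFinite P.weylGroup
  obtain ⟨r, hr⟩ := (f.restrictScalars ℂ).exists_rightInverse_of_surjective
    (LinearMap.range_eq_top.2 hf)
  have hr' : ∀ x, f (r x) = x := fun x => LinearMap.congr_fun hr x
  refine ⟨Ind.lift ((Fintype.card P.weylGroup : ℂ)⁻¹ • average k ρ (r ∘ₗ Ind.mk k ρ))
    (fun w e => by rw [LinearMap.smul_apply, LinearMap.smul_apply, average_rho, smul_comm]),
    Ind.hom_ext fun e => ?_⟩
  have hne : (Fintype.card P.weylGroup : ℂ) ≠ 0 := Nat.cast_ne_zero.2 Fintype.card_ne_zero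
  have h : f (average k ρ (r ∘ₗ Ind.mk k ρ) e) = (Fintype.card P.weylGroup : ℂ) • Ind.mk k ρ e := by
    rw [average_apply, map_sum, Nat.cast_smul_eq_nsmul, ← Finset.card_univ]
    refine Finset.sum_eq_card_nsmul fun w _ => ?_
    rw [map_smul, LinearMap.comp_apply, hr', ← Ind.mk_rho, ← Module.End.mul_apply, ← map_mul,
      mul_inv_cancel, map_one, Module.End.one_apply]
  rw [LinearMap.comp_apply, Ind.lift_mk, LinearMap.smul_apply, LinearMap.map_smul_of_tower, h,
    inv_smul_smul₀ hne, LinearMap.id_apply]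

/-! ### Induced modules as S(V) ⊗ E -/

section PBW

variable [Finite ι] [P.IsReduced] {κ : Type} [Fintype κ] (b : Module.Basis κ ℂ (ℂ ⊗[ℝ] V₀))

/-- The map `S(V) ⊗ E → ℍ ⊗_{ℂ[W]} E`. -/
def Ind.ofPoly : MvPolynomial κ ℂ ⊗[ℂ] E →ₗ[ℂ] Ind k ρ :=
  (Ind.mkQ k ρ).restrictScalars ℂ ∘ₗ (Hecke.ofPoly k b).toLinearMap.rTensor E

omit [Finite ι] [P.IsReduced] [Fintype κ] in
lemma Ind.ofPoly_tmul (p : MvPolynomial κ ℂ) (e : E) :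
    Ind.ofPoly k ρ b (p ⊗ₜ e) = Hecke.ofPoly k b p • Ind.mk k ρ e := by
  rw [Ind.smul_mk]; rfl

lemma Ind.ofPoly_surjective : Function.Surjective (Ind.ofPoly k ρ b) := by
  intro x
  rw [← LinearMap.mem_range]
  induction x using Ind.induction with
  | add x y hx hy => exact add_mem hx hy
  | smul_mk h e =>
    have hh := Hecke.mem_span_ofPoly_mul_t k b h
    induction hh using Submodule.span_induction with
    | mem h hh =>
      obtain ⟨⟨p, w⟩, rfl⟩ := hh
      refine ⟨p ⊗ₜ ρ w e, ?_⟩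
      rw [Ind.ofPoly_tmul, Ind.mk_rho, ← mul_smul]
    | zero => rw [zero_smul]; exact zero_mem _
    | add x y _ _ hx hy => rw [add_smul]; exact add_mem hx hy
    | smul c x _ hx => rw [smul_assoc]; exact Submodule.smul_mem _ c hx

/-- The coordinates of an element of `ℍ ⊗ E` modulo the relations. -/
def indCoord [Fintype ι] [Fintype P.weylGroup] : Hecke k ⊗[ℂ] E →ₗ[ℂ] MvPolynomial κ ℂ ⊗[ℂ] E :=
  -- The coordinate at u belongs to t_{u⁻¹}, and moving t_{u⁻¹} across the tensor product makes it
  -- act on E.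
  ∑ u : P.weylGroup, TensorProduct.map (LinearMap.proj u ∘ₗ PBW.coord b k) (ρ u⁻¹)

omit [Finite ι] in
lemma indCoord_tmul [Fintype ι] [Fintype P.weylGroup] (h : Hecke k) (e : E) :
    indCoord k ρ b (h ⊗ₜ e) = ∑ u : P.weylGroup, PBW.coord b k h u ⊗ₜ ρ u⁻¹ e := by
  simp [indCoord]

omit [Finite ι] in
lemma indCoord_mul_t_tmul [Fintype ι] [Fintype P.weylGroup] (h : Hecke k) (w : P.weylGroup)
    (e : E) : indCoord k ρ b ((h * Hecke.t k w) ⊗ₜ e) = indCoord k ρ b (h ⊗ₜ ρ w e) := by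
  rw [indCoord_tmul, indCoord_tmul, ← Equiv.sum_comp (Equiv.mulLeft w⁻¹)]
  refine Finset.sum_congr rfl fun u _ => ?_
  rw [Equiv.coe_mulLeft, PBW.coord_mul_t, mul_inv_cancel_left, mul_inv_rev, inv_inv, map_mul]
  rfl

omit [Finite ι] in
lemma indCoord_eq_zero [Fintype ι] [Fintype P.weylGroup] {z : Hecke k ⊗[ℂ] E}
    (hz : z ∈ indRel k ρ) : indCoord k ρ b z = 0 := by
  -- The coordinate map is not ℍ-linear, so the induction over the submodule must carry all left
  -- multiples.
  suffices h : ∀ a : Hecke k, indCoord k ρ b (a • z) = 0 by simpa using h 1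
  induction hz using Submodule.span_induction with
  | mem z h =>
    obtain ⟨⟨w, e⟩, rfl⟩ := h
    intro a
    rw [smul_sub, TensorProduct.smul_tmul', TensorProduct.smul_tmul', smul_eq_mul, smul_eq_mul,
      mul_one, map_sub, indCoord_mul_t_tmul, sub_self]
  | zero => simp
  | add x y _ _ hx hy => intro a; rw [smul_add, map_add, hx, hy, add_zero]
  | smul c x _ hx => intro a; rw [← mul_smul, hx]

/-- `indCoord` vanishes on the relations and is a left inverse of S(V) ⊗ E → ℍ ⊗ E, because a
polynomial has its only coordinate at the identity. -/
lemma Ind.ofPoly_injective : Function.Injective (Ind.ofPoly k ρ b) := by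
  classical
  have := Fintype.ofFinite ι
  have := Fintype.ofFinite P.weylGroup
  rw [injective_iff_map_eq_zero]
  intro z hz
  have h1 : (Hecke.ofPoly k b).toLinearMap.rTensor E z ∈ indRel k ρ :=
    (Ind.mkQ_eq_zero_iff k ρ _).1 hz
  have h2 := indCoord_eq_zero k ρ b h1
  have h3 : indCoord k ρ b ∘ₗ (Hecke.ofPoly k b).toLinearMap.rTensor E = LinearMap.id := by
    refine TensorProduct.ext' fun p e => ?_
    rw [LinearMap.comp_apply, LinearMap.rTensor_tmul, indCoord_tmul, AlgHom.toLinearMap_apply,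
      PBW.coord_ofPoly, Finset.sum_eq_single 1]
    · simp
    · intro u _ hu; rw [Pi.single_eq_of_ne hu, TensorProduct.zero_tmul]
    · simp
  rw [← LinearMap.comp_apply, h3] at h2
  exact h2

end PBW

end

end GradedHecke

namespace GradedHecke

variable {ι V₀ N : Type u} [AddCommGroup V₀] [Module ℝ V₀] [AddCommGroup N] [Module ℝ N]
  {P : RootPairing ι ℝ V₀ N} {Δ : SimpleRoots P}

noncomputable section

/-! ### The equivariant generators -/

namespace Hecke

variable (k : Parameter Δ) [Fintype ι]

open Classical in
/-- The element `½ ∑_{α > 0} k_α ⟨v, α^∨⟩ t_{s_α}`. -/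
def shift : ℂ ⊗[ℝ] V₀ →ₗ[ℂ] Hecke k :=
  ∑ i, if Δ.IsPos i then
    ((2 : ℂ)⁻¹ * k.ext i) • (corootC P i).smulRight (t k (SimpleRoots.refl P i)) else 0

open Classical in
lemma shift_apply (v : ℂ ⊗[ℝ] V₀) : shift k v = ∑ i, if Δ.IsPos i then
    ((2 : ℂ)⁻¹ * k.ext i * corootC P i v) • t k (SimpleRoots.refl P i) else 0 := by
  simp only [shift, LinearMap.sum_apply]
  refine Finset.sum_congr rfl fun i _ => ?_
  split_ifs
  · simp [mul_smul]
  · simp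

/-- The element `v - ½ ∑_{α > 0} k_α ⟨v, α^∨⟩ t_{s_α}`. -/
def tilde : ℂ ⊗[ℝ] V₀ →ₗ[ℂ] Hecke k := f k - shift k

lemma tilde_apply (v : ℂ ⊗[ℝ] V₀) : tilde k v = f k v - shift k v := rfl

omit [Fintype ι] in
lemma t_mul_t_refl (w : P.weylGroup) (i : ι) :
    t k w * t k (SimpleRoots.refl P i) = t k (SimpleRoots.refl P (w • i)) * t k w := by
  rw [SimpleRoots.refl_conj, ← map_mul, ← map_mul, inv_mul_cancel_right]

open Classical in
-- Only the roots ±α_j contribute, with ½k and −(−½k). The defect is thus the one in the defining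
-- relation for v, so it cancels in ṽ.
lemma t_refl_mul_shift [P.IsReduced] (j : Δ.support) (v : ℂ ⊗[ℝ] V₀) :
    t k (SimpleRoots.refl P j) * shift k v -
      shift k (act P (SimpleRoots.refl P j) v) * t k (SimpleRoots.refl P j) =
    algebraMap ℂ _ (k.val j * corootC P j v) := by
  set s := SimpleRoots.refl P (j : ι) with hs
  set G : ι → Hecke k := fun i => ((2 : ℂ)⁻¹ * k.ext i * corootC P i v) •
    (t k (SimpleRoots.refl P (s • i)) * t k s) with hG
  have e1 : t k s * shift k v = ∑ i, if Δ.IsPos i then G i else 0 := by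
    rw [shift_apply, Finset.mul_sum]
    refine Finset.sum_congr rfl fun i _ => ?_
    split_ifs
    · rw [mul_smul_comm, t_mul_t_refl]
    · rw [mul_zero]
  have e2 : shift k (act P s v) * t k s = ∑ i, if Δ.IsPos (s • i) then G i else 0 := by
    rw [shift_apply, Finset.sum_mul, ← Equiv.sum_comp (MulAction.toPerm s)]
    refine Finset.sum_congr rfl fun i _ => ?_
    rw [MulAction.toPerm_apply, k.ext_smul, corootC_smul]
    split_ifs
    · rw [smul_mul_assoc]
    · rw [zero_mul]
  rw [e1, e2, hs, Δ.sum_isPos_sub_sum_isPos_refl j G, ← hs]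
  have h3 : SimpleRoots.refl P (s • (j : ι)) = s := by
    simpa using SimpleRoots.refl_smul_refl_self (P := P) 1 (j : ι)
  have h4 : s • s • (j : ι) = j := SimpleRoots.refl_smul_refl_smul _ _
  simp only [hG]
  rw [h4, h3, k.ext_smul, ← hs, ← map_mul, hs, SimpleRoots.refl_mul_self, map_one,
    corootC_refl_smul_self, k.ext_simple, Algebra.algebraMap_eq_smul_one, ← sub_smul]
  congr 1
  ring

lemma t_mul_tilde [P.IsReduced] (w : P.weylGroup) (v : ℂ ⊗[ℝ] V₀) :
    t k w * tilde k v = tilde k (act P w v) * t k w := by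
  induction w using Δ.weylGroup_induction with
  | one => rw [map_one, one_mul, mul_one, act_one]
  | mul j w ih =>
    have h : ∀ v, t k (SimpleRoots.refl P j) * tilde k v =
        tilde k (act P (SimpleRoots.refl P j) v) * t k (SimpleRoots.refl P j) := by
      intro v
      rw [← sub_eq_zero, tilde_apply, tilde_apply, mul_sub, sub_mul, sub_sub_sub_comm, cross,
        t_refl_mul_shift, sub_self]
    rw [map_mul, mul_assoc, ih, ← mul_assoc, h, act_mul, mul_assoc]

open Classical in
-- Replacing a root by its negative changes the sign of the coroot but not the reflection or the
-- parameter, so the summand is odd. The longest element exchanges positive and negative roots.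
lemma t_longest_mul_shift [P.IsReduced] (v : ℂ ⊗[ℝ] V₀) :
    t k Δ.longest * shift k v = -(shift k (act P Δ.longest v) * t k Δ.longest) := by
  rw [shift_apply, shift_apply, Finset.mul_sum, Finset.sum_mul]
  set w := Δ.longest
  have hodd : ∀ i : ι, ((2 : ℂ)⁻¹ * k.ext (SimpleRoots.refl P i • i) *
      corootC P (SimpleRoots.refl P i • i) (act P w v)) •
        t k (SimpleRoots.refl P (SimpleRoots.refl P i • i)) =
      -(((2 : ℂ)⁻¹ * k.ext i * corootC P i (act P w v)) • t k (SimpleRoots.refl P i)) := by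
    intro i
    have h3 : SimpleRoots.refl P (SimpleRoots.refl P i • i) = SimpleRoots.refl P i := by
      simpa using SimpleRoots.refl_smul_refl_self (P := P) 1 (i : ι)
    rw [k.ext_smul, corootC_refl_smul_self, h3, mul_neg, neg_smul]
  -- The permutation of the indices that replaces each root by its negative.
  let σ : Equiv.Perm ι := (show Function.Involutive (fun i : ι => SimpleRoots.refl P i • i) from
    fun i => by
      have h3 : SimpleRoots.refl P (SimpleRoots.refl P i • i) = SimpleRoots.refl P i := by
        simpa using SimpleRoots.refl_smul_refl_self (P := P) 1 (i : ι)
      change SimpleRoots.refl P (SimpleRoots.refl P i • i) • SimpleRoots.refl P i • i = i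
      rw [h3, SimpleRoots.refl_smul_refl_smul]).toPerm
  have hσ : ∀ i, σ i = SimpleRoots.refl P i • i := fun i => rfl
  rw [← Equiv.sum_comp σ (fun i => (if Δ.IsPos i then ((2 : ℂ)⁻¹ * k.ext i *
    corootC P i (act P w v)) • t k (SimpleRoots.refl P i) else 0) * t k w),
    ← Equiv.sum_comp (MulAction.toPerm w) (fun i => (if Δ.IsPos (σ i) then _ else 0) * t k w),
    ← Finset.sum_neg_distrib]
  refine Finset.sum_congr rfl fun i _ => ?_
  have h1 : Δ.IsPos (σ (MulAction.toPerm w i)) ↔ Δ.IsPos i := by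
    rw [hσ, Δ.isPos_refl_smul_self_iff, MulAction.toPerm_apply, Δ.isPos_longest_smul_iff, not_not]
  simp only [h1]
  split_ifs
  · rw [hσ, hodd, MulAction.toPerm_apply, k.ext_smul, corootC_smul, neg_mul, neg_neg,
      smul_mul_assoc, mul_smul_comm, t_mul_t_refl]
  · simp

/-- The conjugate of `w₀(v)` by `t_{w₀}` is `v - ∑_{α > 0} k_α ⟨v, α^∨⟩ t_{s_α}`. -/
lemma t_longest_mul_f [P.IsReduced] (v : ℂ ⊗[ℝ] V₀) :
    t k Δ.longest * f k (act P Δ.longest⁻¹ v) * t k Δ.longest⁻¹ = tilde k v - shift k v := by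
  have h1 := t_mul_tilde k Δ.longest (act P Δ.longest⁻¹ v)
  have h2 := t_longest_mul_shift k (act P Δ.longest⁻¹ v)
  rw [← act_mul, mul_inv_cancel, act_one] at h1 h2
  have h3 : f k (act P Δ.longest⁻¹ v) = tilde k (act P Δ.longest⁻¹ v) +
    shift k (act P Δ.longest⁻¹ v) := by rw [tilde_apply, sub_add_cancel]
  rw [h3, mul_add, h1, h2, add_mul, mul_assoc, neg_mul, mul_assoc, ← map_mul, mul_inv_cancel,
    map_one, mul_one, mul_one, sub_eq_add_neg]

end Hecke

/-! ### The Koszul differential on equivariant maps -/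

namespace Ext

variable {V : Type*} [AddCommGroup V] [Module ℂ V]

lemma contr_add (ξ ξ' : Module.Dual ℂ V) (n : ℕ) (x : ⋀[ℂ]^n V) :
    contr (ξ + ξ') n x = contr ξ n x + contr ξ' n x :=
  Subtype.ext (by
    change contract (ξ + ξ') (x : ExteriorAlgebra ℂ V) = contract ξ x + contract ξ' x
    rw [contract, map_add, LinearMap.add_apply])

lemma contr_smul (c : ℂ) (ξ : Module.Dual ℂ V) (n : ℕ) (x : ⋀[ℂ]^n V) :
    contr (c • ξ) n x = c • contr ξ n x :=
  Subtype.ext (by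
    change contract (c • ξ) (x : ExteriorAlgebra ℂ V) = c • contract ξ x
    rw [contract, map_smul, LinearMap.smul_apply])

variable {κ : Type*} [Fintype κ] (b : Module.Basis κ ℂ V)
  {M : Type*} [AddCommGroup M] [Module ℂ M]

lemma sum_smul_coord (ξ : Module.Dual ℂ V) : ∑ l, ξ (b l) • b.coord l = ξ := by
  classical
  refine b.ext fun j => ?_
  simp

lemma sum_apply_coord (Φ : Module.Dual ℂ V →ₗ[ℂ] M) (ξ : Module.Dual ℂ V) :
    ∑ l, ξ (b l) • Φ (b.coord l) = Φ ξ := by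
  conv_rhs => rw [← sum_smul_coord b ξ]
  rw [map_sum]
  simp only [map_smul]

/-- The canonical tensor ∑ b_j ⊗ b_j^* lets an endomorphism pass from one factor to its transpose on
the other. This gives the invariance of the Koszul differential under W. -/
lemma sum_basis_coord_comp (Φ : V →ₗ[ℂ] Module.Dual ℂ V →ₗ[ℂ] M) (g : V →ₗ[ℂ] V) :
    ∑ j, Φ (b j) (b.coord j ∘ₗ g) = ∑ j, Φ (g (b j)) (b.coord j) := by
  have h1 : ∀ j, Φ (b j) (b.coord j ∘ₗ g) =
      ∑ l, b.coord j (g (b l)) • Φ (b j) (b.coord l) := by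
    intro j
    conv_lhs => rw [← sum_smul_coord b (b.coord j ∘ₗ g)]
    rw [map_sum]
    simp only [map_smul, LinearMap.comp_apply]
  have h2 : ∀ l, Φ (g (b l)) (b.coord l) =
      ∑ j, b.coord j (g (b l)) • Φ (b j) (b.coord l) := by
    intro l
    conv_lhs => rw [← b.sum_repr (g (b l))]
    rw [map_sum, LinearMap.sum_apply]
    simp only [map_smul, LinearMap.smul_apply, Module.Basis.coord_apply]
  simp only [h1, h2]
  exact Finset.sum_comm

end Ext

/-! ### The differential, its equivariance, and the replacement of v by ṽ -/

section Delta

variable (k : Parameter Δ) {κ : Type} [Fintype κ] (b : Module.Basis κ ℂ (ℂ ⊗[ℝ] V₀))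
  (X : Type u) [AddCommGroup X] [Module ℂ X] [Module (Hecke k) X] [IsScalarTower ℂ (Hecke k) X]

/-- The restriction of an `ℍ`-module to the reflection group. -/
def weylRep : Representation ℂ P.weylGroup X :=
  (Algebra.lsmul ℂ ℂ X : Hecke k →ₐ[ℂ] Module.End ℂ X).toMonoidHom.comp (Hecke.t k)

variable (P) in
/-- The exterior powers of the reflection representation. -/
def exteriorRep (n : ℕ) : Representation ℂ P.weylGroup (⋀[ℂ]^n (ℂ ⊗[ℝ] V₀)) where
  toFun w := exteriorPower.map n (act P w)
  map_one' := by
    rw [show act P 1 = LinearMap.id from LinearMap.ext (act_one P), exteriorPower.map_id]; rfl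
  map_mul' w w' := by
    rw [show act P (w * w') = act P w ∘ₗ act P w' from LinearMap.ext (act_mul P w w'),
      exteriorPower.map_comp]; rfl

/-- The representation of the reflection group on `X ⊗ ⋀ⁿ V`. -/
def koszulRep (n : ℕ) : Representation ℂ P.weylGroup (X ⊗[ℂ] ⋀[ℂ]^n (ℂ ⊗[ℝ] V₀)) :=
  (weylRep k X).tprod (exteriorRep P n)

lemma koszulRep_tmul (n : ℕ) (w : P.weylGroup) (x : X) (y : ⋀[ℂ]^n (ℂ ⊗[ℝ] V₀)) :
    koszulRep k X n w (x ⊗ₜ y) = (Hecke.t k w • x) ⊗ₜ exteriorPower.map n (act P w) y := rfl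

variable {X} {Z : Type*} [AddCommGroup Z] [Module (Hecke k) Z] [Module ℂ Z]
  [IsScalarTower ℂ (Hecke k) Z]

/-- The bilinear map whose contraction is the Koszul differential. -/
def deltaBilin (F : ℂ ⊗[ℝ] V₀ →ₗ[ℂ] Hecke k) (n : ℕ)
    (g : X ⊗[ℂ] ⋀[ℂ]^(n - 1) (ℂ ⊗[ℝ] V₀) →ₗ[ℂ] Z) (x : X) (y : ⋀[ℂ]^n (ℂ ⊗[ℝ] V₀)) :
    ℂ ⊗[ℝ] V₀ →ₗ[ℂ] Module.Dual ℂ (ℂ ⊗[ℝ] V₀) →ₗ[ℂ] Z :=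
  LinearMap.mk₂ ℂ (fun v ξ => F v • g (x ⊗ₜ Ext.contr ξ n y) - g ((F v • x) ⊗ₜ Ext.contr ξ n y))
    (fun v v' ξ => by
      simp only [map_add, add_smul, TensorProduct.add_tmul]; abel)
    (fun c v ξ => by
      simp only [map_smul, smul_assoc, smul_sub, ← TensorProduct.smul_tmul'])
    (fun v ξ ξ' => by
      simp only [Ext.contr_add, TensorProduct.tmul_add, map_add, smul_add]; abel)
    (fun c v ξ => by
      simp only [Ext.contr_smul, TensorProduct.tmul_smul, map_smul, smul_sub]
      rw [smul_comm])

lemma deltaBilin_apply (F : ℂ ⊗[ℝ] V₀ →ₗ[ℂ] Hecke k) (n : ℕ)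
    (g : X ⊗[ℂ] ⋀[ℂ]^(n - 1) (ℂ ⊗[ℝ] V₀) →ₗ[ℂ] Z) (x : X) (y : ⋀[ℂ]^n (ℂ ⊗[ℝ] V₀))
    (v : ℂ ⊗[ℝ] V₀) (ξ : Module.Dual ℂ (ℂ ⊗[ℝ] V₀)) :
    deltaBilin k F n g x y v ξ =
      F v • g (x ⊗ₜ Ext.contr ξ n y) - g ((F v • x) ⊗ₜ Ext.contr ξ n y) := rfl

/-- The Koszul differential of a linear map `X ⊗ ⋀ⁿ⁻¹ V → Z`. -/
def delta (F : ℂ ⊗[ℝ] V₀ →ₗ[ℂ] Hecke k) (n : ℕ)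
    (g : X ⊗[ℂ] ⋀[ℂ]^(n - 1) (ℂ ⊗[ℝ] V₀) →ₗ[ℂ] Z) : X ⊗[ℂ] ⋀[ℂ]^n (ℂ ⊗[ℝ] V₀) →ₗ[ℂ] Z :=
  ∑ j, (Algebra.lsmul ℂ ℂ Z (F (b j)) ∘ₗ g ∘ₗ (Ext.contr (b.coord j) n).lTensor X -
    g ∘ₗ TensorProduct.map (Algebra.lsmul ℂ ℂ X (F (b j))) (Ext.contr (b.coord j) n))

lemma delta_tmul (F : ℂ ⊗[ℝ] V₀ →ₗ[ℂ] Hecke k) (n : ℕ)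
    (g : X ⊗[ℂ] ⋀[ℂ]^(n - 1) (ℂ ⊗[ℝ] V₀) →ₗ[ℂ] Z) (x : X) (y : ⋀[ℂ]^n (ℂ ⊗[ℝ] V₀)) :
    delta k b F n g (x ⊗ₜ y) = ∑ j, deltaBilin k F n g x y (b j) (b.coord j) := by
  simp [delta, deltaBilin_apply]

lemma delta_sub (F F' : ℂ ⊗[ℝ] V₀ →ₗ[ℂ] Hecke k) (n : ℕ)
    (g : X ⊗[ℂ] ⋀[ℂ]^(n - 1) (ℂ ⊗[ℝ] V₀) →ₗ[ℂ] Z) :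
    delta k b (F - F') n g = delta k b F n g - delta k b F' n g := by
  refine TensorProduct.ext' fun x y => ?_
  rw [LinearMap.sub_apply, delta_tmul, delta_tmul, delta_tmul, ← Finset.sum_sub_distrib]
  refine Finset.sum_congr rfl fun j _ => ?_
  simp only [deltaBilin_apply, LinearMap.sub_apply, sub_smul, TensorProduct.sub_tmul, map_sub]
  abel

/-- Summing over the basis turns each positive root's term into a contraction with its own coroot.
The reflection fixes that contraction, so equivariance of g makes the two halves of the term equal.
-/
lemma delta_shift [Fintype ι] (n : ℕ) (g : X ⊗[ℂ] ⋀[ℂ]^(n - 1) (ℂ ⊗[ℝ] V₀) →ₗ[ℂ] Z)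
    (hg : ∀ w e, g (koszulRep k X (n - 1) w e) = Hecke.t k w • g e) :
    delta k b (Hecke.shift k) n g = 0 := by
  classical
  refine TensorProduct.ext' fun x y => ?_
  rw [delta_tmul, LinearMap.zero_apply]
  have h1 : ∀ j, deltaBilin k (Hecke.shift k) n g x y (b j) (b.coord j) =
      ∑ i, if Δ.IsPos i then ((2 : ℂ)⁻¹ * k.ext i) • corootC P i (b j) •
        (Hecke.t k (SimpleRoots.refl P i) • g (x ⊗ₜ Ext.contr (b.coord j) n y) -
          g ((Hecke.t k (SimpleRoots.refl P i) • x) ⊗ₜ Ext.contr (b.coord j) n y)) else 0 := by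
    intro j
    rw [deltaBilin_apply, Hecke.shift_apply, Finset.sum_smul, Finset.sum_smul,
      TensorProduct.sum_tmul, map_sum, ← Finset.sum_sub_distrib]
    refine Finset.sum_congr rfl fun i _ => ?_
    split_ifs
    · rw [smul_assoc, smul_assoc, ← TensorProduct.smul_tmul', map_smul, ← smul_sub, mul_smul]
    · rw [zero_smul, zero_smul, TensorProduct.zero_tmul, map_zero, sub_zero]
  simp only [h1]
  rw [Finset.sum_comm]
  refine Finset.sum_eq_zero fun i _ => ?_
  by_cases hi : Δ.IsPos i
  · simp only [hi, if_true]
    rw [← Finset.smul_sum]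
    let Φ : Module.Dual ℂ (ℂ ⊗[ℝ] V₀) →ₗ[ℂ] Z :=
      { toFun := fun ξ => Hecke.t k (SimpleRoots.refl P i) • g (x ⊗ₜ Ext.contr ξ n y) -
          g ((Hecke.t k (SimpleRoots.refl P i) • x) ⊗ₜ Ext.contr ξ n y)
        map_add' := fun ξ ξ' => by
          simp only [Ext.contr_add, TensorProduct.tmul_add, map_add, smul_add]; abel
        map_smul' := fun c ξ => by
          simp only [Ext.contr_smul, TensorProduct.tmul_smul, map_smul, smul_sub,
            RingHom.id_apply]
          rw [smul_comm] }
    have h2 : ∑ j, corootC P i (b j) • Φ (b.coord j) = Φ (corootC P i) :=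
      Ext.sum_apply_coord b Φ _
    refine (congrArg _ (h2.trans ?_)).trans (smul_zero _)
    change Hecke.t k (SimpleRoots.refl P i) • g (x ⊗ₜ Ext.contr (corootC P i) n y) -
          g ((Hecke.t k (SimpleRoots.refl P i) • x) ⊗ₜ Ext.contr (corootC P i) n y) = 0
    rw [← hg, koszulRep_tmul, Ext.exteriorPower_map_contr_of_transvection _ (rootC P i) _
      (act_refl i), sub_self]
  · simp [hi]

lemma delta_f_eq_delta_tilde [Fintype ι] (n : ℕ)
    (g : X ⊗[ℂ] ⋀[ℂ]^(n - 1) (ℂ ⊗[ℝ] V₀) →ₗ[ℂ] Z)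
    (hg : ∀ w e, g (koszulRep k X (n - 1) w e) = Hecke.t k w • g e) :
    delta k b (Hecke.f k) n g = delta k b (Hecke.tilde k) n g := by
  rw [Hecke.tilde, delta_sub, delta_shift k b n g hg, sub_zero]

/-- Since W permutes the ṽ linearly and the canonical tensor is invariant, this holds for every
linear g. With v in place of ṽ, equivariance of g would be needed. -/
lemma delta_tilde_conj [Fintype ι] [P.IsReduced] (n : ℕ)
    (g : X ⊗[ℂ] ⋀[ℂ]^(n - 1) (ℂ ⊗[ℝ] V₀) →ₗ[ℂ] Z) (w : P.weylGroup) :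
    delta k b (Hecke.tilde k) n (Hecke.t k w • (g ∘ₗ koszulRep k X (n - 1) w⁻¹)) =
      Hecke.t k w • (delta k b (Hecke.tilde k) n g ∘ₗ koszulRep k X n w⁻¹) := by
  refine TensorProduct.ext' fun x y => ?_
  rw [LinearMap.smul_apply, LinearMap.comp_apply, koszulRep_tmul, delta_tmul, delta_tmul]
  set x' := Hecke.t k w⁻¹ • x
  set y' := exteriorPower.map n (act P w⁻¹) y
  have h1 : ∀ v ξ, deltaBilin k (Hecke.tilde k) n
      (Hecke.t k w • (g ∘ₗ koszulRep k X (n - 1) w⁻¹)) x y v ξ = Hecke.t k w •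
        deltaBilin k (Hecke.tilde k) n g x' y' (act P w⁻¹ v) (ξ ∘ₗ act P w) := by
    intro v ξ
    have h2 : exteriorPower.map (n - 1) (act P w⁻¹) (Ext.contr ξ n y) =
        Ext.contr (ξ ∘ₗ act P w) n y' := by
      have h3 : (ξ ∘ₗ act P w) ∘ₗ act P w⁻¹ = ξ := by
        refine LinearMap.ext fun v => ?_
        rw [LinearMap.comp_apply, LinearMap.comp_apply, ← act_mul, mul_inv_cancel, act_one]
      rw [Ext.contr_exteriorPower_map, h3]
    rw [deltaBilin_apply, deltaBilin_apply]
    simp only [LinearMap.smul_apply, LinearMap.comp_apply, koszulRep_tmul, h2, smul_sub]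
    have h5 : Hecke.t k w * Hecke.tilde k (act P w⁻¹ v) = Hecke.tilde k v * Hecke.t k w := by
      rw [Hecke.t_mul_tilde, ← act_mul, mul_inv_cancel, act_one]
    rw [← mul_smul (Hecke.t k w⁻¹), Hecke.t_mul_tilde, mul_smul _ _ x, ← mul_smul (Hecke.tilde k v),
      ← mul_smul _ (Hecke.tilde k _) (g _), h5]
  simp only [h1]
  rw [← Finset.smul_sum]
  congr 1
  have h4 := Ext.sum_basis_coord_comp b
    (deltaBilin k (Hecke.tilde k) n g x' y' ∘ₗ act P w⁻¹) (act P w)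
  simp only [LinearMap.comp_apply, ← act_mul, inv_mul_cancel, act_one] at h4
  exact h4

lemma delta_tilde_average [Fintype ι] [P.IsReduced] [Fintype P.weylGroup] (n : ℕ)
    (g : X ⊗[ℂ] ⋀[ℂ]^(n - 1) (ℂ ⊗[ℝ] V₀) →ₗ[ℂ] Z) :
    delta k b (Hecke.tilde k) n (average k (koszulRep k X (n - 1)) g) =
      average k (koszulRep k X n) (delta k b (Hecke.tilde k) n g) := by
  have hadd : ∀ g : P.weylGroup → X ⊗[ℂ] ⋀[ℂ]^(n - 1) (ℂ ⊗[ℝ] V₀) →ₗ[ℂ] Z,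
      delta k b (Hecke.tilde k) n (∑ w, g w) = ∑ w, delta k b (Hecke.tilde k) n (g w) := by
    intro g
    refine TensorProduct.ext' fun x y => ?_
    simp only [LinearMap.sum_apply, delta_tmul, deltaBilin_apply, Finset.smul_sum,
      ← Finset.sum_sub_distrib]
    exact Finset.sum_comm
  rw [average, average, hadd]
  exact Finset.sum_congr rfl fun w _ => delta_tilde_conj k b n g w

lemma delta_equivariant [Fintype ι] [P.IsReduced] (n : ℕ)
    (g : X ⊗[ℂ] ⋀[ℂ]^(n - 1) (ℂ ⊗[ℝ] V₀) →ₗ[ℂ] Z)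
    (hg : ∀ w e, g (koszulRep k X (n - 1) w e) = Hecke.t k w • g e) (w : P.weylGroup) (e) :
    delta k b (Hecke.f k) n g (koszulRep k X n w e) =
      Hecke.t k w • delta k b (Hecke.f k) n g e := by
  have h1 : Hecke.t k w • (g ∘ₗ koszulRep k X (n - 1) w⁻¹) = g := by
    refine LinearMap.ext fun e => ?_
    rw [LinearMap.smul_apply, LinearMap.comp_apply, ← hg, ← Module.End.mul_apply, ← map_mul,
      mul_inv_cancel, map_one, Module.End.one_apply]
  have h2 := delta_tilde_conj k b n g w
  rw [h1] at h2
  rw [delta_f_eq_delta_tilde k b n g hg]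
  conv_lhs => rw [h2]
  rw [LinearMap.smul_apply, LinearMap.comp_apply, ← Module.End.mul_apply (koszulRep k X n w⁻¹),
    ← map_mul, inv_mul_cancel, map_one, Module.End.one_apply]

lemma map_delta {Z' : Type*} [AddCommGroup Z'] [Module (Hecke k) Z'] [Module ℂ Z']
    [IsScalarTower ℂ (Hecke k) Z'] (F : ℂ ⊗[ℝ] V₀ →ₗ[ℂ] Hecke k) (n : ℕ)
    (g : X ⊗[ℂ] ⋀[ℂ]^(n - 1) (ℂ ⊗[ℝ] V₀) →ₗ[ℂ] Z) (G : Z →ₗ[Hecke k] Z')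
    (g' : X ⊗[ℂ] ⋀[ℂ]^(n - 1) (ℂ ⊗[ℝ] V₀) →ₗ[ℂ] Z') (h : ∀ e, G (g e) = g' e) (e) :
    G (delta k b F n g e) = delta k b F n g' e := by
  induction e with
  | zero => simp
  | add x y hx hy => rw [map_add, map_add, map_add, hx, hy]
  | tmul x y =>
    rw [delta_tmul, delta_tmul, map_sum]
    refine Finset.sum_congr rfl fun j _ => ?_
    rw [deltaBilin_apply, deltaBilin_apply, map_sub, map_smul, h, h]

end Delta

end

end GradedHecke

namespace GradedHecke

variable {ι V₀ N : Type u} [AddCommGroup V₀] [Module ℝ V₀] [AddCommGroup N] [Module ℝ N]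
  {P : RootPairing ι ℝ V₀ N} {Δ : SimpleRoots P} [Finite ι] [P.IsReduced]

/-! ### The Koszul resolution -/

noncomputable section

variable (k : Parameter Δ) {κ : Type} [Fintype κ] (b : Module.Basis κ ℂ (ℂ ⊗[ℝ] V₀))
  (X : Type u) [AddCommGroup X] [Module ℂ X] [Module (Hecke k) X] [IsScalarTower ℂ (Hecke k) X]

/-- The modules `ℍ ⊗_{ℂ[W]} (X ⊗ ⋀ⁿ V)` of the Koszul resolution. -/
abbrev KoszulInd (n : ℕ) : Type u := Ind k (koszulRep k X n)

/-- The differential of the Koszul resolution. In degree zero it is zero. -/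
def koszulD (n : ℕ) : KoszulInd k X n →ₗ[Hecke k] KoszulInd k X (n - 1) :=
  Ind.lift (delta k b (Hecke.f k) n (Ind.mk k (koszulRep k X (n - 1)))) fun w e => by
    have := Fintype.ofFinite ι
    exact delta_equivariant k b n _ (Ind.mk_rho k _) w e

/-- The augmentation of the Koszul resolution. -/
def koszulAug : KoszulInd k X 0 →ₗ[Hecke k] X :=
  Ind.lift (TensorProduct.rid ℂ X ∘ₗ
    (exteriorPower.zeroEquiv ℂ (ℂ ⊗[ℝ] V₀)).toLinearMap.lTensor X) fun w e => by
    induction e with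
    | zero => simp
    | add x y hx hy => rw [map_add, map_add, map_add, hx, hy, smul_add]
    | tmul x y =>
      rw [koszulRep_tmul]
      simp only [LinearMap.comp_apply, LinearMap.lTensor_tmul, LinearEquiv.coe_coe,
        TensorProduct.rid_tmul]
      have h := LinearMap.congr_fun (exteriorPower.zeroEquiv_naturality (act P w)) y
      simp only [LinearMap.comp_apply, LinearEquiv.coe_coe] at h
      rw [h, smul_comm]

variable {X}

omit [Finite ι] [P.IsReduced] in
lemma koszulAug_mk_tmul (x : X) (y : ⋀[ℂ]^0 (ℂ ⊗[ℝ] V₀)) :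
    koszulAug k X (Ind.mk k _ (x ⊗ₜ y)) = exteriorPower.zeroEquiv ℂ (ℂ ⊗[ℝ] V₀) y • x := by
  rw [koszulAug, Ind.lift_mk]
  simp

omit [Finite ι] [P.IsReduced] in
lemma koszulAug_surjective : Function.Surjective (koszulAug k X) := fun x =>
  ⟨Ind.mk k _ (x ⊗ₜ (exteriorPower.zeroEquiv ℂ (ℂ ⊗[ℝ] V₀)).symm 1), by
    rw [koszulAug_mk_tmul, LinearEquiv.apply_symm_apply, one_smul]⟩

lemma map_koszulD_mk {Z : Type*} [AddCommGroup Z] [Module (Hecke k) Z] [Module ℂ Z]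
    [IsScalarTower ℂ (Hecke k) Z] (n : ℕ) (G : KoszulInd k X (n - 1) →ₗ[Hecke k] Z)
    (e : X ⊗[ℂ] ⋀[ℂ]^n (ℂ ⊗[ℝ] V₀)) :
    G (koszulD k b X n (Ind.mk k _ e)) =
      delta k b (Hecke.f k) n (G.restrictScalars ℂ ∘ₗ Ind.mk k _) e := by
  rw [koszulD, Ind.lift_mk]
  exact map_delta k b _ n _ G _ (fun _ => rfl) e

lemma koszulD_zero : koszulD k b X 0 = 0 := by
  refine Ind.hom_ext fun e => ?_
  rw [LinearMap.zero_apply, koszulD, Ind.lift_mk]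
  induction e with
  | zero => simp
  | add x y hx hy => rw [map_add, hx, hy, add_zero]
  | tmul x y => simp [delta_tmul, deltaBilin_apply, Ext.contr_zero]

/-- The differential of the Koszul resolution in positive degrees. -/
def koszulDSucc (n : ℕ) : KoszulInd k X (n + 1) →ₗ[Hecke k] KoszulInd k X n :=
  koszulD k b X (n + 1)

lemma koszulDSucc_mk_tmul (n : ℕ) (x : X) (y : ⋀[ℂ]^(n + 1) (ℂ ⊗[ℝ] V₀)) :
    koszulDSucc k b n (Ind.mk k _ (x ⊗ₜ y)) =
      ∑ j, (Hecke.f k (b j) • Ind.mk k (koszulRep k X n) (x ⊗ₜ Ext.contrSucc (b.coord j) n y) -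
        Ind.mk k (koszulRep k X n) ((Hecke.f k (b j) • x) ⊗ₜ Ext.contrSucc (b.coord j) n y)) := by
  rw [koszulDSucc, koszulD, Ind.lift_mk, delta_tmul]
  rfl

lemma koszulAug_koszulDSucc (z : KoszulInd k X 1) : koszulAug k X (koszulDSucc k b 0 z) = 0 := by
  suffices h : koszulAug k X ∘ₗ koszulDSucc k b 0 = 0 from LinearMap.congr_fun h z
  refine Ind.hom_ext fun e => ?_
  induction e with
  | zero => simp
  | add x y hx hy => rw [map_add, map_add, map_add, hx, hy]
  | tmul x y =>
    rw [LinearMap.comp_apply, koszulDSucc_mk_tmul, map_sum, LinearMap.zero_apply]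
    refine Finset.sum_eq_zero fun j _ => ?_
    rw [map_sub, map_smul, koszulAug_mk_tmul, koszulAug_mk_tmul, smul_comm, sub_self]

variable (X) [DecidableEq κ]

/-- The Koszul data given by the action of a basis of `V` on `X`. -/
def moduleKoszulData : KoszulData κ fun n => X ⊗[ℂ] ⋀[ℂ]^n (ℂ ⊗[ℝ] V₀) :=
  koszulData b (fun j => Algebra.lsmul ℂ ℂ X (Hecke.f k (b j))) fun j l x => by
    simp only [Algebra.lsmul_coe, ← mul_smul, Hecke.f_comm]

variable {X}

omit [Finite ι] [P.IsReduced] in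
lemma moduleKoszulData_D_tmul (n : ℕ) (p : MvPolynomial κ ℂ) (x : X)
    (y : ⋀[ℂ]^(n + 1) (ℂ ⊗[ℝ] V₀)) :
    (moduleKoszulData k b X).D n (p ⊗ₜ (x ⊗ₜ y)) =
      ∑ j, ((MvPolynomial.X j * p) ⊗ₜ (x ⊗ₜ[ℂ] Ext.contrSucc (b.coord j) n y) -
        p ⊗ₜ ((Hecke.f k (b j) • x) ⊗ₜ[ℂ] Ext.contrSucc (b.coord j) n y)) :=
  (moduleKoszulData k b X).D_tmul n p (x ⊗ₜ y)

omit [Finite ι] [P.IsReduced] [Fintype κ] [DecidableEq κ] in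
lemma Hecke.ofPoly_X_mul (j : κ) (p : MvPolynomial κ ℂ) :
    Hecke.ofPoly k b (MvPolynomial.X j * p) = Hecke.ofPoly k b p * Hecke.f k (b j) := by
  rw [mul_comm, map_mul, Hecke.ofPoly_X]

/-- This transports the whole question of exactness to the polynomial Koszul complex. Commutativity
of S(V) lets the variable X_j appear at the right end of the coefficient, where f_{b_j} stands in
the differential. -/
lemma koszulDSucc_ofPoly (n : ℕ)
    (z : MvPolynomial κ ℂ ⊗[ℂ] (X ⊗[ℂ] ⋀[ℂ]^(n + 1) (ℂ ⊗[ℝ] V₀))) :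
    koszulDSucc k b n (Ind.ofPoly k _ b z) =
      Ind.ofPoly k (koszulRep k X n) b ((moduleKoszulData k b X).D n z) := by
  induction z with
  | zero => simp
  | add x y hx hy => simp only [map_add, hx, hy]
  | tmul p e =>
    induction e with
    | zero => simp
    | add x y hx hy => simp only [TensorProduct.tmul_add, map_add, hx, hy]
    | tmul x y =>
      rw [moduleKoszulData_D_tmul, Ind.ofPoly_tmul, map_smul, koszulDSucc_mk_tmul, map_sum,
        Finset.smul_sum]
      refine Finset.sum_congr rfl fun j _ => ?_
      have h1 := Ind.ofPoly_tmul k (koszulRep k X n) b (MvPolynomial.X j * p)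
        (x ⊗ₜ Ext.contrSucc (b.coord j) n y)
      have h2 := Ind.ofPoly_tmul k (koszulRep k X n) b p
        ((Hecke.f k (b j) • x) ⊗ₜ Ext.contrSucc (b.coord j) n y)
      rw [Hecke.ofPoly_X_mul, mul_smul] at h1
      exact (smul_sub _ _ _).trans ((congrArg₂ _ h1 h2).symm.trans (map_sub _ _ _).symm)

lemma koszulDSucc_koszulDSucc (n : ℕ) (z : KoszulInd k X (n + 2)) :
    koszulDSucc k b n (koszulDSucc k b (n + 1) z) = 0 := by
  obtain ⟨z, rfl⟩ := Ind.ofPoly_surjective k _ b z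
  rw [koszulDSucc_ofPoly, koszulDSucc_ofPoly, KoszulData.D_D, map_zero]

lemma exists_koszulDSucc_eq (n : ℕ) (z : KoszulInd k X (n + 1)) (hz : koszulDSucc k b n z = 0) :
    ∃ y, koszulDSucc k b (n + 1) y = z := by
  obtain ⟨z, rfl⟩ := Ind.ofPoly_surjective k _ b z
  rw [koszulDSucc_ofPoly, ← map_zero (Ind.ofPoly k (koszulRep k X n) b)] at hz
  obtain ⟨y, rfl⟩ := (moduleKoszulData k b X).exact_succ n z (Ind.ofPoly_injective k _ b hz)
  exact ⟨Ind.ofPoly k _ b y, koszulDSucc_ofPoly k b _ y⟩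

lemma exists_koszulDSucc_eq_of_aug (z : KoszulInd k X 0) (hz : koszulAug k X z = 0) :
    ∃ y, koszulDSucc k b 0 y = z := by
  obtain ⟨z, rfl⟩ := Ind.ofPoly_surjective k _ b z
  -- On constant polynomials the augmentation is the isomorphism X ⊗ ⋀⁰V ≅ X.
  have hinj : ∀ e, ((koszulAug k X).restrictScalars ℂ ∘ₗ Ind.ofPoly k _ b) (1 ⊗ₜ e) = 0 →
      e = 0 := by
    intro e he
    rw [LinearMap.comp_apply, Ind.ofPoly_tmul, map_one, one_smul, LinearMap.restrictScalars_apply,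
      koszulAug, Ind.lift_mk, LinearMap.comp_apply, LinearEquiv.coe_coe,
      LinearEquiv.map_eq_zero_iff] at he
    exact (LinearEquiv.lTensor X (exteriorPower.zeroEquiv ℂ (ℂ ⊗[ℝ] V₀))).map_eq_zero_iff.1 he
  have hD : ∀ y, ((koszulAug k X).restrictScalars ℂ ∘ₗ Ind.ofPoly k _ b)
      ((moduleKoszulData k b X).D 0 y) = 0 := by
    intro y
    rw [LinearMap.comp_apply, ← koszulDSucc_ofPoly, LinearMap.restrictScalars_apply,
      koszulAug_koszulDSucc k b]
  obtain ⟨y, hy⟩ := (moduleKoszulData k b X).exact_zero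
    ((koszulAug k X).restrictScalars ℂ ∘ₗ Ind.ofPoly k _ b) hinj hD z hz
  exact ⟨Ind.ofPoly k _ b y, by rw [koszulDSucc_ofPoly, hy]⟩

end

end GradedHecke

namespace GradedHecke

noncomputable section

/-! ### Extensions in the top degree of a projective resolution -/

section ExtTop

universe w' v' u'

open Abelian

variable {C : Type u'} [Category.{v'} C] [Abelian C] [HasExt.{w'} C] [Linear ℂ C] {X : C}
  (R : ProjectiveResolution X) (n : ℕ) (hn : R.complex.d (n + 1) n = 0) (Y : C)

/-- If the differential into degree `n` of a projective resolution is zero, then every morphism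
from its term in degree `n` defines an extension of degree `n`. -/
def extTop : (R.complex.X n ⟶ Y) →ₗ[ℂ] Ext X Y n where
  toFun f := R.extMk f (n + 1) rfl (by rw [hn, Limits.zero_comp])
  map_add' f g := (R.add_extMk f g _ rfl _ _).symm
  map_smul' c f := by
    rw [RingHom.id_apply, Ext.smul_eq_comp_mk₀, R.extMk_comp_mk₀]
    congr 1
    rw [Linear.comp_smul, Category.comp_id]

lemma extTop_surjective : Function.Surjective (extTop R n hn Y) := fun α => by
  obtain ⟨f, hf, h⟩ := R.extMk_surjective α (n + 1) rfl
  exact ⟨f, h⟩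

lemma extTop_eq_zero_iff (f : R.complex.X n ⟶ Y) :
    extTop R n hn Y f = 0 ↔ ∃ g : R.complex.X (n - 1) ⟶ Y, R.complex.d n (n - 1) ≫ g = f := by
  rcases n with _ | n
  · have h0 : R.complex.d 0 (0 - 1) = 0 := R.complex.shape _ _ (by simp)
    rw [h0]
    simp only [Limits.zero_comp, exists_const]
    refine ⟨fun h => ?_, fun h => by rw [← h, map_zero]⟩
    have h1 := R.extEquivCohomologyClass.congr_arg h
    rw [extTop, LinearMap.coe_mk, AddHom.coe_mk, ProjectiveResolution.extEquivCohomologyClass_extMk,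
      ProjectiveResolution.extEquivCohomologyClass_zero,
      CochainComplex.HomComplex.CohomologyClass.mk_eq_zero_iff,
      CochainComplex.HomComplex.Cocycle.toSingleMk_mem_coboundaries_iff _ _ _ _ _ 1 (by simp)] at h1
    obtain ⟨g, hg⟩ := h1
    have hz : Limits.IsZero (R.cochainComplex.X 1) :=
      CochainComplex.isZero_of_isStrictlyLE _ 0 _ (by simp)
    rw [hz.eq_of_src g 0, Limits.comp_zero] at hg
    rw [← cancel_epi (R.cochainComplexXIso (-(0 : ℕ)) 0 rfl).hom, ← hg, Limits.comp_zero]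
  · exact R.extMk_eq_zero_iff f _ rfl (by rw [hn, Limits.zero_comp]) n rfl

end ExtTop

/-! ### The Koszul resolution as a projective resolution -/

section Resolution

variable {ι V₀ N : Type u} [AddCommGroup V₀] [Module ℝ V₀] [AddCommGroup N] [Module ℝ N]
  {P : RootPairing ι ℝ V₀ N} {Δ : SimpleRoots P} [Finite ι] [P.IsReduced]
  (k : Parameter Δ) {κ : Type} [Fintype κ] [DecidableEq κ] (b : Module.Basis κ ℂ (ℂ ⊗[ℝ] V₀))
  (X : ModuleCat.{u} (Hecke k))

/-- The Koszul complex. -/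
def koszulComplex : ChainComplex (ModuleCat.{u} (Hecke k)) ℕ :=
  ChainComplex.of (fun n => ModuleCat.of (Hecke k) (KoszulInd k X n))
    (fun n => ModuleCat.ofHom (koszulDSucc k b n))
    (fun n => by
      ext z
      exact koszulDSucc_koszulDSucc k b n z)

lemma koszulComplex_d (n : ℕ) :
    (koszulComplex k b X).d (n + 1) n = ModuleCat.ofHom (koszulDSucc k b n) :=
  ChainComplex.of_d (fun n => ModuleCat.of (Hecke k) (KoszulInd k X n))
    (fun n => ModuleCat.ofHom (koszulDSucc k b n)) n

lemma koszulComplex_d_pred (n : ℕ) :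
    (koszulComplex k b X).d n (n - 1) = ModuleCat.ofHom (koszulD k b X n) := by
  rcases n with _ | n
  · rw [koszulD_zero]
    exact (koszulComplex k b X).shape _ _ (by simp)
  · exact koszulComplex_d k b X n

lemma koszulComplex_exactAt_succ (n : ℕ) : (koszulComplex k b X).ExactAt (n + 1) := by
  rw [HomologicalComplex.exactAt_iff' _ (n + 1 + 1) (n + 1) n (by simp) (by simp),
    ShortComplex.moduleCat_exact_iff]
  intro z hz
  change (koszulComplex k b X).d (n + 1) n z = 0 at hz
  rw [koszulComplex_d] at hz
  obtain ⟨y, hy⟩ := exists_koszulDSucc_eq k b n z hz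
  refine ⟨y, ?_⟩
  change (koszulComplex k b X).d (n + 1 + 1) (n + 1) y = z
  rw [koszulComplex_d]
  exact hy

/-- The augmentation of the Koszul complex. -/
def koszulComplexAug : (koszulComplex k b X).X 0 ⟶ X := ModuleCat.ofHom (koszulAug k X)

lemma koszulComplex_d_comp_aug : (koszulComplex k b X).d 1 0 ≫ koszulComplexAug k b X = 0 := by
  rw [koszulComplex_d]
  ext z
  exact koszulAug_koszulDSucc k b z

/-- The Koszul resolution of an `ℍ`-module. -/
def koszulResolution : ProjectiveResolution X where
  complex := koszulComplex k b X
  projective n := 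
    (inferInstance : Projective (ModuleCat.of (Hecke k) (KoszulInd k X n)))
  π := (ChainComplex.toSingle₀Equiv _ _).symm
    ⟨koszulComplexAug k b X, koszulComplex_d_comp_aug k b X⟩
  quasiIso := ⟨fun n => by
    cases n
    · rw [ChainComplex.quasiIsoAt₀_iff, ShortComplex.quasiIso_iff_of_zeros']
      · refine (ShortComplex.exact_and_epi_g_iff_of_iso (S₂ := ShortComplex.mk _ _
          (koszulComplex_d_comp_aug k b X)) ?_).2 ⟨?_, ?_⟩
        · exact ShortComplex.isoMk (Iso.refl _) (Iso.refl _) (Iso.refl _)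
            ((Category.id_comp _).trans (Category.comp_id _).symm)
            ((Category.id_comp _).trans ((ChainComplex.toSingle₀Equiv_symm_apply_f_zero
              (koszulComplexAug k b X) (koszulComplex_d_comp_aug k b X)).symm.trans
              (Category.comp_id _).symm))
        · rw [ShortComplex.moduleCat_exact_iff]
          intro z hz
          obtain ⟨y, hy⟩ := exists_koszulDSucc_eq_of_aug k b z hz
          refine ⟨y, ?_⟩
          change (koszulComplex k b X).d (0 + 1) 0 y = z
          rw [koszulComplex_d]
          exact hy
        · exact (ModuleCat.epi_iff_surjective _).2 (koszulAug_surjective k)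
      all_goals rfl
    · rw [quasiIsoAt_iff_exactAt']
      · apply koszulComplex_exactAt_succ
      · apply ChainComplex.exactAt_succ_single_obj⟩

variable {k X} in
/-- In the top degree, every linear map out of the Koszul resolution defines an extension. -/
theorem exists_linearMap_ext (Y : ModuleCat.{u} (Hecke k)) (n : ℕ)
    (hn : koszulDSucc k b (X := X) n = 0) :
    ∃ Θ : (KoszulInd k X n →ₗ[Hecke k] Y) →ₗ[ℂ] Abelian.Ext X Y n, Function.Surjective Θ ∧
      ∀ F, Θ F = 0 ↔ ∃ G : KoszulInd k X (n - 1) →ₗ[Hecke k] Y, G ∘ₗ koszulD k b X n = F := by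
  have hd : (koszulResolution k b X).complex.d (n + 1) n = 0 := by
    refine (koszulComplex_d k b X n).trans ?_
    rw [hn]
    rfl
  let e : (KoszulInd k X n →ₗ[Hecke k] Y) ≃ₗ[ℂ] ((koszulResolution k b X).complex.X n ⟶ Y) :=
    (ModuleCat.homLinearEquiv (M := ModuleCat.of (Hecke k) (KoszulInd k X n)) (N := Y)).symm
  refine ⟨extTop (koszulResolution k b X) n hd Y ∘ₗ e.toLinearMap, ?_, fun F => ?_⟩
  · exact (extTop_surjective _ n hd Y).comp e.surjective
  · refine (extTop_eq_zero_iff _ n hd Y _).trans ?_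
    have h := koszulComplex_d_pred k b X n
    constructor
    · rintro ⟨g, hg⟩
      refine ⟨g.hom, ?_⟩
      change (koszulComplex k b X).d n (n - 1) ≫ g = ModuleCat.ofHom F at hg
      rw [h] at hg
      exact congrArg ModuleCat.Hom.hom hg
    · rintro ⟨G, rfl⟩
      refine ⟨ModuleCat.ofHom G, ?_⟩
      change (koszulComplex k b X).d n (n - 1) ≫ ModuleCat.ofHom G = _
      rw [h]
      rfl

end Resolution

end

end GradedHecke

namespace GradedHecke

noncomputable section

/-! ### The top exterior power -/

section TopExterior

variable {V : Type*} [AddCommGroup V] [Module ℂ V] {n : ℕ} (b : Module.Basis (Fin n) ℂ V)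

/-- The coordinate on the top exterior power given by a basis. -/
def topCoord : ⋀[ℂ]^n V →ₗ[ℂ] ℂ := exteriorPower.alternatingMapLinearEquiv b.det

/-- The generator of the top exterior power given by a basis. -/
def topForm : ⋀[ℂ]^n V := exteriorPower.ιMulti ℂ n b

lemma topCoord_topForm : topCoord b (topForm b) = 1 := by
  rw [topCoord, topForm, exteriorPower.alternatingMapLinearEquiv_apply_ιMulti, b.det_self]

lemma topCoord_smul_topForm (y : ⋀[ℂ]^n V) : topCoord b y • topForm b = y := by
  have h : (topCoord b).smulRight (topForm b) = LinearMap.id := by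
    -- It suffices to test on tuples of distinct basis vectors. There are n of them in a basis of
    -- size n, so such a tuple is a permutation of the basis.
    refine exteriorPower.linearMap_ext (b.ext_alternating fun v hv => ?_)
    let σ : Equiv.Perm (Fin n) := Equiv.ofBijective v (Finite.injective_iff_bijective.1 hv)
    have hσ : (fun i => b (v i)) = b ∘ σ := rfl
    rw [hσ, AlternatingMap.map_perm, AlternatingMap.map_perm]
    congr 1
    change topCoord b (topForm b) • topForm b = topForm b
    rw [topCoord_topForm, one_smul]
  exact LinearMap.congr_fun h y

/-- This is how the sign character enters: it is the determinant by which W acts on the top exterior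
power. -/
lemma topCoord_map (g : V →ₗ[ℂ] V) (y : ⋀[ℂ]^n V) :
    topCoord b (exteriorPower.map n g y) = LinearMap.det g * topCoord b y := by
  rw [← topCoord_smul_topForm b y]
  simp only [map_smul, topCoord_topForm, smul_eq_mul, mul_one]
  rw [topForm, exteriorPower.map_apply_ιMulti, topCoord,
    exteriorPower.alternatingMapLinearEquiv_apply_ιMulti, b.det_comp, b.det_self, mul_one, mul_comm]

include b in
lemma subsingleton_exteriorPower_succ : Subsingleton (⋀[ℂ]^(n + 1) V) := by
  have := Module.Finite.of_basis b
  have h : Module.finrank ℂ (⋀[ℂ]^(n + 1) V) = 0 := by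
    rw [exteriorPower.finrank_eq, Module.finrank_eq_card_basis b, Fintype.card_fin,
      Nat.choose_succ_self]
  exact Module.finrank_zero_iff.1 h

lemma topCoord_wedge_contr {n : ℕ} (b : Module.Basis (Fin (n + 1)) ℂ V) (v : V)
    (ξ : Module.Dual ℂ V) (y : ⋀[ℂ]^(n + 1) V) :
    topCoord b (Ext.wedge v n (Ext.contrSucc ξ n y)) = ξ v * topCoord b y := by
  have := subsingleton_exteriorPower_succ b
  have h := Ext.contr_wedge ξ v n y
  rw [Subsingleton.elim (Ext.wedge v (n + 1) y) 0, map_zero, zero_add] at h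
  rw [h, map_smul, smul_eq_mul]

end TopExterior

/-! ### The trace pairing -/

section TracePairing

variable (X Y : Type*) [AddCommGroup X] [Module ℂ X] [AddCommGroup Y] [Module ℂ Y]

/-- The pairing `(ψ, φ) ↦ tr(ψ φ)`. -/
def tracePairing : (Y →ₗ[ℂ] X) →ₗ[ℂ] Module.Dual ℂ (X →ₗ[ℂ] Y) :=
  (LinearMap.llcomp ℂ X Y X).compr₂ (LinearMap.trace ℂ X)

variable {X Y}

lemma tracePairing_apply (ψ : Y →ₗ[ℂ] X) (φ : X →ₗ[ℂ] Y) :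
    tracePairing X Y ψ φ = LinearMap.trace ℂ X (ψ ∘ₗ φ) := rfl

variable [FiniteDimensional ℂ X]

/-- Pairing with the rank one map x ↦ ξ(x)y gives ξ(ψ(y)), and functionals separate points. -/
lemma tracePairing_injective : Function.Injective (tracePairing X Y) := by
  rw [injective_iff_map_eq_zero]
  refine fun ψ h => LinearMap.ext fun y => (Module.forall_dual_apply_eq_zero_iff ℂ _).1 fun ξ => ?_
  have h1 := LinearMap.congr_fun h (ξ.smulRight y)
  have h2 : ψ ∘ₗ ξ.smulRight y = ξ.smulRight (ψ y) := by ext; simp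
  rwa [tracePairing_apply, h2, LinearMap.trace_smulRight] at h1

variable [FiniteDimensional ℂ Y]

/-- The trace pairing is perfect, so T is the annihilator of ker Ξ, whose dimension is the
codimension of ker Ξ, that is, the dimension of E. -/
lemma finrank_eq_of_mem_iff_tracePairing {E : Type*} [AddCommGroup E] [Module ℂ E]
    (Ξ : (X →ₗ[ℂ] Y) →ₗ[ℂ] E) (hΞ : Function.Surjective Ξ) (T : Submodule ℂ (Y →ₗ[ℂ] X))
    (hT : ∀ ψ, ψ ∈ T ↔ ∀ φ, Ξ φ = 0 → tracePairing X Y ψ φ = 0) :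
    Module.finrank ℂ E = Module.finrank ℂ T := by
  have hdim : Module.finrank ℂ (Y →ₗ[ℂ] X) = Module.finrank ℂ (Module.Dual ℂ (X →ₗ[ℂ] Y)) := by
    rw [Subspace.dual_finrank_eq, Module.finrank_linearMap, Module.finrank_linearMap, mul_comm]
  let e := LinearEquiv.ofBijective (tracePairing X Y) ⟨tracePairing_injective,
    (LinearMap.injective_iff_surjective_of_finrank_eq_finrank hdim).1 tracePairing_injective⟩
  have hTe : T.map (e : (Y →ₗ[ℂ] X) →ₗ[ℂ] _) = (LinearMap.ker Ξ).dualAnnihilator := by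
    ext ℓ
    rw [Submodule.mem_dualAnnihilator, Submodule.mem_map]
    constructor
    · rintro ⟨ψ, hψ, rfl⟩ φ hφ
      exact (hT ψ).1 hψ φ hφ
    · intro h
      refine ⟨e.symm ℓ, (hT _).2 fun φ hφ => ?_, e.apply_symm_apply ℓ⟩
      have : tracePairing X Y (e.symm ℓ) = ℓ := e.apply_symm_apply ℓ
      rw [this]
      exact h φ hφ
  have h1 := Subspace.finrank_add_finrank_dualAnnihilator_eq (LinearMap.ker Ξ)
  have h2 := LinearMap.finrank_range_add_finrank_ker Ξ
  rw [LinearMap.range_eq_top.2 hΞ, finrank_top] at h2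
  have h3 := LinearEquiv.finrank_map_eq e T
  rw [hTe] at h3
  omega

end TracePairing

end

end GradedHecke

namespace GradedHecke

noncomputable section

/-! ### Extensions of top degree and twisted intertwiners -/

variable {ι V₀ N : Type u} [AddCommGroup V₀] [Module ℝ V₀] [AddCommGroup N] [Module ℝ N]
  {P : RootPairing ι ℝ V₀ N} {Δ : SimpleRoots P} [FiniteDimensional ℝ V₀]

lemma det_act (w : P.weylGroup) : LinearMap.det (act P w) = sgn P w := by
  rw [act, LinearMap.det_baseChange]
  rfl

omit [FiniteDimensional ℝ V₀] in
lemma sgn_inv_mul_sgn (w : P.weylGroup) : sgn P w⁻¹ * sgn P w = 1 := by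
  rw [← sgn_mul, inv_mul_cancel, sgn_one]

variable (Δ) in
include Δ in
lemma sgn_mul_self [Finite ι] [P.IsReduced] (w : P.weylGroup) : sgn P w * sgn P w = 1 := by
  induction w using Δ.weylGroup_induction with
  | one => rw [sgn_one, one_mul]
  | mul j w ih => rw [sgn_mul, mul_mul_mul_comm, ih, sgn_refl, mul_one, neg_mul_neg, one_mul]

variable (Δ) in
include Δ in
lemma sgn_inv [Finite ι] [P.IsReduced] (w : P.weylGroup) : sgn P w⁻¹ = sgn P w := by
  rw [← mul_one (sgn P w⁻¹), ← sgn_mul_self Δ w, ← mul_assoc, sgn_inv_mul_sgn, one_mul]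

variable (k : Parameter Δ) {n : ℕ} (b : Module.Basis (Fin n) ℂ (ℂ ⊗[ℝ] V₀))
  {X : Type u} [AddCommGroup X] [Module ℂ X] [Module (Hecke k) X] [IsScalarTower ℂ (Hecke k) X]
  {Y : Type*} [AddCommGroup Y] [Module ℂ Y] [Module (Hecke k) Y] [IsScalarTower ℂ (Hecke k) Y]

variable (X Y) in
/-- The linear maps that commute with the elements `v - ½ ∑_{α > 0} k_α ⟨v, α^∨⟩ t_{s_α}` and
commute with the reflection group up to the sign character. -/
def twistedHom [Fintype ι] : Submodule ℂ (Y →ₗ[ℂ] X) where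
  carrier := {ψ | (∀ w y, ψ (Hecke.t k w • y) = sgn P w • Hecke.t k w • ψ y) ∧
    ∀ v y, ψ (Hecke.tilde k v • y) = Hecke.tilde k v • ψ y}
  zero_mem' := by simp
  add_mem' := fun h h' => ⟨fun w y => by simp [h.1, h'.1], fun v y => by simp [h.2, h'.2]⟩
  smul_mem' := fun c ψ h => ⟨fun w y => by
      simp only [LinearMap.smul_apply, h.1]
      rw [smul_comm c, smul_comm c (Hecke.t k w)],
    fun v y => by
      simp only [LinearMap.smul_apply, h.2]
      rw [smul_comm]⟩

/-- The linear map `X ⊗ ⋀ⁿ V → Y` given by a linear map `X → Y` in the top degree. -/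
def topMap : (X →ₗ[ℂ] Y) →ₗ[ℂ] (X ⊗[ℂ] ⋀[ℂ]^n (ℂ ⊗[ℝ] V₀) →ₗ[ℂ] Y) where
  toFun φ := TensorProduct.rid ℂ Y ∘ₗ TensorProduct.map φ (topCoord b)
  map_add' φ φ' := TensorProduct.ext' fun x y => by simp
  map_smul' c φ := TensorProduct.ext' fun x y => by
    simp only [LinearMap.comp_apply, LinearEquiv.coe_coe, TensorProduct.map_tmul,
      TensorProduct.rid_tmul, LinearMap.smul_apply, RingHom.id_apply]
    rw [smul_comm]

omit [FiniteDimensional ℝ V₀] in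
lemma topMap_tmul (φ : X →ₗ[ℂ] Y) (x : X) (y : ⋀[ℂ]^n (ℂ ⊗[ℝ] V₀)) :
    topMap b φ (x ⊗ₜ y) = topCoord b y • φ x := by
  simp [topMap]

/-- The `ℍ`-linear map on the Koszul resolution in the top degree given by a linear map. -/
def topHom [Fintype P.weylGroup] : (X →ₗ[ℂ] Y) →ₗ[ℂ] (KoszulInd k X n →ₗ[Hecke k] Y) where
  toFun φ := Ind.lift (average k (koszulRep k X n) (topMap b φ)) (average_rho k _ _)
  map_add' φ φ' := Ind.hom_ext fun e => by
    simp only [LinearMap.add_apply, Ind.lift_mk, average_apply, map_add, smul_add,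
      Finset.sum_add_distrib]
  map_smul' c φ := Ind.hom_ext fun e => by
    simp only [LinearMap.smul_apply, Ind.lift_mk, average_apply, map_smul, Finset.smul_sum,
      RingHom.id_apply]
    exact Finset.sum_congr rfl fun w _ => smul_comm _ _ _

omit [FiniteDimensional ℝ V₀] in
lemma topHom_mk [Fintype P.weylGroup] (φ : X →ₗ[ℂ] Y) (e) :
    topHom k b φ (Ind.mk k _ e) = average k (koszulRep k X n) (topMap b φ) e :=
  Ind.lift_mk _ (average_rho k _ _) e

omit [FiniteDimensional ℝ V₀] in
lemma topHom_surjective [Finite ι] [Fintype P.weylGroup] :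
    Function.Surjective (topHom k b : (X →ₗ[ℂ] Y) →ₗ[ℂ] (KoszulInd k X n →ₗ[Hecke k] Y)) := by
  intro F
  -- F is determined by its values on x ⊗ `topForm b`. They define an equivariant map, which
  -- averaging multiplies by the order of W, hence the inverse factor below.
  let φ : X →ₗ[ℂ] Y := F.restrictScalars ℂ ∘ₗ Ind.mk k (koszulRep k X n) ∘ₗ
    (TensorProduct.mk ℂ X _).flip (topForm b)
  have h1 : topMap b φ = F.restrictScalars ℂ ∘ₗ Ind.mk k (koszulRep k X n) := by
    refine TensorProduct.ext' fun x y => ?_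
    rw [topMap_tmul]
    conv_rhs => rw [← topCoord_smul_topForm b y, TensorProduct.tmul_smul, map_smul]
    rfl
  have hne : (Fintype.card P.weylGroup : ℂ) ≠ 0 := Nat.cast_ne_zero.2 Fintype.card_ne_zero
  refine ⟨(Fintype.card P.weylGroup : ℂ)⁻¹ • φ, Ind.hom_ext fun e => ?_⟩
  rw [map_smul, LinearMap.smul_apply, topHom_mk, h1, average_of_equivariant, LinearMap.smul_apply,
    inv_smul_smul₀ hne]
  · rfl
  · intro w e
    change F _ = _ • F _
    rw [Ind.mk_rho, map_smul]

/-- Conjugation of a linear map with an element of the reflection group, multiplied by its sign. -/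
def signConj (w : P.weylGroup) (φ : X →ₗ[ℂ] Y) : X →ₗ[ℂ] Y :=
  sgn P w • (Algebra.lsmul ℂ ℂ Y (Hecke.t k w) ∘ₗ φ ∘ₗ Algebra.lsmul ℂ ℂ X (Hecke.t k w⁻¹))

omit [FiniteDimensional ℝ V₀] in
lemma signConj_apply (w : P.weylGroup) (φ : X →ₗ[ℂ] Y) (x : X) :
    signConj k w φ x = sgn P w • Hecke.t k w • φ (Hecke.t k w⁻¹ • x) := rfl

lemma topMap_signConj [Finite ι] [P.IsReduced] (w : P.weylGroup) (φ : X →ₗ[ℂ] Y) (e) :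
    topMap b (signConj k w φ) e = Hecke.t k w • topMap b φ (koszulRep k X n w⁻¹ e) := by
  induction e with
  | zero => simp
  | add x y hx hy => simp only [map_add, hx, hy, smul_add]
  | tmul x y =>
    rw [koszulRep_tmul, topMap_tmul, topMap_tmul, topCoord_map, det_act, sgn_inv Δ, signConj_apply,
      mul_comm, mul_smul, smul_comm (Hecke.t k w), smul_comm (Hecke.t k w)]

omit [FiniteDimensional ℝ V₀] in
lemma average_conj [Fintype P.weylGroup] {E : Type u} [AddCommGroup E] [Module ℂ E]
    (ρ : Representation ℂ P.weylGroup E) (u : P.weylGroup)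
    (g g' : E →ₗ[ℂ] Y) (h : ∀ e, g' e = Hecke.t k u • g (ρ u⁻¹ e)) :
    average k ρ g' = average k ρ g := by
  refine LinearMap.ext fun e => ?_
  rw [average_apply, average_apply, ← Equiv.sum_comp (Equiv.mulRight u⁻¹)]
  refine Finset.sum_congr rfl fun w _ => ?_
  have h1 : ρ u⁻¹ (ρ (w * u⁻¹)⁻¹ e) = ρ w⁻¹ e := by
    rw [← Module.End.mul_apply, ← map_mul, mul_inv_rev, inv_inv, inv_mul_cancel_left]
  have h2 : Hecke.t k (w * u⁻¹) * Hecke.t k u = Hecke.t k w := by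
    rw [← map_mul, inv_mul_cancel_right]
  rw [Equiv.coe_mulRight, h, h1, ← mul_smul, h2]

lemma topHom_signConj [Finite ι] [P.IsReduced] [Fintype P.weylGroup] (u : P.weylGroup)
    (φ : X →ₗ[ℂ] Y) : topHom k b (signConj k u φ) = topHom k b φ := by
  refine Ind.hom_ext fun e => ?_
  rw [topHom_mk, topHom_mk,
    average_conj k (koszulRep k X n) u _ _ (topMap_signConj k b u φ)]

lemma topHom_mk_tmul_topForm [Finite ι] [P.IsReduced] [Fintype P.weylGroup]
    (φ : X →ₗ[ℂ] Y) (x : X) :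
    topHom k b φ (Ind.mk k (koszulRep k X n) (x ⊗ₜ topForm b)) = ∑ w : P.weylGroup, signConj k w φ x := by
  rw [topHom_mk, average_apply]
  refine Finset.sum_congr rfl fun w _ => ?_
  rw [← topMap_signConj, topMap_tmul, topCoord_topForm, one_smul]

/-- The commutator of a linear map with `v - ½ ∑_{α > 0} k_α ⟨v, α^∨⟩ t_{s_α}`. -/
def tildeComm [Fintype ι] (v : ℂ ⊗[ℝ] V₀) (φ : X →ₗ[ℂ] Y) : X →ₗ[ℂ] Y :=
  Algebra.lsmul ℂ ℂ Y (Hecke.tilde k v) ∘ₗ φ - φ ∘ₗ Algebra.lsmul ℂ ℂ X (Hecke.tilde k v)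

variable [Fintype ι]

omit [FiniteDimensional ℝ V₀] in
lemma tildeComm_apply (v : ℂ ⊗[ℝ] V₀) (φ : X →ₗ[ℂ] Y) (x : X) :
    tildeComm k v φ x = Hecke.tilde k v • φ x - φ (Hecke.tilde k v • x) := rfl

variable [P.IsReduced] [Fintype P.weylGroup]

omit [FiniteDimensional ℝ V₀] in
-- The cochain x ⊗ y ↦ (v ∧ y)φ(x) has the commutator as its differential formed with ṽ. Averaging
-- commutes with that differential, and on the averaged map it agrees with the true one.
lemma exists_comp_koszulD_eq_topHom_tildeComm (v : ℂ ⊗[ℝ] V₀) (φ : X →ₗ[ℂ] Y) :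
    ∃ G : KoszulInd k X (n - 1) →ₗ[Hecke k] Y,
      G ∘ₗ koszulD k b X n = topHom k b (tildeComm k v φ) := by
  rcases n with _ | n
  -- When n = 0 the space V is zero, and so is the commutator.
  · have hv : v = 0 := by
      rw [← b.sum_repr v]
      exact Finset.sum_of_isEmpty _
    refine ⟨0, ?_⟩
    have h : tildeComm k v φ = 0 := by
      ext x
      simp [tildeComm_apply, hv]
    rw [h, map_zero, LinearMap.zero_comp]
  let g₀ : X ⊗[ℂ] ⋀[ℂ]^n (ℂ ⊗[ℝ] V₀) →ₗ[ℂ] Y := topMap b φ ∘ₗ (Ext.wedge v n).lTensor X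
  have hg₀ : delta k b (Hecke.tilde k) (n + 1) g₀ = topMap b (tildeComm k v φ) := by
    refine TensorProduct.ext' fun x y => ?_
    rw [delta_tmul, topMap_tmul, tildeComm_apply]
    have h1 : ∀ j, deltaBilin k (Hecke.tilde k) (n + 1) g₀ x y (b j) (b.coord j) =
        b.coord j v • topCoord b y • (Hecke.tilde k (b j) • φ x - φ (Hecke.tilde k (b j) • x)) := by
      intro j
      have h2 : ∀ x, g₀ (x ⊗ₜ Ext.contrSucc (b.coord j) n y) =
          (b.coord j v * topCoord b y) • φ x := by
        intro x
        rw [← topCoord_wedge_contr, ← topMap_tmul]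
        rfl
      rw [← mul_smul, smul_sub, smul_comm _ (Hecke.tilde k (b j)), ← h2, ← h2]
      rfl
    simp only [h1]
    let Φ : ℂ ⊗[ℝ] V₀ →ₗ[ℂ] Y :=
      { toFun := fun v => topCoord b y • (Hecke.tilde k v • φ x - φ (Hecke.tilde k v • x))
        map_add' := fun v v' => by
          simp only [map_add, add_smul, ← smul_add]
          congr 1
          abel
        map_smul' := fun c v => by
          simp only [map_smul, smul_assoc, RingHom.id_apply, ← smul_sub]
          rw [smul_comm] }
    have h3 : Φ v = ∑ j, b.coord j v • Φ (b j) := by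
      conv_lhs => rw [← b.sum_repr v]
      rw [map_sum]
      simp only [map_smul, Module.Basis.coord_apply]
    exact h3.symm
  have hg := average_rho k (koszulRep k X n) g₀
  refine ⟨Ind.lift (average k (koszulRep k X n) g₀) hg, Ind.hom_ext fun e => ?_⟩
  have h4 : (Ind.lift (average k (koszulRep k X n) g₀) hg).restrictScalars ℂ ∘ₗ Ind.mk k _ =
      average k (koszulRep k X n) g₀ := LinearMap.ext fun e => Ind.lift_mk _ hg e
  have h5 := map_koszulD_mk k b (n + 1) (Ind.lift (average k (koszulRep k X n) g₀) hg) e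
  have h6 := delta_f_eq_delta_tilde k b (n + 1) (average k (koszulRep k X n) g₀) hg
  have h7 := delta_tilde_average k b (n + 1) g₀
  rw [topHom_mk, ← hg₀, ← h7]
  refine h5.trans (Eq.trans ?_ (LinearMap.congr_fun h6 e))
  exact congrArg (fun g => delta k b (Hecke.f k) (n + 1) g e) h4

end

end GradedHecke

/-! ### Orthogonality under the trace pairing -/

namespace GradedHecke

noncomputable section

variable {ι V₀ N : Type u} [AddCommGroup V₀] [Module ℝ V₀] [AddCommGroup N] [Module ℝ N]
  {P : RootPairing ι ℝ V₀ N} {Δ : SimpleRoots P} [Fintype ι]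
  (k : Parameter Δ) {n : ℕ} (b : Module.Basis (Fin n) ℂ (ℂ ⊗[ℝ] V₀))
  {X : Type u} [AddCommGroup X] [Module ℂ X] [Module (Hecke k) X] [IsScalarTower ℂ (Hecke k) X]
  {Y : Type u} [AddCommGroup Y] [Module ℂ Y] [Module (Hecke k) Y] [IsScalarTower ℂ (Hecke k) Y]

lemma mem_twistedHom_iff (ψ : Y →ₗ[ℂ] X) :
    ψ ∈ twistedHom k X Y ↔ (∀ w, signConj k w ψ = ψ) ∧ ∀ v, tildeComm k v ψ = 0 := by
  have hw : ∀ w : P.weylGroup, Hecke.t k w⁻¹ * Hecke.t k w = 1 := fun w => by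
    rw [← map_mul, inv_mul_cancel, map_one]
  have hw' : ∀ w : P.weylGroup, Hecke.t k w * Hecke.t k w⁻¹ = 1 := fun w => by
    rw [← map_mul, mul_inv_cancel, map_one]
  refine and_congr (forall_congr' fun w => ⟨fun h => LinearMap.ext fun y => ?_, fun h y => ?_⟩)
    (forall_congr' fun v => ⟨fun h => LinearMap.ext fun y => ?_, fun h y => ?_⟩)
  · rw [signConj_apply, ← h, ← mul_smul, hw', one_smul]
  · conv_lhs => rw [← h]
    rw [signConj_apply, ← mul_smul (Hecke.t k w⁻¹), hw, one_smul]
  · rw [tildeComm_apply, h, sub_self, LinearMap.zero_apply]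
  · have := LinearMap.congr_fun h y
    rw [tildeComm_apply, LinearMap.zero_apply, sub_eq_zero] at this
    exact this.symm

/-- By cyclicity of the trace, taking commutators is skew-adjoint. -/
lemma tracePairing_tildeComm (v : ℂ ⊗[ℝ] V₀) (ψ : Y →ₗ[ℂ] X) (φ : X →ₗ[ℂ] Y) :
    tracePairing X Y ψ (tildeComm k v φ) = -tracePairing X Y (tildeComm k v ψ) φ := by
  have h := LinearMap.trace_mul_comm ℂ (ψ ∘ₗ φ) (Algebra.lsmul ℂ ℂ X (Hecke.tilde k v))
  rw [tracePairing_apply, tracePairing_apply, tildeComm, tildeComm, LinearMap.comp_sub,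
    LinearMap.sub_comp, map_sub, map_sub, neg_sub]
  exact congrArg₂ _ rfl h

omit [Fintype ι] in
lemma tracePairing_signConj [FiniteDimensional ℝ V₀] [Finite ι] [P.IsReduced] (w : P.weylGroup)
    (ψ : Y →ₗ[ℂ] X) (φ : X →ₗ[ℂ] Y) :
    tracePairing X Y ψ (signConj k w φ) = tracePairing X Y (signConj k w⁻¹ ψ) φ := by
  have h := LinearMap.trace_mul_comm ℂ (ψ ∘ₗ Algebra.lsmul ℂ ℂ Y (Hecke.t k w) ∘ₗ φ)
    (Algebra.lsmul ℂ ℂ X (Hecke.t k w⁻¹))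
  rw [tracePairing_apply, tracePairing_apply, signConj, signConj, LinearMap.comp_smul,
    LinearMap.smul_comp, map_smul, map_smul, sgn_inv Δ, inv_inv]
  exact congrArg _ h

variable [FiniteDimensional ℝ V₀] [P.IsReduced] [FiniteDimensional ℂ X]

/-- The twisted intertwiners are the orthogonal complement of the linear maps that define the zero
extension. -/
lemma mem_twistedHom_iff_tracePairing [Fintype P.weylGroup] {E : Type*} [AddCommGroup E]
    [Module ℂ E] (Θ : (KoszulInd k X n →ₗ[Hecke k] Y) →ₗ[ℂ] E)
    (hΘ : ∀ F, Θ F = 0 ↔ ∃ G : KoszulInd k X (n - 1) →ₗ[Hecke k] Y, G ∘ₗ koszulD k b X n = F)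
    (ψ : Y →ₗ[ℂ] X) :
    ψ ∈ twistedHom k X Y ↔ ∀ φ, (Θ ∘ₗ topHom k b) φ = 0 → tracePairing X Y ψ φ = 0 := by
  rw [mem_twistedHom_iff]
  constructor
  · rintro ⟨h1, h2⟩ φ hφ
    obtain ⟨G, hG⟩ := (hΘ _).1 hφ
    let g : X ⊗[ℂ] ⋀[ℂ]^(n - 1) (ℂ ⊗[ℝ] V₀) →ₗ[ℂ] Y := G.restrictScalars ℂ ∘ₗ Ind.mk k _
    have hg : ∀ w e, g (koszulRep k X (n - 1) w e) = Hecke.t k w • g e := by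
      intro w e
      change G _ = _ • G _
      rw [Ind.mk_rho, map_smul]
    -- Evaluating the coboundary at x ⊗ `topForm b`, with ṽ in place of v, writes the sum of the
    -- conjugates of φ as a sum of commutators. Pairing with ψ gives |W| tr(ψφ) on the left and 0 on
    -- the right.
    have e1 : ∑ w : P.weylGroup, signConj k w φ = ∑ j, tildeComm k (b j)
        (g ∘ₗ (TensorProduct.mk ℂ X _).flip (Ext.contr (b.coord j) n (topForm b))) := by
      refine LinearMap.ext fun x => ?_
      rw [LinearMap.sum_apply, LinearMap.sum_apply, ← topHom_mk_tmul_topForm k b, ← hG,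
        LinearMap.comp_apply, map_koszulD_mk]
      refine (LinearMap.congr_fun (delta_f_eq_delta_tilde k b n g hg) _).trans ?_
      rw [delta_tmul]
      rfl
    have e2 := congrArg (tracePairing X Y ψ) e1
    rw [map_sum, map_sum] at e2
    simp only [tracePairing_signConj, tracePairing_tildeComm, h1, h2, map_zero,
      LinearMap.zero_apply, neg_zero, Finset.sum_const_zero, Finset.sum_const, Finset.card_univ,
      smul_eq_zero, Fintype.card_ne_zero, false_or] at e2
    exact e2
  · intro h
    refine ⟨fun w => ?_, fun v => ?_⟩
    · refine tracePairing_injective (LinearMap.ext fun φ => ?_)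
      -- Sign-twisted conjugation does not change the average, so this difference already maps to
      -- zero. Orthogonality to all such differences says, by adjointness, that ψ is invariant.
      have h1 := h (signConj k w⁻¹ φ - φ)
        (by rw [LinearMap.comp_apply, map_sub, topHom_signConj, sub_self, map_zero])
      rwa [map_sub, sub_eq_zero, tracePairing_signConj, inv_inv] at h1
    · refine tracePairing_injective (LinearMap.ext fun φ => ?_)
      have h1 := h (tildeComm k v φ)
        ((hΘ _).2 (exists_comp_koszulD_eq_topHom_tildeComm k b v φ))
      rw [tracePairing_tildeComm, neg_eq_zero] at h1
      rw [h1, map_zero, LinearMap.zero_apply]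

end

/-! ### The dimension of the top extensions -/

noncomputable section

variable {ι V₀ N : Type u} [AddCommGroup V₀] [Module ℝ V₀] [AddCommGroup N] [Module ℝ N]
  {P : RootPairing ι ℝ V₀ N} {Δ : SimpleRoots P} [Fintype ι] [FiniteDimensional ℝ V₀] [P.IsReduced]
  (k : Parameter Δ) (X Y : ModuleCat.{u} (Hecke k)) [FiniteDimensional ℂ X] [FiniteDimensional ℂ Y]

/-- The dimension of the extensions of top degree of finite-dimensional modules. -/
theorem finrank_ext_eq_finrank_twistedHom :
    Module.finrank ℂ (Abelian.Ext X Y (Module.finrank ℂ (ℂ ⊗[ℝ] V₀))) =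
      Module.finrank ℂ (twistedHom k X Y) ∧
    Module.Finite ℂ (Abelian.Ext X Y (Module.finrank ℂ (ℂ ⊗[ℝ] V₀))) := by
  have := Fintype.ofFinite P.weylGroup
  let b := Module.finBasis ℂ (ℂ ⊗[ℝ] V₀)
  have hn : koszulDSucc k b (X := X) (Module.finrank ℂ (ℂ ⊗[ℝ] V₀)) = 0 := by
    refine Ind.hom_ext fun e => ?_
    induction e with
    | zero => simp
    | add x y hx hy => rw [map_add, map_add, hx, hy, map_add]
    | tmul x y =>
      have := subsingleton_exteriorPower_succ b
      rw [Subsingleton.elim y 0, TensorProduct.tmul_zero, map_zero, map_zero, map_zero]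
  obtain ⟨Θ, hΘ, hΘ'⟩ := exists_linearMap_ext b Y _ hn
  have hs : Function.Surjective (Θ ∘ₗ topHom k b) := hΘ.comp (topHom_surjective k b)
  exact ⟨finrank_eq_of_mem_iff_tracePairing (Θ ∘ₗ topHom k b) hs (twistedHom k X Y)
    (mem_twistedHom_iff_tracePairing k b Θ hΘ'), Module.Finite.of_surjective _ hs⟩

end

end GradedHecke

namespace GradedHecke

noncomputable section

/-! ### Twisted intertwiners of irreducible modules -/

variable {ι V₀ N : Type u} [AddCommGroup V₀] [Module ℝ V₀] [AddCommGroup N] [Module ℝ N]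
  {P : RootPairing ι ℝ V₀ N} {Δ : SimpleRoots P} [Fintype ι]

section

variable (k : Parameter Δ)
  {X : Type u} [AddCommGroup X] [Module ℂ X] [Module (Hecke k) X] [IsScalarTower ℂ (Hecke k) X]
  {Y : Type u} [AddCommGroup Y] [Module ℂ Y] [Module (Hecke k) Y] [IsScalarTower ℂ (Hecke k) Y]

lemma Hecke.shift_smul_mem {S : Submodule ℂ X} (ht : ∀ w, ∀ x ∈ S, Hecke.t k w • x ∈ S)
    (v : ℂ ⊗[ℝ] V₀) {x : X} (hx : x ∈ S) : Hecke.shift k v • x ∈ S := by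
  classical
  rw [Hecke.shift_apply, Finset.sum_smul]
  refine sum_mem fun i _ => ?_
  split_ifs
  · rw [smul_assoc]
    exact S.smul_mem _ (ht _ x hx)
  · rw [zero_smul]
    exact S.zero_mem

/-- A subspace that is stable under the equivariant generators is a submodule. -/
def submoduleOfTilde (S : Submodule ℂ X) (ht : ∀ w, ∀ x ∈ S, Hecke.t k w • x ∈ S)
    (hv : ∀ v, ∀ x ∈ S, Hecke.tilde k v • x ∈ S) : Submodule (Hecke k) X where
  carrier := S
  add_mem' := S.add_mem
  zero_mem' := S.zero_mem
  smul_mem' h x hx := by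
    change h • x ∈ S
    induction h using Hecke.induction_left with
    | one => rwa [one_smul]
    | add a b ha hb => rw [add_smul]; exact S.add_mem ha hb
    | smul c a ha => rw [smul_assoc]; exact S.smul_mem c ha
    | t_mul w a ha => rw [mul_smul]; exact ht w _ ha
    | f_mul v a ha =>
      rw [← sub_add_cancel (Hecke.f k v) (Hecke.shift k v), ← Hecke.tilde_apply, mul_smul, add_smul]
      exact S.add_mem (hv v _ ha) (Hecke.shift_smul_mem k ht v ha)

lemma eq_bot_or_eq_top_of_tilde [IsSimpleModule (Hecke k) X] (S : Submodule ℂ X)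
    (ht : ∀ w, ∀ x ∈ S, Hecke.t k w • x ∈ S) (hv : ∀ v, ∀ x ∈ S, Hecke.tilde k v • x ∈ S) :
    S = ⊥ ∨ S = ⊤ := by
  rcases eq_bot_or_eq_top (submoduleOfTilde k S ht hv) with h | h
  · left
    rw [Submodule.eq_bot_iff] at h ⊢
    exact h
  · right
    rw [Submodule.eq_top_iff'] at h ⊢
    exact h

/-- Schur's argument: the signs do not affect stability of the kernel and the range under the t_w,
and stability under the t_w and ṽ is stability under ℍ. -/
lemma bijective_of_mem_twistedHom [IsSimpleModule (Hecke k) X] [IsSimpleModule (Hecke k) Y]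
    {ψ : Y →ₗ[ℂ] X} (hψ : ψ ∈ twistedHom k X Y) (h0 : ψ ≠ 0) : Function.Bijective ψ := by
  have hsgn : ∀ w : P.weylGroup, sgn P w ≠ 0 := fun w =>
    right_ne_zero_of_mul_eq_one (sgn_inv_mul_sgn w)
  constructor
  · rw [← LinearMap.ker_eq_bot]
    refine (eq_bot_or_eq_top_of_tilde k (LinearMap.ker ψ) (fun w y hy => ?_)
      fun v y hy => ?_).resolve_right fun h => h0 (LinearMap.ker_eq_top.1 h)
    · rw [LinearMap.mem_ker] at hy ⊢
      rw [hψ.1, hy, smul_zero, smul_zero]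
    · rw [LinearMap.mem_ker] at hy ⊢
      rw [hψ.2, hy, smul_zero]
  · rw [← LinearMap.range_eq_top]
    refine (eq_bot_or_eq_top_of_tilde k (LinearMap.range ψ) (fun w x hx => ?_)
      fun v x hx => ?_).resolve_left fun h => h0 (LinearMap.range_eq_bot.1 h)
    · obtain ⟨y, rfl⟩ := hx
      refine ⟨(sgn P w)⁻¹ • Hecke.t k w • y, ?_⟩
      rw [map_smul, hψ.1, inv_smul_smul₀ (hsgn w)]
    · obtain ⟨y, rfl⟩ := hx
      exact ⟨Hecke.tilde k v • y, hψ.2 v y⟩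

/-- A linear map that commutes with the equivariant generators is linear over `ℍ`. -/
lemma map_smul_of_tilde (θ : X →ₗ[ℂ] Y) (ht : ∀ w x, θ (Hecke.t k w • x) = Hecke.t k w • θ x)
    (hv : ∀ v x, θ (Hecke.tilde k v • x) = Hecke.tilde k v • θ x) (h : Hecke k) (x : X) :
    θ (h • x) = h • θ x := by
  classical
  induction h using Hecke.induction_left with
  | one => rw [one_smul, one_smul]
  | add a b ha hb => rw [add_smul, add_smul, map_add, ha, hb]
  | smul c a ha => rw [smul_assoc, smul_assoc, map_smul, ha]
  | t_mul w a ha => rw [mul_smul, mul_smul, ht, ha]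
  | f_mul v a ha =>
    have hs : ∀ x, θ (Hecke.shift k v • x) = Hecke.shift k v • θ x := by
      intro x
      rw [Hecke.shift_apply, Finset.sum_smul, Finset.sum_smul, map_sum]
      refine Finset.sum_congr rfl fun i _ => ?_
      split_ifs
      · rw [smul_assoc, smul_assoc, map_smul, ht]
      · rw [zero_smul, zero_smul, map_zero]
    rw [← sub_add_cancel (Hecke.f k v) (Hecke.shift k v), ← Hecke.tilde_apply, mul_smul, mul_smul,
      add_smul, add_smul, map_add, hv, hs, ha]

lemma exists_smul_eq_of_mem_twistedHom [IsSimpleModule (Hecke k) X] [IsSimpleModule (Hecke k) Y]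
    [FiniteDimensional ℂ X] {ψ ψ' : Y →ₗ[ℂ] X} (hψ : ψ ∈ twistedHom k X Y) (h0 : ψ ≠ 0)
    (hψ' : ψ' ∈ twistedHom k X Y) : ∃ c : ℂ, c • ψ = ψ' := by
  have hsgn : ∀ w : P.weylGroup, sgn P w ≠ 0 := fun w =>
    right_ne_zero_of_mul_eq_one (sgn_inv_mul_sgn w)
  let e := LinearEquiv.ofBijective ψ (bijective_of_mem_twistedHom k hψ h0)
  have he : ∀ y, e.symm (ψ y) = y := e.symm_apply_apply
  have hsurj := (bijective_of_mem_twistedHom k hψ h0).2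
  have ht : ∀ (w : P.weylGroup) x, (ψ' ∘ₗ e.symm.toLinearMap) (Hecke.t k w • x) =
      Hecke.t k w • (ψ' ∘ₗ e.symm.toLinearMap) x := by
    intro w x
    obtain ⟨y, rfl⟩ := hsurj x
    have h1 : Hecke.t k w • ψ y = ψ ((sgn P w)⁻¹ • Hecke.t k w • y) := by
      rw [map_smul, hψ.1, inv_smul_smul₀ (hsgn w)]
    rw [h1, LinearMap.comp_apply, LinearMap.comp_apply, LinearEquiv.coe_coe, he, he, map_smul,
      hψ'.1, inv_smul_smul₀ (hsgn w)]
  have hv : ∀ v x, (ψ' ∘ₗ e.symm.toLinearMap) (Hecke.tilde k v • x) =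
      Hecke.tilde k v • (ψ' ∘ₗ e.symm.toLinearMap) x := by
    intro v x
    obtain ⟨y, rfl⟩ := hsurj x
    rw [← hψ.2, LinearMap.comp_apply, LinearMap.comp_apply, LinearEquiv.coe_coe, he, he, hψ'.2]
  -- The signs of ψ' and ψ⁻¹ cancel, so the composite is honestly ℍ-linear and Schur's lemma over ℂ
  -- makes it a scalar.
  let θ : Module.End (Hecke k) X :=
    { toFun := ψ' ∘ₗ e.symm.toLinearMap
      map_add' := map_add _
      map_smul' := map_smul_of_tilde k _ ht hv }
  obtain ⟨c, hc⟩ := (IsSimpleModule.algebraMap_end_bijective_of_isAlgClosed ℂ (A := Hecke k)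
    (V := X)).2 θ
  refine ⟨c, LinearMap.ext fun y => ?_⟩
  have h2 := LinearMap.congr_fun hc (ψ y)
  change c • ψ y = ψ' (e.symm (ψ y)) at h2
  rw [he] at h2
  exact h2

end

/-! ### The module `𝔻(Y)` -/

variable [FiniteDimensional ℝ V₀] [P.IsReduced] (k : Parameter Δ)
  (Y : ModuleCat.{u} (Hecke k))

/-- The twist by which `ℍ` acts on the double dual. -/
def doubleTwist (h : Hecke k) : Hecke k :=
  (Hecke.bullet k (Hecke.iwahoriMatsumoto k (Hecke.star k h).unop)).unop

lemma doubleTwist_t (w : P.weylGroup) : doubleTwist k (Hecke.t k w) = sgn P w • Hecke.t k w := by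
  rw [doubleTwist, Hecke.star_t, MulOpposite.unop_op, Hecke.iwahoriMatsumoto_t, map_smul,
    Hecke.bullet_t, MulOpposite.unop_smul, MulOpposite.unop_op, inv_inv, sgn_inv Δ]

/-- The sign in −w₀(v) is removed by ι, the two factors sgn(w₀) cancel, and what remains is
conjugation by t_{w₀}. Since the shift is negated by the signs of the reflections, ṽ itself is
fixed. -/
lemma doubleTwist_f (v : ℂ ⊗[ℝ] V₀) :
    doubleTwist k (Hecke.f k v) = Hecke.tilde k v - Hecke.shift k v := by
  rw [doubleTwist, Hecke.star_f, MulOpposite.unop_op]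
  simp only [map_mul, map_neg, map_smul, Hecke.iwahoriMatsumoto_t, Hecke.iwahoriMatsumoto_f,
    neg_neg, Hecke.bullet_t, Hecke.bullet_f, MulOpposite.unop_mul, MulOpposite.unop_smul,
    MulOpposite.unop_op, inv_inv]
  rw [← Hecke.t_longest_mul_f, smul_mul_assoc, mul_smul_comm, mul_smul_comm, smul_smul,
    sgn_inv_mul_sgn, one_smul, mul_assoc]

lemma doubleTwist_one : doubleTwist k 1 = 1 := by simp [doubleTwist]

lemma doubleTwist_add (a b : Hecke k) :
    doubleTwist k (a + b) = doubleTwist k a + doubleTwist k b := by simp [doubleTwist]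

lemma doubleTwist_mul (a b : Hecke k) :
    doubleTwist k (a * b) = doubleTwist k a * doubleTwist k b := by simp [doubleTwist]

lemma doubleTwist_smul (c : ℂ) (a : Hecke k) :
    doubleTwist k (c • a) = c • doubleTwist k a := by simp [doubleTwist]

lemma doubleTwist_algebraMap (c : ℂ) :
    doubleTwist k (algebraMap ℂ _ c) = algebraMap ℂ _ c := by
  rw [Algebra.algebraMap_eq_smul_one, doubleTwist_smul, doubleTwist_one]

/-- A map with the sign rule for W anticommutes with the shift, since reflections have sign −1. This
turns ṽ minus the shift on Y into v = ṽ plus the shift on X. -/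
lemma mem_twistedHom_iff_doubleTwist {X : Type u} [AddCommGroup X] [Module ℂ X]
    [Module (Hecke k) X] [IsScalarTower ℂ (Hecke k) X] {Y : Type u} [AddCommGroup Y] [Module ℂ Y]
    [Module (Hecke k) Y] [IsScalarTower ℂ (Hecke k) Y] (ψ : Y →ₗ[ℂ] X) :
    ψ ∈ twistedHom k X Y ↔ ∀ h y, ψ (doubleTwist k h • y) = h • ψ y := by
  classical
  have hs : (∀ (w : P.weylGroup) y, ψ (Hecke.t k w • y) = sgn P w • Hecke.t k w • ψ y) →
      ∀ v y, ψ (Hecke.shift k v • y) = -(Hecke.shift k v • ψ y) := by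
    intro h v y
    rw [Hecke.shift_apply, Finset.sum_smul, Finset.sum_smul, map_sum, ← Finset.sum_neg_distrib]
    refine Finset.sum_congr rfl fun i _ => ?_
    split_ifs
    · rw [smul_assoc, smul_assoc, map_smul, h, sgn_refl, neg_one_smul, smul_neg]
    · rw [zero_smul, zero_smul, map_zero, neg_zero]
  constructor
  · rintro ⟨ht, hv⟩ h
    induction h using Hecke.induction_left with
    | one => intro y; rw [doubleTwist_one, one_smul, one_smul]
    | add a b ha hb => intro y; rw [doubleTwist_add, add_smul, add_smul, map_add, ha, hb]
    | smul c a ha => intro y; rw [doubleTwist_smul, smul_assoc, smul_assoc, map_smul, ha]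
    | t_mul w a ha =>
      intro y
      rw [doubleTwist_mul, doubleTwist_t, mul_smul, mul_smul, smul_assoc, map_smul, ht, smul_smul,
        sgn_mul_self Δ, one_smul, ha]
    | f_mul v a ha =>
      intro y
      rw [doubleTwist_mul, doubleTwist_f, mul_smul, mul_smul, sub_smul, map_sub, hv, hs ht, ha,
        Hecke.tilde_apply, sub_smul, sub_neg_eq_add, sub_add_cancel]
  · intro h
    have ht : ∀ (w : P.weylGroup) y, ψ (Hecke.t k w • y) = sgn P w • Hecke.t k w • ψ y := by
      intro w y
      rw [← h (Hecke.t k w) y, doubleTwist_t, smul_assoc, map_smul ψ, smul_smul, sgn_mul_self Δ,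
        one_smul]
    refine ⟨ht, fun v y => ?_⟩
    have h1 := h (Hecke.f k v) y
    rw [doubleTwist_f, sub_smul, map_sub, hs ht, sub_neg_eq_add] at h1
    have h2 : Hecke.tilde k v • ψ y = Hecke.f k v • ψ y - Hecke.shift k v • ψ y := by
      rw [Hecke.tilde_apply, sub_smul]
    rw [h2, ← h1, add_sub_cancel_right]

omit [Fintype ι] [P.IsReduced] in
-- The scalars on the twisted dual act through ℍ. They agree with the usual ones because ι and • are
-- ℂ-linear, so its linear functionals are those of the ordinary dual of Y.
lemma twist_dual_smul_apply (c : ℂ) (ψ : twist (Hecke.iwahoriMatsumoto k) (dual (Hecke.bullet k) Y))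
    (y : Y) : (show Module.Dual ℂ Y from c • ψ) y = c • (show Module.Dual ℂ Y from ψ) y := by
  change (show Module.Dual ℂ Y from ψ) ((Hecke.bullet k (Hecke.iwahoriMatsumoto k
    (algebraMap ℂ _ c))).unop • y) = _
  rw [AlgHom.commutes, AlgHom.commutes, MulOpposite.algebraMap_apply, MulOpposite.unop_op,
    algebraMap_smul, map_smul]

/-- The evaluation map of `Y` into `𝔻(Y)`, as a map of sets. -/
def evalDualFun (y : Y) : dualizing k Y :=
  (show Module.Dual ℂ (twist (Hecke.iwahoriMatsumoto k) (dual (Hecke.bullet k) Y)) from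
    { toFun := fun ψ => (show Module.Dual ℂ Y from ψ) y
      map_add' := fun _ _ => rfl
      map_smul' := fun c ψ => twist_dual_smul_apply k Y c ψ y })

lemma smul_evalDualFun (h : Hecke k) (y : Y) :
    h • evalDualFun k Y y = evalDualFun k Y (doubleTwist k h • y) := rfl

/-- The evaluation map of `Y` into `𝔻(Y)`. -/
def evalDual : Y →ₗ[ℂ] dualizing k Y where
  toFun := evalDualFun k Y
  map_add' y y' := LinearMap.ext fun ψ => map_add (show Module.Dual ℂ Y from ψ) y y'
  map_smul' c y := by
    rw [RingHom.id_apply, ← algebraMap_smul (Hecke k) c (evalDualFun k Y y), smul_evalDualFun,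
      doubleTwist_algebraMap, algebraMap_smul]

lemma smul_evalDual (h : Hecke k) (y : Y) :
    h • evalDual k Y y = evalDual k Y (doubleTwist k h • y) := rfl

lemma evalDual_bijective [FiniteDimensional ℂ Y] : Function.Bijective (evalDual k Y) := by
  constructor
  · rw [injective_iff_map_eq_zero]
    intro y hy
    refine (Module.forall_dual_apply_eq_zero_iff ℂ y).1 fun ψ => ?_
    exact LinearMap.congr_fun
      (show (show Module.Dual ℂ (twist (Hecke.iwahoriMatsumoto k) (dual (Hecke.bullet k) Y)) from
        evalDual k Y y) = 0 from hy) ψ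
  · intro Φ
    let e : Module.Dual ℂ Y →ₗ[ℂ] twist (Hecke.iwahoriMatsumoto k) (dual (Hecke.bullet k) Y) :=
      { toFun := fun ψ => ψ
        map_add' := fun _ _ => rfl
        map_smul' := fun c ψ => LinearMap.ext fun y => (twist_dual_smul_apply k Y c ψ y).symm }
    obtain ⟨y, hy⟩ := (Module.evalEquiv ℂ Y).surjective
      ((show Module.Dual ℂ (twist (Hecke.iwahoriMatsumoto k) (dual (Hecke.bullet k) Y)) from Φ) ∘ₗ e)
    exact ⟨y, LinearMap.ext fun ψ => LinearMap.congr_fun hy ψ⟩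

variable [FiniteDimensional ℂ Y] (X : ModuleCat.{u} (Hecke k)) [FiniteDimensional ℂ X]
  [IsSimpleModule (Hecke k) X] [IsSimpleModule (Hecke k) Y]

omit [FiniteDimensional ℂ X] in
-- Through evaluation 𝔻(Y) is Y acted on via `doubleTwist`, so ℍ-linear maps 𝔻(Y) → X are the
-- twisted intertwiners. A nonzero one is bijective by irreducibility.
lemma nonempty_iso_dualizing_iff :
    Nonempty (X ≅ dualizing k Y) ↔ ∃ ψ ∈ twistedHom k X Y, ψ ≠ 0 := by
  constructor
  · rintro ⟨e⟩
    let ψ : Y →ₗ[ℂ] X := e.inv.hom.restrictScalars ℂ ∘ₗ evalDual k Y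
    refine ⟨ψ, (mem_twistedHom_iff_doubleTwist k ψ).2 fun h y => ?_, fun h0 => ?_⟩
    · change e.inv.hom (evalDual k Y (doubleTwist k h • y)) = h • e.inv.hom (evalDual k Y y)
      rw [← smul_evalDual, map_smul]
    · have := IsSimpleModule.nontrivial (Hecke k) Y
      obtain ⟨y, hy⟩ := exists_ne (0 : Y)
      have hinj : Function.Injective e.inv.hom := (ModuleCat.mono_iff_injective e.inv).1 inferInstance
      refine hy ((evalDual_bijective k Y).1 (hinj ?_))
      rw [map_zero, map_zero]
      exact LinearMap.congr_fun h0 y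
  · rintro ⟨ψ, hψ, h0⟩
    let e₁ := LinearEquiv.ofBijective ψ (bijective_of_mem_twistedHom k hψ h0)
    let e₂ := LinearEquiv.ofBijective (evalDual k Y) (evalDual_bijective k Y)
    have h1 := (mem_twistedHom_iff_doubleTwist k ψ).1 hψ
    let e : X ≃ₗ[Hecke k] dualizing k Y :=
      { toFun := fun x => evalDual k Y (e₁.symm x)
        invFun := fun z => e₁ (e₂.symm z)
        left_inv := fun x => by
          change e₁ (e₂.symm (e₂ (e₁.symm x))) = x
          rw [e₂.symm_apply_apply, e₁.apply_symm_apply]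
        right_inv := fun z => by
          change e₂ (e₁.symm (e₁ (e₂.symm z))) = z
          rw [e₁.symm_apply_apply, e₂.apply_symm_apply]
        map_add' := fun x x' => by rw [map_add, map_add]
        map_smul' := fun h x => by
          obtain ⟨y, rfl⟩ := e₁.surjective x
          have h2 : h • e₁ y = e₁ (doubleTwist k h • y) := (h1 h y).symm
          rw [RingHom.id_apply, h2, e₁.symm_apply_apply, e₁.symm_apply_apply, smul_evalDual] }
    exact ⟨e.toModuleIso⟩

omit [FiniteDimensional ℝ V₀] [P.IsReduced] in
/-- The dimension of the space of twisted intertwiners of irreducible modules. -/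
lemma finrank_twistedHom_eq_one {ψ : Y →ₗ[ℂ] X} (hψ : ψ ∈ twistedHom k X Y) (h0 : ψ ≠ 0) :
    Module.finrank ℂ (twistedHom k X Y) = 1 := by
  refine finrank_eq_one_iff'.2 ⟨⟨ψ, hψ⟩, fun h => h0 (congrArg Subtype.val h), fun ψ' => ?_⟩
  obtain ⟨c, hc⟩ := exists_smul_eq_of_mem_twistedHom k hψ h0 ψ'.2
  exact ⟨c, Subtype.ext hc⟩

end

end GradedHecke

/-! ### The duality theorem -/

theorem mainTheorem9 {ι V₀ N : Type u} [Finite ι]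
    [AddCommGroup V₀] [Module ℝ V₀] [FiniteDimensional ℝ V₀] [AddCommGroup N] [Module ℝ N]
    (P : RootPairing ι ℝ V₀ N) [P.IsReduced] (Δ : GradedHecke.SimpleRoots P)
    (k : GradedHecke.Parameter Δ) (X Y : ModuleCat.{u} (GradedHecke.Hecke k))
    [FiniteDimensional ℂ X] [FiniteDimensional ℂ Y]
    [IsSimpleModule (GradedHecke.Hecke k) X] [IsSimpleModule (GradedHecke.Hecke k) Y] :
    (Nonempty (X ≅ GradedHecke.dualizing k Y) →
      Nonempty (Abelian.Ext X Y (Module.finrank ℂ (ℂ ⊗[ℝ] V₀)) ≃ₗ[ℂ] ℂ)) ∧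
    (¬ Nonempty (X ≅ GradedHecke.dualizing k Y) →
      Subsingleton (Abelian.Ext X Y (Module.finrank ℂ (ℂ ⊗[ℝ] V₀)))) := by
  have := Fintype.ofFinite ι
  obtain ⟨hd, _⟩ := GradedHecke.finrank_ext_eq_finrank_twistedHom k X Y
  rw [GradedHecke.nonempty_iso_dualizing_iff k Y X]
  refine ⟨fun ⟨ψ, hψ, h0⟩ => ?_, fun h => ?_⟩
  · refine FiniteDimensional.nonempty_linearEquiv_of_finrank_eq ?_
    rw [hd, GradedHecke.finrank_twistedHom_eq_one k Y X hψ h0, Module.finrank_self]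
  · have hbot : GradedHecke.twistedHom k X Y = ⊥ := by
      rw [Submodule.eq_bot_iff]
      exact fun ψ hψ => by_contra fun h0 => h ⟨ψ, hψ, h0⟩
    rw [hbot, finrank_bot] at hd
    exact Module.finrank_zero_iff.1 hd
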